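/- Let $n\ge 2$ and $\alpha\in(0,1)$. Let $g\in C^\infty(\mathbb{R}^n,\mathbb{R}^{n\times n}_{sym})$ be uniformly elliptic with $g=\mathrm{id}$ outside the closure of some bounded open set, write $|g|=\det g$, and let $$\widetilde g=\sqrt{|g|}\begin{pmatrix} g^{-1}&0\\0&1\end{pmatrix}.$$ Let $\mathbb{R}^{n+1}_+=\{(x,x_{n+1}):x\in\mathbb{R}^n,\ x_{n+1}>0\}$, $\mathbb{R}^n_+=\{x\in\mathbb{R}^n:x_n>0\}$ and $\mathbb{R}^n_-=\{x\in\mathbb{R}^n: x_n\le 0\}$. Let $X_\alpha=\dot H^1(\mathbb{R}^{n+1}_+,x_{n+1}^{1-2\alpha})$ be the closure of $C_0^\infty(\overline{\mathbb{R}^{n+1}_+})$ with respect to the norm $\big(\int_{\mathbb{R}^{n+1}_+}x_{n+1}^{1-2\alpha}|\nabla\widetilde v|^2\,d(x,x_{n+1})\big)^{1/2}$; its elements have traces $\widetilde v|_{\mathbb{R}^n\times\{0\}}\in L^{2n/(n-2\alpha)}(\mathbb{R}^n)$, defined by density. Let $\delta\in[0,\tfrac12)$, $f_D\in H^{\alpha+\delta}(\mathbb{R}^n)$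 and $f_N\in H^{-\alpha+\delta}(\mathbb{R}^n)$. A function $\widetilde v\in X_\alpha$ with $\widetilde v|_{\mathbb{R}^n\times\{0\}}\in H^\alpha(\mathbb{R}^n)$ is called a weak solution of the mixed Dirichlet–Neumann problem $$\nabla\cdot x_{n+1}^{1-2\alpha}\widetilde g\nabla\widetilde v=0\ \text{in }\mathbb{R}^{n+1}_+,\qquad \widetilde v=f_D\ \text{on }\mathbb{R}^n_+\times\{0\},\qquad \lim_{x_{n+1}\to0}x_{n+1}^{1-2\alpha}\partial_{n+1}\widetilde v=f_N\ \text{on }\mathbb{R}^n_-\times\{0\},$$ if $\widetilde v|_{\mathbb{R}^n\times\{0\}}=f_D$ a.e. on $\mathbb{R}^n_+$ and $$\int_{\mathbb{R}^{n+1}_+}x_{n+1}^{1-2\alpha}\,\widetilde g\nabla\widetilde v\cdot\nabla\widetilde\varphi\,d(x,x_{n+1})=-\big\langle\sqrt{|g|}f_N,\ \widetilde\varphi|_{\mathbb{R}^n\times\{0\}}\big\rangle_{H^{-\alpha}(\mathbb{R}^n),H^{\alpha}(\mathbb{R}^n)}$$ for all $\widetilde\varphi\in X_\alpha$ whose trace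 belongs to $H^\alpha(\mathbb{R}^n)$ and vanishes a.e. on $\mathbb{R}^n_+$. Then for every $\epsilon\in(0,\delta)$ there is a constant $C>0$, depending only on $n,\alpha,g,\delta,\epsilon$ (and not on $f_D$, $f_N$, $\widetilde v$), such that for every such weak solution $\widetilde v$ one has $\widetilde v|_{\mathbb{R}^n\times\{0\}}\in H^{\alpha+\delta-\epsilon}(\mathbb{R}^n)$ and $$\|\widetilde v|_{\mathbb{R}^n\times\{0\}}\|_{H^{\alpha+\delta-\epsilon}(\mathbb{R}^n)}\le C\big(\|f_D\|_{H^{\alpha+\delta}(\mathbb{R}^n)}+\|\sqrt{|g|}\,f_N\|_{H^{-\alpha+\delta}(\mathbb{R}^n)}+\|\widetilde v|_{\mathbb{R}^n\times\{0\}}\|_{H^{\alpha}(\mathbb{R}^n)}\big).$$ -/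

import Mathlib

open MeasureTheory Filter Topology TemperedDistribution
open scoped ContDiff ENNReal NNReal SchwartzMap Matrix

noncomputable section

namespace MixedExtension

/-- The Euclidean space `ℝⁿ`. -/
abbrev E (n : ℕ) : Type := EuclideanSpace ℝ (Fin n)

/-! ### Sobolev spaces of arbitrary real order -/

/-- The `L²` function `J^s u` representing the Bessel potential of order `s` of `u ∈ H^s(ℝⁿ)`
(it is unique; the value is `0` if `u ∉ H^s(ℝⁿ)`). -/
def besselRep {n : ℕ} (s : ℝ) (u : 𝓢'(E n, ℂ)) : Lp ℂ 2 (volume : Measure (E n)) :=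
  open Classical in if h : MemSobolev s 2 u then h.choose else 0

theorem besselRep_spec {n : ℕ} {s : ℝ} {u : 𝓢'(E n, ℂ)} (h : MemSobolev s 2 u) :
    besselPotential (E n) ℂ s u = (besselRep s u : 𝓢'(E n, ℂ)) := by
  unfold besselRep
  rw [dif_pos h]
  exact h.choose_spec

/-- The `H^s(ℝⁿ)` norm of a tempered distribution, i.e. the `L²` norm of its Bessel potential of
order `s`; it is `∞` if the distribution is not in `H^s(ℝⁿ)`. -/
def sobolevNorm {n : ℕ} (s : ℝ) (u : 𝓢'(E n, ℂ)) : ℝ≥0∞ :=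
  ⨅ (f : Lp ℂ 2 (volume : Measure (E n))) (_ : besselPotential (E n) ℂ s u = f), ‖f‖ₑ

theorem sobolevNorm_eq {n : ℕ} {s : ℝ} {u : 𝓢'(E n, ℂ)} (h : MemSobolev s 2 u) :
    sobolevNorm s u = ‖besselRep s u‖ₑ := by
  apply le_antisymm
  · exact iInf_le_of_le (besselRep s u) (iInf_le_of_le (besselRep_spec h) le_rfl)
  · refine le_iInf fun f => le_iInf fun hf => ?_
    have hinj : Function.Injective
        (Lp.toTemperedDistributionCLM ℂ (volume : Measure (E n)) 2) :=
      LinearMap.ker_eq_bot.mp Lp.ker_toTemperedDistributionCLM_eq_bot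
    have : besselRep s u = f := by
      apply hinj
      rw [Lp.toTemperedDistributionCLM_apply, Lp.toTemperedDistributionCLM_apply,
        ← besselRep_spec h, hf]
    rw [this]

/-- The (bilinear) duality pairing `⟨f, w⟩` of `f ∈ H^{-s}(ℝⁿ)` with `w ∈ H^s(ℝⁿ)`, which is the
continuous extension of the pairing of distributions with test functions:
`⟨f, w⟩ = ∫ (J^{-s} f) (J^s w) dx`. -/
def sobolevPairing {n : ℕ} (s : ℝ) (f w : 𝓢'(E n, ℂ)) : ℂ :=
  ∫ x, besselRep (-s) f x * besselRep s w x

/-! ### The metric -/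

/-- A smooth, symmetric, uniformly elliptic metric on `ℝⁿ` that is Euclidean outside the closure of
a bounded open set. -/
structure IsAdmissibleMetric {n : ℕ} (g : E n → Matrix (Fin n) (Fin n) ℝ) : Prop where
  smooth : ∀ i j, ContDiff ℝ ∞ fun x => g x i j
  symm : ∀ x, (g x).IsSymm
  elliptic : ∃ lam : ℝ, 0 < lam ∧ ∀ (x : E n) (ξ : Fin n → ℝ),
    lam * (ξ ⬝ᵥ ξ) ≤ ξ ⬝ᵥ (g x *ᵥ ξ) ∧ ξ ⬝ᵥ (g x *ᵥ ξ) ≤ lam⁻¹ * (ξ ⬝ᵥ ξ)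
  euclidean : ∃ U : Set (E n), IsOpen U ∧ Bornology.IsBounded U ∧ ∀ x ∉ closure U, g x = 1

/-- The volume density `√|g|`, with `|g| = det g`. -/
def sqrtDet {n : ℕ} (g : E n → Matrix (Fin n) (Fin n) ℝ) (x : E n) : ℝ :=
  Real.sqrt (g x).det

/-- The tensor field `g̃ = √|g| (g⁻¹ 0; 0 1)` of size `(n+1) × (n+1)`. The index `Sum.inl i` is the
tangential direction `i`, the index `Sum.inr ()` is the normal direction. -/
def gTilde {n : ℕ} (g : E n → Matrix (Fin n) (Fin n) ℝ) (x : E n) :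
    Matrix (Fin n ⊕ Unit) (Fin n ⊕ Unit) ℝ :=
  sqrtDet g x • Matrix.fromBlocks (g x)⁻¹ 0 0 1

/-! ### The weighted energy space on the upper half-space -/

/-- The measure `t^{1-2α} d(x,t)` on the upper half-space `{(x,t) : x ∈ ℝⁿ, t > 0}`. -/
def weightedMeasure (n : ℕ) (α : ℝ) : Measure (E n × ℝ) :=
  ((volume : Measure (E n × ℝ)).restrict {p | 0 < p.2}).withDensity
    fun p => ENNReal.ofReal (p.2 ^ (1 - 2 * α))

/-- Fields of vectors with `n + 1` components (tangential and normal) on `ℝⁿ × ℝ`. -/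
abbrev Field (n : ℕ) : Type := E n × ℝ → EuclideanSpace ℂ (Fin n ⊕ Unit)

/-- The classical gradient of a function of `(x,t) ∈ ℝⁿ × ℝ`. -/
def classicalGrad {n : ℕ} (ψ : E n × ℝ → ℂ) : Field n := fun p =>
  WithLp.toLp 2 (Sum.elim
    (fun i : Fin n => fderiv ℝ ψ p (EuclideanSpace.single i 1, 0))
    (fun _ : Unit => fderiv ℝ ψ p (0, 1)))

/-- The Sobolev trace exponent `2n / (n - 2α)`. -/
def traceExponent (n : ℕ) (α : ℝ) : ℝ≥0∞ := ENNReal.ofReal (2 * n / (n - 2 * α))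

/-- `InEnergySpace α u G v` says that the function `u` on the upper half-space belongs to
`X_α = Ḣ¹(ℝⁿ⁺¹₊, t^{1-2α})`, the closure of the smooth compactly supported functions on the closed
half-space with respect to the seminorm `‖∇ψ‖_{L²(t^{1-2α})}`, with gradient `G` and trace `v` on
`ℝⁿ × {0}`. Thus there are `ψ_k ∈ C_c^∞` with `∇ψ_k → G` in `L²(t^{1-2α})`; by the Sobolev trace
inequality, such a sequence converges locally, and its traces converge in `L^{2n/(n-2α)}(ℝⁿ)`;
the limits are `u` and `v`. -/
structure InEnergySpace {n : ℕ} (α : ℝ) (u : E n × ℝ → ℂ) (G : Field n) (v : E n → ℂ) :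
    Prop where
  aesm_fun : AEStronglyMeasurable u (weightedMeasure n α)
  memLp_grad : MemLp G 2 (weightedMeasure n α)
  aesm_trace : AEStronglyMeasurable v volume
  approx : ∃ ψ : ℕ → E n × ℝ → ℂ,
    (∀ k, ContDiff ℝ ∞ (ψ k)) ∧ (∀ k, HasCompactSupport (ψ k)) ∧
    Tendsto (fun k => eLpNorm (classicalGrad (ψ k) - G) 2 (weightedMeasure n α)) atTop (𝓝 0) ∧
    (∀ R : ℝ, Tendsto (fun k => eLpNorm (ψ k - u) 2
      ((weightedMeasure n α).restrict (Metric.ball 0 R))) atTop (𝓝 0)) ∧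
    Tendsto (fun k => eLpNorm (fun x => ψ k (x, 0) - v x) (traceExponent n α) volume)
      atTop (𝓝 0)

/-- The bilinear form `∫ t^{1-2α} g̃(x) ∇u · ∇φ d(x,t)` in terms of the gradients `G = ∇u` and
`H = ∇φ`. -/
def energyForm {n : ℕ} (α : ℝ) (g : E n → Matrix (Fin n) (Fin n) ℝ) (G H : Field n) : ℂ :=
  ∫ p, ∑ k, ∑ l, (gTilde g p.1 k l : ℂ) * G p l * H p k ∂(weightedMeasure n α)

/-! ### The mixed Dirichlet-Neumann problem -/

/-- The open half-space `ℝⁿ₊ = {x ∈ ℝⁿ : x_n > 0}` (the index of the last coordinate is `n - 1`). -/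
def posHalfSpace (n : ℕ) : Set (E n) := {x | ∀ i : Fin n, (i : ℕ) + 1 = n → 0 < x i}

/-- The function `u ∈ X_α`, with gradient `G` and trace `v`, is a weak solution of
`∇ · t^{1-2α} g̃ ∇u = 0` in the upper half-space, `u = f_D` on `ℝⁿ₊ × {0}`,
`lim t^{1-2α} ∂_t u = f_N` on `ℝⁿ₋ × {0}`: the Dirichlet condition holds for the trace, and
`∫ t^{1-2α} g̃ ∇u · ∇φ = - ⟨√|g| f_N, φ|_{t=0}⟩` for all `φ ∈ X_α` whose trace vanishes on `ℝⁿ₊`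
and belongs to `H^α(ℝⁿ)` (so that the pairing of `H^{-α}` with `H^α` makes sense). -/
structure IsWeakSolution {n : ℕ} (α : ℝ) (g : E n → Matrix (Fin n) (Fin n) ℝ)
    (fD : Lp ℂ 2 (volume : Measure (E n))) (fN : 𝓢'(E n, ℂ))
    (u : E n × ℝ → ℂ) (G : Field n) (v : Lp ℂ 2 (volume : Measure (E n))) : Prop where
  mem : InEnergySpace α u G v
  dirichlet : ∀ᵐ x : E n, x ∈ posHalfSpace n → v x = fD x
  weak : ∀ (φ : E n × ℝ → ℂ) (H : Field n) (w : Lp ℂ 2 (volume : Measure (E n))),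
    InEnergySpace α φ H w → MemSobolev α 2 (w : 𝓢'(E n, ℂ)) →
    (∀ᵐ x : E n, x ∈ posHalfSpace n → w x = 0) →
    energyForm α g G H =
      - sobolevPairing α (smulLeftCLM ℂ (fun x => (sqrtDet g x : ℂ)) fN) (w : 𝓢'(E n, ℂ))

end MixedExtension

end

/-! The trace of a weak solution is shown to be regular by difference quotients in tangential
directions, without any boundary regularity theory for the mixed problem.

Let `u_F` be an energy extension of `f_D` (`exists_extension`) and `U` the gradient of `u - u_F`, a
function whose trace `w = v - f_D` vanishes on `ℝⁿ₊`. Shifts `w(· + h)` by vectors `h` with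
`h_n ≥ 0` still vanish on `ℝⁿ₊`, so that with `τ` the shift by `h` the difference `τ U - U` is an
admissible test field, although the shift by `-h` is not. Since the coefficients are symmetric and
Lipschitz, testing with this *single* difference already controls the energy of the difference,
`‖τ U - U‖² ≲ |h| ‖U‖² + |⟨N, τ W - W⟩| + |⟨M F, τ U - U⟩|` (`IsShiftProblem.energy_le`), where
`W = J^α w`, `N = J^{-α} (√|g| f_N)`, `F = ∇ u_F` and `M` is multiplication by `g̃`.

The naive bound of the pairings loses: it only sees the order of the solution, not that of the data.
The remedy is an argument for dyadic steps (`norm_inner_shift_sub_le`): by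
`τ² - 1 = (τ - 1)² + 2 (τ - 1)` and the isometry of `τ`, a pairing of `A` with `τ B - B` has the
order of the product of a difference of `A` and one of `B`, as long as these orders add up to less
than one. Hence an order `s` of the solution improves to `(s + δ) / 2`, and iteration gives every order
below `δ` (`IsShiftProblem.exists_regularity`); here `δ < 1/2` is used.

The estimate on the bulk field passes to the trace by the weighted trace inequality
`‖J^α w - w‖_{L²} ≲ ‖∇ (u - u_F)‖` (`InEnergySpace.norm_trace_le`), and dyadic difference quotients
of `J^α w` of order `s` in the coordinate directions give `J^α w ∈ H^r` for `r < s`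
(`exists_eLpNorm_bracket_le`). The energy extension has to have a gradient with as many difference
quotients as `J^α f_D`; it is built on the Fourier side as `χ(⟨ξ⟩ t) 𝓕f(ξ)`, which commutes with
tangential shifts. That its trace converges in `L^{2n/(n-2α)}` is the Sobolev embedding
(`exists_eLpNorm_traceExponent_le`). Finally `√|g| f_N ∈ H^{-α+δ}`, because multiplication by a
Schwartz function is bounded on every Sobolev space (`memSobolev_smulLeftCLM_schwartz`). -/

noncomputable section

namespace MixedExtension

/-! ### Dyadic difference quotients in Hilbert spaces -/

section Abstract

open scoped InnerProductSpace

variable {H K : Type*} [NormedAddCommGroup H] [InnerProductSpace ℂ H]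
  [NormedAddCommGroup K] [InnerProductSpace ℂ K]

/-- The dyadic step length `2^{-j}`. -/
def scale (j : ℕ) : ℝ := (1 / 2 : ℝ) ^ j

lemma scale_pos (j : ℕ) : 0 < scale j := by unfold scale; positivity

lemma scale_le_one (j : ℕ) : scale j ≤ 1 := pow_le_one₀ (by norm_num) (by norm_num)

lemma scale_zero : scale 0 = 1 := by simp [scale]

lemma scale_eq (j : ℕ) : scale j = 2 * scale (j + 1) := by
  unfold scale; rw [pow_succ]; ring

lemma scale_rpow_eq (j : ℕ) (κ : ℝ) : scale j ^ κ = 2 ^ κ * scale (j + 1) ^ κ := by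
  rw [scale_eq j, Real.mul_rpow (by norm_num) (scale_pos _).le]

lemma scale_rpow_anti (j : ℕ) {a b : ℝ} (h : a ≤ b) : scale j ^ b ≤ scale j ^ a :=
  Real.rpow_le_rpow_of_exponent_ge (scale_pos j) (scale_le_one j) h

/-- A family of isometries `τ j` behaving like the shifts by `2^{-j} e` for a fixed vector `e`. -/
def IsDyadicShift (τ : ℕ → H →ₗᵢ[ℂ] H) : Prop :=
  ∀ j x, τ j x = τ (j + 1) (τ (j + 1) x)

/-- If `A` and `B` have difference quotients of order `μ` and `ν`, then the single difference in
`⟪A, τ B - B⟫` gains the full order `μ + ν`, as long as `μ + ν < 1`. This follows from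
`τ² - 1 = (τ - 1)² + 2 (τ - 1)`: the square of the difference may be distributed evenly on `A` and
`B`, and passing from the step `2^{-j}` to `2^{-j-1}` halves the remaining term. -/
lemma norm_inner_shift_sub_le {τ : ℕ → H →ₗᵢ[ℂ] H} (hτ : IsDyadicShift τ) {μ ν : ℝ}
    (hμν : μ + ν < 1) {A B : H} {a b : ℝ} (ha : ‖A‖ ≤ a)
    (hA : ∀ j, ‖τ j A - A‖ ≤ a * scale j ^ μ) (hB : ∀ j, ‖τ j B - B‖ ≤ b * scale j ^ ν) (j : ℕ) :
    ‖⟪A, τ j B - B⟫_ℂ‖ ≤ (1 + 1 / (1 - 2 ^ (μ + ν - 1))) * (a * b) * scale j ^ (μ + ν) := by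
  have hq : (2 : ℝ) ^ (μ + ν - 1) < 1 :=
    Real.rpow_lt_one_of_one_lt_of_neg (by norm_num) (by linarith)
  have hq0 : (0 : ℝ) < 2 ^ (μ + ν - 1) := by positivity
  have h2 : (2 : ℝ) ^ (μ + ν) = 2 * 2 ^ (μ + ν - 1) := by
    rw [Real.rpow_sub_one (by norm_num)]; ring
  set q := (2 : ℝ) ^ (μ + ν - 1) with hqdef
  have ha0 : 0 ≤ a := (norm_nonneg _).trans ha
  have hb0 : 0 ≤ b := by
    have := (norm_nonneg _).trans (hB 0)
    simpa [scale_zero] using this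
  have hC1 : 0 < 1 / (1 - q) := by apply div_pos one_pos; linarith
  have hab : 0 ≤ a * b := mul_nonneg ha0 hb0
  induction j with
  | zero =>
    have h0 := hB 0
    simp only [scale_zero, Real.one_rpow, mul_one] at h0 ⊢
    calc _ ≤ ‖A‖ * ‖τ 0 B - B‖ := norm_inner_le_norm _ _
      _ ≤ a * b := by gcongr
      _ ≤ _ := by nlinarith
  | succ j ih =>
    set y := τ (j + 1) B - B with hy
    have hsq : τ j B - B = (τ (j + 1) y - y) + (2 : ℂ) • y := by
      rw [hτ j B, hy, map_sub, two_smul]; abel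
    have hsq' : ⟪A, τ (j + 1) y - y⟫_ℂ = - ⟪τ (j + 1) A - A, τ (j + 1) y⟫_ℂ := by
      rw [inner_sub_right, inner_sub_left, LinearIsometry.inner_map_map]; ring
    have hbound : ‖⟪A, τ (j + 1) y - y⟫_ℂ‖ ≤ (a * b) * scale (j + 1) ^ (μ + ν) := by
      rw [hsq', norm_neg]
      calc _ ≤ ‖τ (j + 1) A - A‖ * ‖τ (j + 1) y‖ := norm_inner_le_norm _ _
        _ ≤ (a * scale (j + 1) ^ μ) * (b * scale (j + 1) ^ ν) := by
          rw [LinearIsometry.norm_map]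
          have := scale_pos (j + 1)
          gcongr
          · exact hA _
          · exact hB _
        _ = _ := by rw [Real.rpow_add (scale_pos _)]; ring
    have hy2 : ⟪A, y⟫_ℂ = (1 / 2) * (⟪A, τ j B - B⟫_ℂ - ⟪A, τ (j + 1) y - y⟫_ℂ) := by
      rw [hsq, inner_add_right, inner_smul_right]; ring
    have hs := Real.rpow_pos_of_pos (scale_pos (j + 1)) (μ + ν)
    calc ‖⟪A, y⟫_ℂ‖ ≤ (1 / 2) * (‖⟪A, τ j B - B⟫_ℂ‖ + ‖⟪A, τ (j + 1) y - y⟫_ℂ‖) := by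
          rw [hy2, norm_mul]
          have : ‖(1 / 2 : ℂ)‖ = 1 / 2 := by norm_num
          rw [this]
          gcongr
          exact norm_sub_le _ _
      _ ≤ (1 / 2) * ((1 + 1 / (1 - q)) * (a * b) * (2 * q * scale (j + 1) ^ (μ + ν))
            + (a * b) * scale (j + 1) ^ (μ + ν)) := by
          rw [scale_rpow_eq, h2] at ih
          gcongr
      _ = ((1 + 1 / (1 - q)) * q + 1 / 2) * (a * b) * scale (j + 1) ^ (μ + ν) := by ring
      _ ≤ _ := by
          have : (1 / (1 - q)) * (1 - q) = 1 := by
            rw [one_div, inv_mul_cancel₀]; linarith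
          have h' : (1 + 1 / (1 - q)) * q + 1 / 2 ≤ 1 + 1 / (1 - q) := by nlinarith
          simpa only [mul_assoc] using mul_le_mul_of_nonneg_right h' (mul_nonneg hab hs.le)

/-- The data of the mixed problem after reduction to Hilbert spaces: `U` is the gradient of the
difference of the solution and the extension of the Dirichlet datum, `F` the gradient of that
extension, `W` and `N` are the Bessel potentials of the trace of that difference and of the Neumann
datum, and `M` is the coefficient operator. The shifts `τ`, `σ` act on bulk fields and on traces;
`T` is the size of the data. -/
structure IsShiftProblem (lam L m c δ : ℝ) (τ : ℕ → H →ₗᵢ[ℂ] H) (σ : ℕ → K →ₗᵢ[ℂ] K)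
    (M : H →L[ℂ] H) (U F : H) (W N : K) (T : ℝ) : Prop where
  shift_bulk : IsDyadicShift τ
  shift_trace : IsDyadicShift σ
  symm : ∀ x y, ⟪M x, y⟫_ℂ = ⟪x, M y⟫_ℂ
  coercive : ∀ x, lam * ‖x‖ ^ 2 ≤ (⟪x, M x⟫_ℂ).re
  bound : ‖M‖ ≤ m
  commutator : ∀ j x, ‖M (τ j x) - τ j (M x)‖ ≤ L * scale j * ‖x‖
  weak_self : ⟪U, M U⟫_ℂ = - ⟪W, N⟫_ℂ - ⟪U, M F⟫_ℂ
  weak_shift : ∀ j, ⟪τ j U - U, M U⟫_ℂ = - ⟪σ j W - W, N⟫_ℂ - ⟪τ j U - U, M F⟫_ℂ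
  trace : ∀ j, ‖σ j W - W‖ ≤ c * (‖τ j U - U‖ + scale j * T)
  norm_W : ‖W‖ ≤ c * T
  norm_N : ‖N‖ ≤ c * T
  norm_F : ‖F‖ ≤ c * T
  shift_N : ∀ j, ‖σ j N - N‖ ≤ c * T * scale j ^ δ
  shift_F : ∀ j, ‖τ j F - F‖ ≤ c * T * scale j ^ δ

variable {lam L m c δ : ℝ} {τ : ℕ → H →ₗᵢ[ℂ] H} {σ : ℕ → K →ₗᵢ[ℂ] K}
    {M : H →L[ℂ] H} {U F : H} {W N : K} {T : ℝ}

lemma IsShiftProblem.norm_U_le (h : IsShiftProblem lam L m c δ τ σ M U F W N T)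
    (hlam : 0 < lam) (hm : 0 ≤ m) (hc : 0 ≤ c) (hT : 0 ≤ T) :
    ‖U‖ ≤ (c + (m * c + c) / lam) * T := by
  have h1 : lam * ‖U‖ ^ 2 ≤ c * T * (c * T) + ‖U‖ * (m * (c * T)) := by
    calc lam * ‖U‖ ^ 2 ≤ (⟪U, M U⟫_ℂ).re := h.coercive U
      _ ≤ ‖⟪U, M U⟫_ℂ‖ := Complex.re_le_norm _
      _ ≤ ‖⟪W, N⟫_ℂ‖ + ‖⟪U, M F⟫_ℂ‖ := by
          rw [h.weak_self]
          refine (norm_sub_le _ _).trans ?_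
          rw [norm_neg]
      _ ≤ ‖W‖ * ‖N‖ + ‖U‖ * ‖M F‖ := by gcongr <;> exact norm_inner_le_norm _ _
      _ ≤ c * T * (c * T) + ‖U‖ * (m * (c * T)) := by
          gcongr
          · exact h.norm_W
          · exact h.norm_N
          · exact (M.le_opNorm F).trans (by gcongr; exacts [h.bound, h.norm_F])
  by_contra! hcon
  have hX : 0 ≤ (c + (m * c + c) / lam) * T := by positivity
  have hU : 0 < ‖U‖ := hX.trans_lt hcon
  have h2 : lam * (c + (m * c + c) / lam) * T < lam * ‖U‖ := by
    rw [mul_assoc]; gcongr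
  have h3 : lam * (c + (m * c + c) / lam) * T = lam * c * T + (m * c + c) * T := by
    field_simp
  have h4 : c * T ≤ ‖U‖ := by
    refine le_trans ?_ hcon.le
    have : 0 ≤ (m * c + c) / lam * T := by positivity
    nlinarith
  have h5 : lam * ‖U‖ ^ 2 ≤ ‖U‖ * ((m * c + c) * T) := by
    have : c * T * (c * T) ≤ ‖U‖ * (c * T) := by gcongr
    nlinarith
  have h6 : lam * ‖U‖ ≤ (m * c + c) * T := by
    have : ‖U‖ * (lam * ‖U‖) ≤ ‖U‖ * ((m * c + c) * T) := by nlinarith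
    exact le_of_mul_le_mul_left this hU
  have h7 : 0 ≤ lam * c * T := by positivity
  linarith

/-- Testing the equation with `τ U - U` bounds the energy of the difference by two pairings with a
single difference. -/
lemma IsShiftProblem.energy_le (h : IsShiftProblem lam L m c δ τ σ M U F W N T) (j : ℕ) :
    lam * ‖τ j U - U‖ ^ 2 ≤ L * scale j * ‖U‖ ^ 2 + 2 * ‖⟪N, σ j W - W⟫_ℂ‖
      + 2 * ‖⟪M F, τ j U - U⟫_ℂ‖ := by
  refine (h.coercive _).trans ?_
  have hs : (⟪U, M (τ j U)⟫_ℂ).re = (⟪τ j U, M U⟫_ℂ).re := by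
    rw [← h.symm, ← inner_conj_symm, Complex.conj_re]
  have h1 : (⟪τ j U - U, M (τ j U - U)⟫_ℂ).re =
      (⟪τ j U, M (τ j U) - τ j (M U)⟫_ℂ).re - 2 * (⟪τ j U - U, M U⟫_ℂ).re := by
    simp only [map_sub, inner_sub_left, inner_sub_right, Complex.sub_re, hs,
      LinearIsometry.inner_map_map]
    ring
  rw [h1, h.weak_shift]
  have h2 : (⟪τ j U, M (τ j U) - τ j (M U)⟫_ℂ).re ≤ L * scale j * ‖U‖ ^ 2 := by
    calc _ ≤ ‖⟪τ j U, M (τ j U) - τ j (M U)⟫_ℂ‖ := Complex.re_le_norm _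
      _ ≤ ‖τ j U‖ * ‖M (τ j U) - τ j (M U)‖ := norm_inner_le_norm _ _
      _ ≤ ‖U‖ * (L * scale j * ‖U‖) := by
        rw [LinearIsometry.norm_map]
        gcongr
        exact h.commutator j U
      _ = _ := by ring
  have h3 : -(- ⟪σ j W - W, N⟫_ℂ - ⟪τ j U - U, M F⟫_ℂ).re ≤
      ‖⟪N, σ j W - W⟫_ℂ‖ + ‖⟪M F, τ j U - U⟫_ℂ‖ := by
    rw [norm_inner_symm N, norm_inner_symm (M F)]
    have e1 := Complex.re_le_norm ⟪σ j W - W, N⟫_ℂ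
    have e2 := Complex.re_le_norm ⟪τ j U - U, M F⟫_ℂ
    simp only [Complex.sub_re, Complex.neg_re]
    linarith
  linarith

/-- One step of the bootstrap: from order `s` to order `(s + δ) / 2`. The energy of the difference
is bounded by pairings of data of order `δ` with a single difference of a quantity of order `s`,
hence by a multiple of `2^{-j(s + δ)}`, as long as `s + δ < 1`. -/
lemma IsShiftProblem.exists_step (hlam : 0 < lam) (hL : 0 ≤ L) (hm : 0 ≤ m) (hc : 0 ≤ c)
    {s C : ℝ} (hC : 0 ≤ C) (hs0 : 0 ≤ s) (hδ0 : 0 ≤ δ) (hs : s + δ < 1) :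
    ∃ C' : ℝ, 0 ≤ C' ∧ ∀ (τ : ℕ → H →ₗᵢ[ℂ] H) (σ : ℕ → K →ₗᵢ[ℂ] K) (M : H →L[ℂ] H) (U F : H)
      (W N : K) (T : ℝ), 0 ≤ T → IsShiftProblem lam L m c δ τ σ M U F W N T →
      (∀ j, ‖τ j U - U‖ ≤ C * T * scale j ^ s) →
      ∀ j, ‖τ j U - U‖ ≤ C' * T * scale j ^ ((s + δ) / 2) := by
  have hq : (2 : ℝ) ^ (δ + s - 1) < 1 :=
    Real.rpow_lt_one_of_one_lt_of_neg (by norm_num) (by linarith)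
  set Z := 1 + 1 / (1 - (2 : ℝ) ^ (δ + s - 1)) with hZ
  have hZ0 : 0 ≤ Z := by
    have : 0 < 1 - (2 : ℝ) ^ (δ + s - 1) := by linarith
    positivity
  set B := c + (m * c + c) / lam with hB
  have hB0 : 0 ≤ B := by positivity
  set X := (L * B ^ 2 + 2 * (Z * (c * (c * (C + 1)))) + 2 * (Z * ((L * c + m * c) * C))) / lam
    with hX
  have hX0 : 0 ≤ X := by positivity
  refine ⟨Real.sqrt X, Real.sqrt_nonneg _, fun τ σ M U F W N T hT h hU j => ?_⟩
  have hUn : ‖U‖ ≤ B * T := h.norm_U_le hlam hm hc hT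
  have hsc := scale_pos j
  have hsδ : ∀ j, scale j ≤ scale j ^ (δ + s) := fun j => by
    conv_lhs => rw [← Real.rpow_one (scale j)]
    exact scale_rpow_anti j (by linarith)
  have hsδ' : ∀ j, scale j ≤ scale j ^ s := fun j => by
    conv_lhs => rw [← Real.rpow_one (scale j)]
    exact scale_rpow_anti j (by linarith)
  have hsδ'' : ∀ j, scale j ≤ scale j ^ δ := fun j => by
    conv_lhs => rw [← Real.rpow_one (scale j)]
    exact scale_rpow_anti j (by linarith)
  have hW : ∀ j, ‖σ j W - W‖ ≤ c * (C + 1) * T * scale j ^ s := fun j => by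
    refine (h.trace j).trans ?_
    have h1 := hU j
    have h2 := hsδ' j
    calc _ ≤ c * (C * T * scale j ^ s + scale j ^ s * T) := by gcongr
      _ = _ := by ring
  have e1 := norm_inner_shift_sub_le h.shift_trace (μ := δ) (ν := s) (by linarith)
    h.norm_N h.shift_N hW j
  have hMF : ‖M F‖ ≤ (L * c + m * c) * T := by
    refine (M.le_opNorm F).trans ?_
    calc _ ≤ m * (c * T) := by gcongr; exacts [h.bound, h.norm_F]
      _ ≤ _ := by
        have : 0 ≤ L * c * T := by positivity
        nlinarith
  have hMFs : ∀ j, ‖τ j (M F) - M F‖ ≤ (L * c + m * c) * T * scale j ^ δ := fun j => by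
    have : τ j (M F) - M F = - (M (τ j F) - τ j (M F)) + M (τ j F - F) := by
      rw [map_sub]; abel
    rw [this]
    refine (norm_add_le _ _).trans ?_
    rw [norm_neg]
    have a1 := h.commutator j F
    have a2 := M.le_opNorm (τ j F - F)
    have hsp := scale_pos j
    calc _ ≤ L * scale j ^ δ * (c * T) + m * (c * T * scale j ^ δ) := by
          refine add_le_add (a1.trans ?_) (a2.trans ?_)
          · gcongr; exacts [hsδ'' j, h.norm_F]
          · gcongr; exacts [h.bound, h.shift_F j]
      _ = _ := by ring
  have e2 := norm_inner_shift_sub_le h.shift_bulk (μ := δ) (ν := s) (by linarith) hMF hMFs hU j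
  have e3 := h.energy_le j
  have e4 : lam * ‖τ j U - U‖ ^ 2 ≤ lam * (X * T ^ 2 * scale j ^ (δ + s)) := by
    calc _ ≤ L * scale j ^ (δ + s) * (B * T) ^ 2 +
            2 * (Z * (c * T * (c * (C + 1) * T)) * scale j ^ (δ + s)) +
            2 * (Z * ((L * c + m * c) * T * (C * T)) * scale j ^ (δ + s)) := by
          refine e3.trans ?_
          gcongr
          exact hsδ j
      _ = lam * (X * T ^ 2 * scale j ^ (δ + s)) := by
          rw [hX]; field_simp
  have e5 : ‖τ j U - U‖ ^ 2 ≤ X * T ^ 2 * scale j ^ (δ + s) := le_of_mul_le_mul_left e4 hlam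
  have e6 : scale j ^ (δ + s) = (scale j ^ ((s + δ) / 2)) ^ 2 := by
    rw [← Real.rpow_natCast, ← Real.rpow_mul hsc.le]; congr 1; push_cast; ring
  have e7 : (Real.sqrt X) ^ 2 = X := Real.sq_sqrt hX0
  refine le_of_sq_le_sq ?_ (by positivity)
  rw [mul_pow, mul_pow, e7, ← e6]
  exact e5

/-- Iterating the bootstrap yields every order below `δ`. -/
lemma IsShiftProblem.exists_regularity (H K : Type*) [NormedAddCommGroup H]
    [InnerProductSpace ℂ H] [NormedAddCommGroup K] [InnerProductSpace ℂ K]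
    (hlam : 0 < lam) (hL : 0 ≤ L) (hm : 0 ≤ m) (hc : 0 ≤ c)
    (hδ0 : 0 < δ) (hδ : δ < 1 / 2) {s : ℝ} (hs : s < δ) :
    ∃ C : ℝ, 0 ≤ C ∧ ∀ (τ : ℕ → H →ₗᵢ[ℂ] H) (σ : ℕ → K →ₗᵢ[ℂ] K) (M : H →L[ℂ] H) (U F : H)
      (W N : K) (T : ℝ), 0 ≤ T → IsShiftProblem lam L m c δ τ σ M U F W N T →
      ∀ j, ‖σ j W - W‖ ≤ C * T * scale j ^ s := by
  have key : ∀ k : ℕ, ∃ C : ℝ, 0 ≤ C ∧ ∀ (τ : ℕ → H →ₗᵢ[ℂ] H) (σ : ℕ → K →ₗᵢ[ℂ] K)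
      (M : H →L[ℂ] H) (U F : H)
      (W N : K) (T : ℝ), 0 ≤ T → IsShiftProblem lam L m c δ τ σ M U F W N T →
      ∀ j, ‖τ j U - U‖ ≤ C * T * scale j ^ (δ * (1 - (1 / 2) ^ k)) := by
    intro k
    induction k with
    | zero =>
      refine ⟨2 * (c + (m * c + c) / lam), by positivity, fun τ σ M U F W N T hT h j => ?_⟩
      have := h.norm_U_le hlam hm hc hT
      have h2 := norm_sub_le (τ j U) U
      rw [LinearIsometry.norm_map] at h2
      simp only [pow_zero, sub_self, mul_zero, Real.rpow_zero, mul_one]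
      linarith
    | succ k ih =>
      obtain ⟨C, hC, ih⟩ := ih
      have hk0 : 0 ≤ 1 - (1 / 2 : ℝ) ^ k := sub_nonneg.2 (pow_le_one₀ (by norm_num) (by norm_num))
      have hk1 : 1 - (1 / 2 : ℝ) ^ k ≤ 1 := by
        have : (0 : ℝ) ≤ (1 / 2 : ℝ) ^ k := by positivity
        linarith
      obtain ⟨C', hC', h'⟩ := IsShiftProblem.exists_step (H := H) (K := K) hlam hL hm hc hC
        (s := δ * (1 - (1 / 2) ^ k)) (by positivity) hδ0.le (by nlinarith)
      refine ⟨C', hC', fun τ σ M U F W N T hT h j => ?_⟩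
      have := h' τ σ M U F W N T hT h (ih τ σ M U F W N T hT h) j
      convert! this using 3
      rw [pow_succ]; ring
  obtain ⟨k, hk⟩ : ∃ k : ℕ, (1 / 2 : ℝ) ^ k < (δ - s) / δ :=
    exists_pow_lt_of_lt_one (div_pos (by linarith) hδ0) (by norm_num)
  obtain ⟨C, hC, h'⟩ := key k
  refine ⟨c * (C + 1), by positivity, fun τ σ M U F W N T hT h j => ?_⟩
  have h1 : s ≤ δ * (1 - (1 / 2) ^ k) := by
    rw [lt_div_iff₀ hδ0] at hk
    nlinarith
  have h2 : scale j ≤ scale j ^ s := by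
    conv_lhs => rw [← Real.rpow_one (scale j)]
    exact scale_rpow_anti j (by linarith)
  have hsp := scale_pos j
  refine (h.trace j).trans ?_
  calc _ ≤ c * (C * T * scale j ^ s + scale j ^ s * T) := by
        gcongr
        refine (h' τ σ M U F W N T hT h j).trans ?_
        have := scale_rpow_anti j h1
        gcongr
    _ = _ := by ring

end Abstract

/-! ### Bessel potentials and shifts on the Fourier side -/

section Fourier

open FourierTransform
open scoped Real

variable {n : ℕ}

/-- Square integrable functions on `ℝⁿ`. -/
abbrev L2 (n : ℕ) : Type := Lp ℂ 2 (volume : Measure (E n))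

/-- The Bessel symbol `(1 + |ξ|²)^{s/2}`. -/
def bracket (s : ℝ) (ξ : E n) : ℝ := (1 + ‖ξ‖ ^ 2) ^ (s / 2)

lemma bracket_pos (s : ℝ) (ξ : E n) : 0 < bracket s ξ := by unfold bracket; positivity

lemma bracket_add (s r : ℝ) (ξ : E n) : bracket (s + r) ξ = bracket s ξ * bracket r ξ := by
  unfold bracket; rw [← Real.rpow_add (by positivity)]; congr 1; ring

lemma bracket_zero (ξ : E n) : bracket 0 ξ = 1 := by simp [bracket]

lemma bracket_le {s r : ℝ} (h : s ≤ r) (ξ : E n) : bracket s ξ ≤ bracket r ξ :=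
  Real.rpow_le_rpow_of_exponent_le (by nlinarith [sq_nonneg ‖ξ‖]) (by linarith)

lemma bracket_neg (s : ℝ) (ξ : E n) : bracket (-s) ξ = (bracket s ξ)⁻¹ := by
  unfold bracket; rw [← Real.rpow_neg (by positivity)]; congr 1; ring

lemma one_le_bracket {s : ℝ} (hs : 0 ≤ s) (ξ : E n) : 1 ≤ bracket s ξ := by
  rw [← bracket_zero ξ]; exact bracket_le hs ξ

lemma continuous_bracket (s : ℝ) : Continuous (bracket s : E n → ℝ) := by
  unfold bracket
  exact (by fun_prop : Continuous fun ξ : E n => 1 + ‖ξ‖ ^ 2).rpow_const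
    fun ξ => Or.inl (by positivity)

lemma hasTemperateGrowth_bracket (s : ℝ) :
    (fun ξ : E n => (bracket s ξ : ℂ)).HasTemperateGrowth := by
  unfold bracket; fun_prop

lemma locallyIntegrable_coe (f : L2 n) : LocallyIntegrable f volume :=
  (Lp.memLp f).locallyIntegrable (by norm_num)

lemma locallyIntegrable_mul {m : E n → ℂ} (hm : Continuous m) (f : L2 n) :
    LocallyIntegrable (fun x => m x * f x) volume := by
  rw [← locallyIntegrableOn_univ]
  exact (locallyIntegrableOn_univ.2 (locallyIntegrable_coe f)).continuousOn_mul hm.continuousOn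
    isOpen_univ.isLocallyClosed

/-- Locally integrable functions that agree as distributions agree almost everywhere. -/
lemma ae_eq_of_integral_schwartz_eq {f f' : E n → ℂ} (hf : LocallyIntegrable f volume)
    (hf' : LocallyIntegrable f' volume)
    (h : ∀ η : 𝓢(E n, ℂ), ∫ x, η x * f x = ∫ x, η x * f' x) : f =ᵐ[volume] f' := by
  refine ae_eq_of_integral_contDiff_smul_eq hf hf' fun η hη hc => ?_
  have h1 : HasCompactSupport (Complex.ofRealCLM ∘ η) := hc.comp_left rfl
  have h2 : ContDiff ℝ ∞ (Complex.ofRealCLM ∘ η) := by fun_prop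
  simpa using h (h1.toSchwartzMap h2)

lemma smulLeftCLM_coe_eq_iff {m : E n → ℂ} (hm : m.HasTemperateGrowth) (a b : L2 n) :
    smulLeftCLM ℂ m (a : 𝓢'(E n, ℂ)) = (b : 𝓢'(E n, ℂ)) ↔ b =ᵐ[volume] fun ξ => m ξ * a ξ := by
  constructor
  · intro h
    refine ae_eq_of_integral_schwartz_eq (locallyIntegrable_coe b)
      (locallyIntegrable_mul hm.1.continuous a) fun η => ?_
    have := congrArg (fun u : 𝓢'(E n, ℂ) => u η) h
    simp only [smulLeftCLM_apply_apply, Lp.toTemperedDistribution_apply,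
      SchwartzMap.smulLeftCLM_apply_apply hm, smul_eq_mul] at this
    rw [← this]
    refine integral_congr_ae (Eventually.of_forall fun x => ?_)
    simp only; ring
  · intro h
    ext η
    simp only [smulLeftCLM_apply_apply, Lp.toTemperedDistribution_apply,
      SchwartzMap.smulLeftCLM_apply_apply hm, smul_eq_mul]
    refine integral_congr_ae ?_
    filter_upwards [h] with x hx
    rw [hx]; ring

lemma fourier_injective : Function.Injective (fun u : 𝓢'(E n, ℂ) => 𝓕 u) := fun u v h => by
  have := congrArg (fun u : 𝓢'(E n, ℂ) => 𝓕⁻ u) h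
  simpa using this

lemma coe_injective : Function.Injective (fun f : L2 n => (f : 𝓢'(E n, ℂ))) :=
  LinearMap.ker_eq_bot.mp Lp.ker_toTemperedDistributionCLM_eq_bot

/-- For square integrable functions, `J^s f = F` is an equation between Fourier transforms. -/
lemma besselPotential_eq_iff (s : ℝ) (f F : L2 n) :
    besselPotential (E n) ℂ s (f : 𝓢'(E n, ℂ)) = (F : 𝓢'(E n, ℂ)) ↔
      (𝓕 F : L2 n) =ᵐ[volume] fun ξ => (bracket s ξ : ℂ) * (𝓕 f : L2 n) ξ := by
  rw [← smulLeftCLM_coe_eq_iff (hasTemperateGrowth_bracket s),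
    ← Lp.fourier_toTemperedDistribution_eq, ← Lp.fourier_toTemperedDistribution_eq,
    ← fourier_injective.eq_iff]
  simp only [fourier_besselPotential_eq_smulLeftCLM_fourier_apply]
  rfl

lemma sobolevNorm_of_eq {s : ℝ} {u : 𝓢'(E n, ℂ)} {F : L2 n}
    (h : besselPotential (E n) ℂ s u = (F : 𝓢'(E n, ℂ))) : sobolevNorm s u = ‖F‖ₑ := by
  have hm : MemSobolev s 2 u := ⟨F, h⟩
  rw [sobolevNorm_eq hm]
  congr 1
  exact coe_injective ((besselRep_spec hm).symm.trans h)

lemma besselRep_of_eq {s : ℝ} {u : 𝓢'(E n, ℂ)} {F : L2 n}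
    (h : besselPotential (E n) ℂ s u = (F : 𝓢'(E n, ℂ))) : besselRep s u = F :=
  coe_injective ((besselRep_spec ⟨F, h⟩).symm.trans h)

lemma exists_besselPotential_eq {r : ℝ} {f : L2 n}
    (h : MemLp (fun ξ => (bracket r ξ : ℂ) * (𝓕 f : L2 n) ξ) 2 volume) :
    ∃ F : L2 n, besselPotential (E n) ℂ r (f : 𝓢'(E n, ℂ)) = (F : 𝓢'(E n, ℂ)) ∧
      ‖F‖ₑ = eLpNorm (fun ξ => (bracket r ξ : ℂ) * (𝓕 f : L2 n) ξ) 2 volume := by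
  refine ⟨𝓕⁻ (h.toLp _), ?_, ?_⟩
  · rw [besselPotential_eq_iff, fourier_fourierInv_eq]
    exact h.coeFn_toLp
  · have : ‖(𝓕⁻ (h.toLp _) : L2 n)‖ = ‖h.toLp _‖ := by
      rw [← Lp.norm_fourier_eq, fourier_fourierInv_eq]
    rw [← ofReal_norm, this, ofReal_norm, Lp.enorm_toLp]

/-- If `J^a u = F` and `J^b u = F'` are square integrable, then `J^{b-a} F = F'`. -/
lemma besselPotential_sub {a b : ℝ} {u : 𝓢'(E n, ℂ)} {F F' : L2 n}
    (h : besselPotential (E n) ℂ a u = (F : 𝓢'(E n, ℂ)))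
    (h' : besselPotential (E n) ℂ b u = (F' : 𝓢'(E n, ℂ))) :
    besselPotential (E n) ℂ (b - a) (F : 𝓢'(E n, ℂ)) = (F' : 𝓢'(E n, ℂ)) := by
  rw [← h, besselPotential_besselPotential_apply, ← h']
  congr 2; ring

/-- The shift `f ↦ f(· + h)` on square integrable functions. -/
def shift (h : E n) : L2 n →ₗᵢ[ℂ] L2 n :=
  Lp.compMeasurePreservingₗᵢ ℂ (fun x => x + h) (measurePreserving_add_right volume h)

lemma coeFn_shift (h : E n) (f : L2 n) : shift h f =ᵐ[volume] fun x => f (x + h) :=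
  Lp.coeFn_compMeasurePreserving f (measurePreserving_add_right volume h)

/-- The character `ξ ↦ e^{2πi ξ·h}`. -/
def char (h ξ : E n) : ℂ := (𝐞 (inner ℝ ξ h) : ℂ)

lemma continuous_char (h : E n) : Continuous (char h) := by
  unfold char; fun_prop

lemma norm_char (h ξ : E n) : ‖char h ξ‖ = 1 := Circle.norm_coe _

lemma fourierInv_compSubConst_apply (h : E n) (φ : 𝓢(E n, ℂ)) (ξ : E n) :
    (𝓕⁻ (φ.compSubConstCLM ℂ h) : 𝓢(E n, ℂ)) ξ = char h ξ * (𝓕⁻ φ : 𝓢(E n, ℂ)) ξ := by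
  rw [SchwartzMap.fourierInv_coe, SchwartzMap.fourierInv_coe, Real.fourierInv_eq,
    Real.fourierInv_eq, ← integral_add_right_eq_self _ h, ← integral_const_mul]
  refine integral_congr_ae (Eventually.of_forall fun x => ?_)
  simp only [SchwartzMap.compSubConstCLM_apply, add_sub_cancel_right, char, inner_add_left,
    AddChar.map_add_eq_mul, Circle.smul_def, Circle.coe_mul, smul_eq_mul, real_inner_comm ξ h]
  ring

lemma fourier_shift (h : E n) (f : L2 n) :
    (𝓕 (shift h f) : L2 n) =ᵐ[volume] fun ξ => char h ξ * (𝓕 f : L2 n) ξ := by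
  refine ae_eq_of_integral_schwartz_eq (locallyIntegrable_coe _)
    (locallyIntegrable_mul (continuous_char h) _) fun η => ?_
  have e1 : ∀ (g : L2 n) (ζ : 𝓢(E n, ℂ)), ∫ x, ζ x * (𝓕 g : L2 n) x =
      ∫ x, (𝓕 ζ : 𝓢(E n, ℂ)) x * g x := fun g ζ => by
    have := congrArg (fun u : 𝓢'(E n, ℂ) => u ζ) (Lp.fourier_toTemperedDistribution_eq g)
    simpa using this.symm
  set η' : 𝓢(E n, ℂ) := 𝓕⁻ ((𝓕 η : 𝓢(E n, ℂ)).compSubConstCLM ℂ h) with hη'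
  have e2 : ∀ ξ, η' ξ = char h ξ * η ξ := fun ξ => by
    rw [hη', fourierInv_compSubConst_apply, fourierInv_fourier_eq]
  have e3 : (𝓕 η' : 𝓢(E n, ℂ)) = (𝓕 η : 𝓢(E n, ℂ)).compSubConstCLM ℂ h := by
    rw [hη', fourier_fourierInv_eq]
  calc ∫ x, η x * (𝓕 (shift h f) : L2 n) x
      = ∫ x, (𝓕 η : 𝓢(E n, ℂ)) x * f (x + h) := by
        rw [e1]
        refine integral_congr_ae ?_
        filter_upwards [coeFn_shift h f] with x hx
        rw [hx]
    _ = ∫ x, (𝓕 η' : 𝓢(E n, ℂ)) x * f x := by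
        rw [e3, ← integral_add_right_eq_self (fun x => _ * f x) h]
        simp
    _ = ∫ x, η' x * (𝓕 f : L2 n) x := (e1 _ _).symm
    _ = ∫ x, η x * (char h x * (𝓕 f : L2 n) x) := by
        refine integral_congr_ae (Eventually.of_forall fun x => ?_)
        simp only [e2]; ring

lemma fourier_shift_sub (h : E n) (f : L2 n) :
    (𝓕 (shift h f - f) : L2 n) =ᵐ[volume] fun ξ => (char h ξ - 1) * (𝓕 f : L2 n) ξ := by
  have : (𝓕 (shift h f - f) : L2 n) = 𝓕 (shift h f) - 𝓕 f :=
    (Lp.fourierTransformₗᵢ (E n) ℂ).map_sub _ _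
  rw [this]
  filter_upwards [fourier_shift h f, Lp.coeFn_sub (𝓕 (shift h f) : L2 n) (𝓕 f)] with x h1 h2
  rw [h2, Pi.sub_apply, h1]; ring

lemma besselPotential_shift {s : ℝ} {f F : L2 n}
    (hF : besselPotential (E n) ℂ s (f : 𝓢'(E n, ℂ)) = (F : 𝓢'(E n, ℂ))) (h : E n) :
    besselPotential (E n) ℂ s (shift h f : 𝓢'(E n, ℂ)) = (shift h F : 𝓢'(E n, ℂ)) := by
  rw [besselPotential_eq_iff] at hF ⊢
  filter_upwards [hF, fourier_shift h f, fourier_shift h F] with x h1 h2 h3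
  rw [h2, h3, h1]; ring

lemma besselPotential_coe_sub {s : ℝ} {f F f' F' : L2 n}
    (hF : besselPotential (E n) ℂ s (f : 𝓢'(E n, ℂ)) = (F : 𝓢'(E n, ℂ)))
    (hF' : besselPotential (E n) ℂ s (f' : 𝓢'(E n, ℂ)) = (F' : 𝓢'(E n, ℂ))) :
    besselPotential (E n) ℂ s ((f - f' : L2 n) : 𝓢'(E n, ℂ)) = ((F - F' : L2 n) : 𝓢'(E n, ℂ)) := by
  have h := fun a b : L2 n =>
    (Lp.toTemperedDistributionCLM ℂ (volume : Measure (E n)) 2).map_sub a b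
  simp only [Lp.toTemperedDistributionCLM_apply] at h
  rw [h, h, map_sub, hF, hF']

/-- Complex conjugation commutes with Fourier transform up to a reflection. -/
lemma fourier_star (f : L2 n) :
    (𝓕 (star f) : L2 n) =ᵐ[volume] fun ξ => star ((𝓕 f : L2 n) (-ξ)) := by
  let c : L2 n →L[ℝ] L2 n :=
    ContinuousLinearMap.compLpL 2 volume (Complex.conjCLE : ℂ →L[ℝ] ℂ)
  have hc : ∀ g : L2 n, c g = star g := fun g => by
    apply Lp.ext
    filter_upwards [ContinuousLinearMap.coeFn_compLp (Complex.conjCLE : ℂ →L[ℝ] ℂ) g,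
      Lp.coeFn_star g] with x h1 h2
    rw [h2]; exact h1
  have hmp : MeasurePreserving (fun x : E n => -x) volume volume :=
    Measure.measurePreserving_neg volume
  let N : L2 n →ₗᵢ[ℂ] L2 n := Lp.compMeasurePreservingₗᵢ ℂ (fun x => -x) hmp
  have hN : ∀ g : L2 n, N g =ᵐ[volume] fun x => g (-x) := fun g =>
    Lp.coeFn_compMeasurePreserving g hmp
  have key : 𝓕 (c f) = c (N (𝓕 f)) := by
    refine DenseRange.induction_on (p := fun f : L2 n => 𝓕 (c f) = c (N (𝓕 f)))
      (SchwartzMap.denseRange_toLpCLM (p := 2) ENNReal.ofNat_ne_top) f ?_ ?_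
    · apply isClosed_eq
      · exact (Lp.fourierTransformₗᵢ (E n) ℂ).continuous.comp c.continuous
      · exact c.continuous.comp (N.continuous.comp (Lp.fourierTransformₗᵢ (E n) ℂ).continuous)
    · intro φ
      let φ' : 𝓢(E n, ℂ) := SchwartzMap.postcompCLM (𝕜 := ℝ) (Complex.conjCLE : ℂ →L[ℝ] ℂ) φ
      have hφ' : ∀ x, φ' x = star (φ x) := fun x => rfl
      have e1 : c (φ.toLp 2 volume) = φ'.toLp 2 volume := by
        apply Lp.ext
        rw [hc]
        filter_upwards [Lp.coeFn_star (φ.toLp 2 volume), φ.coeFn_toLp 2 volume,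
          φ'.coeFn_toLp 2 volume] with x h1 h2 h3
        rw [h1, h3, hφ', Pi.star_apply, h2]
      have e2 : ∀ ξ, (𝓕 φ' : 𝓢(E n, ℂ)) ξ = star ((𝓕 φ : 𝓢(E n, ℂ)) (-ξ)) := fun ξ => by
        rw [SchwartzMap.fourier_coe, SchwartzMap.fourier_coe, Real.fourier_eq, Real.fourier_eq]
        rw [Complex.star_def, ← integral_conj]
        refine integral_congr_ae (Eventually.of_forall fun x => ?_)
        simp only [hφ', Circle.smul_def, smul_eq_mul, map_mul, inner_neg_right, neg_neg]
        congr 1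
        rw [← Circle.coe_inv_eq_conj, ← AddChar.map_neg_eq_inv]
      change 𝓕 (c (φ.toLp 2 volume)) = c (N (𝓕 (φ.toLp 2 volume)))
      rw [e1, SchwartzMap.toLp_fourier_eq, SchwartzMap.toLp_fourier_eq]
      apply Lp.ext
      rw [hc]
      filter_upwards [Lp.coeFn_star (N ((𝓕 φ).toLp 2 volume)), hN ((𝓕 φ).toLp 2 volume),
        hmp.quasiMeasurePreserving.ae ((𝓕 φ).coeFn_toLp 2 volume),
        (𝓕 φ').coeFn_toLp 2 volume] with x h1 h2 h3 h4
      rw [h4, h1, e2, Pi.star_apply, h2, h3]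
  rw [← hc, key, hc]
  filter_upwards [Lp.coeFn_star (N (𝓕 f)), hN (𝓕 f)] with x h1 h2
  rw [h1, Pi.star_apply, h2]

lemma besselPotential_star {s : ℝ} {f F : L2 n}
    (hF : besselPotential (E n) ℂ s (f : 𝓢'(E n, ℂ)) = (F : 𝓢'(E n, ℂ))) :
    besselPotential (E n) ℂ s ((star f : L2 n) : 𝓢'(E n, ℂ)) = ((star F : L2 n) : 𝓢'(E n, ℂ)) := by
  rw [besselPotential_eq_iff] at hF ⊢
  filter_upwards [(Measure.measurePreserving_neg (volume : Measure (E n))).quasiMeasurePreserving.ae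
    hF, fourier_star f, fourier_star F] with x h1 h2 h3
  rw [h2, h3, h1]
  simp [bracket]

end Fourier

/-! ### Sobolev regularity and difference quotients -/

section Quotients

open FourierTransform
open scoped Real

variable {n : ℕ}

lemma char_eq (h ξ : E n) :
    char h ξ = Complex.exp (Complex.I * ((2 * π * inner ℝ ξ h : ℝ) : ℂ)) := by
  rw [char, Real.fourierChar_apply, mul_comm]

lemma norm_char_sub_one_le_two (h ξ : E n) : ‖char h ξ - 1‖ ≤ 2 := by
  refine (norm_sub_le _ _).trans ?_
  rw [norm_char, norm_one]; norm_num

lemma norm_char_sub_one_le (h ξ : E n) : ‖char h ξ - 1‖ ≤ 2 * π * (‖ξ‖ * ‖h‖) := by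
  rw [char_eq]
  refine Real.norm_exp_I_mul_ofReal_sub_one_le.trans ?_
  rw [Real.norm_eq_abs, abs_mul, abs_of_pos (by positivity : (0 : ℝ) < 2 * π)]
  gcongr
  exact abs_real_inner_le_norm _ _

/-- Interpolation between the trivial bound and the Lipschitz bound of the character. -/
lemma norm_char_sub_one_le_rpow {r : ℝ} (hr0 : 0 ≤ r) (hr1 : r ≤ 1) (h ξ : E n) :
    ‖char h ξ - 1‖ ≤ 4 * π * ‖h‖ ^ r * bracket r ξ := by
  have hb : ‖ξ‖ ^ r ≤ bracket r ξ := by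
    have : ‖ξ‖ ^ r = (‖ξ‖ ^ 2) ^ (r / 2) := by
      rw [← Real.rpow_natCast, ← Real.rpow_mul (norm_nonneg _)]; congr 1; push_cast; ring
    rw [this]
    exact Real.rpow_le_rpow (by positivity) (by linarith) (by linarith)
  have hx : 0 ≤ ‖ξ‖ * ‖h‖ := by positivity
  have h1 : ‖char h ξ - 1‖ ≤ 4 * π * (‖ξ‖ * ‖h‖) ^ r := by
    have hpi := Real.pi_gt_three
    rcases le_total (‖ξ‖ * ‖h‖) 1 with hle | hge
    · refine (norm_char_sub_one_le h ξ).trans ?_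
      have : ‖ξ‖ * ‖h‖ ≤ (‖ξ‖ * ‖h‖) ^ r := by
        rcases hx.eq_or_lt with h0 | h0
        · rw [← h0]; exact Real.rpow_nonneg le_rfl _
        · conv_lhs => rw [← Real.rpow_one (‖ξ‖ * ‖h‖)]
          exact Real.rpow_le_rpow_of_exponent_ge h0 hle hr1
      nlinarith
    · refine (norm_char_sub_one_le_two h ξ).trans ?_
      have := Real.one_le_rpow hge hr0
      nlinarith
  refine h1.trans ?_
  rw [Real.mul_rpow (norm_nonneg _) (norm_nonneg _)]
  have : 0 ≤ ‖h‖ ^ r := by positivity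
  calc _ = 4 * π * ‖h‖ ^ r * ‖ξ‖ ^ r := by ring
    _ ≤ _ := by gcongr

lemma norm_le_of_fourier_le {f g : L2 n} {c : ℝ}
    (h : ∀ᵐ ξ, ‖(𝓕 f : L2 n) ξ‖ ≤ c * ‖(𝓕 g : L2 n) ξ‖) : ‖f‖ ≤ c * ‖g‖ := by
  rw [← Lp.norm_fourier_eq f, ← Lp.norm_fourier_eq g]
  exact Lp.norm_le_mul_norm_of_ae_le_mul h

lemma norm_le_of_fourier_le_add {f g k : L2 n} {c d : ℝ} (hc : 0 ≤ c) (hd : 0 ≤ d)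
    (h : ∀ᵐ ξ, ‖(𝓕 f : L2 n) ξ‖ ≤ c * ‖(𝓕 g : L2 n) ξ‖ + d * ‖(𝓕 k : L2 n) ξ‖) :
    ‖f‖ ≤ c * ‖g‖ + d * ‖k‖ := by
  rw [← Lp.norm_fourier_eq f, ← Lp.norm_fourier_eq g, ← Lp.norm_fourier_eq k]
  set f' : L2 n := 𝓕 f
  set g' : L2 n := 𝓕 g
  set k' : L2 n := 𝓕 k
  let G : Lp ℝ 2 (volume : Measure (E n)) := (Lp.memLp g').norm.toLp _
  let K : Lp ℝ 2 (volume : Measure (E n)) := (Lp.memLp k').norm.toLp _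
  have hG : ‖G‖ = ‖g'‖ := by
    rw [Lp.norm_toLp, eLpNorm_norm, Lp.norm_def]
  have hK : ‖K‖ = ‖k'‖ := by
    rw [Lp.norm_toLp, eLpNorm_norm, Lp.norm_def]
  have h1 : ‖f'‖ ≤ ‖c • G + d • K‖ := by
    refine Lp.norm_le_norm_of_ae_le ?_
    filter_upwards [h, Lp.coeFn_add (c • G) (d • K), Lp.coeFn_smul c G, Lp.coeFn_smul d K,
      (Lp.memLp g').norm.coeFn_toLp, (Lp.memLp k').norm.coeFn_toLp] with x h1 h2 h3 h4 h5 h6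
    rw [h2, Pi.add_apply, h3, h4, Pi.smul_apply, Pi.smul_apply]
    refine h1.trans (le_trans (le_of_eq ?_) (le_abs_self _))
    rw [smul_eq_mul, smul_eq_mul]
    congr 2
    · exact h5.symm
    · exact h6.symm
  refine h1.trans ((norm_add_le _ _).trans ?_)
  rw [norm_smul, norm_smul, hG, hK, Real.norm_of_nonneg hc, Real.norm_of_nonneg hd]

/-- Functions in `H^r`, `0 ≤ r ≤ 1`, have difference quotients of order `r` in `L²`. -/
lemma norm_shift_sub_le {r : ℝ} (hr0 : 0 ≤ r) (hr1 : r ≤ 1) {f F : L2 n}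
    (hF : besselPotential (E n) ℂ r (f : 𝓢'(E n, ℂ)) = (F : 𝓢'(E n, ℂ))) (h : E n) :
    ‖shift h f - f‖ ≤ 4 * π * ‖h‖ ^ r * ‖F‖ := by
  apply norm_le_of_fourier_le
  rw [besselPotential_eq_iff] at hF
  filter_upwards [fourier_shift_sub h f, hF] with ξ h1 h2
  rw [h1, h2, norm_mul, norm_mul, Complex.norm_of_nonneg (bracket_pos r ξ).le, ← mul_assoc]
  gcongr
  exact norm_char_sub_one_le_rpow hr0 hr1 h ξ

/-- Differences of `J^s w` are controlled by differences of `J^s w - w`, since low frequencies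
contribute a Lipschitz term only. -/
lemma exists_norm_shift_sub_le {s : ℝ} (hs : 0 < s) : ∃ C : ℝ, 0 ≤ C ∧ ∀ {n : ℕ} (w W : L2 n),
    besselPotential (E n) ℂ s (w : 𝓢'(E n, ℂ)) = (W : 𝓢'(E n, ℂ)) → ∀ h : E n,
    ‖shift h W - W‖ ≤ C * (‖shift h (W - w) - (W - w)‖ + ‖h‖ * ‖w‖) := by
  have hc0 : 0 < (2 : ℝ) ^ (s / 2) - 1 := by
    have := Real.one_lt_rpow (x := 2) (by norm_num) (by positivity : 0 < s / 2)
    linarith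
  set c0 := (2 : ℝ) ^ (s / 2) - 1 with hc0def
  refine ⟨1 + c0⁻¹ + 2 * π, by positivity, fun {n} w W hW h => ?_⟩
  rw [besselPotential_eq_iff] at hW
  have key : ‖shift h w - w‖ ≤ c0⁻¹ * ‖shift h (W - w) - (W - w)‖ + (2 * π * ‖h‖) * ‖w‖ := by
    apply norm_le_of_fourier_le_add (by positivity) (by positivity)
    have hsub : (𝓕 (W - w) : L2 n) = 𝓕 W - 𝓕 w := (Lp.fourierTransformₗᵢ (E n) ℂ).map_sub _ _
    filter_upwards [fourier_shift_sub h w, fourier_shift_sub h (W - w), hW,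
      Lp.coeFn_sub (𝓕 W : L2 n) (𝓕 w)] with ξ h1 h2 h3 h4
    rw [h1, h2, hsub, h4, Pi.sub_apply, h3]
    have e1 : (bracket s ξ : ℂ) * (𝓕 w : L2 n) ξ - (𝓕 w : L2 n) ξ =
        ((bracket s ξ - 1 : ℝ) : ℂ) * (𝓕 w : L2 n) ξ := by push_cast; ring
    have hb1 := one_le_bracket hs.le ξ
    rw [e1, norm_mul, norm_mul, norm_mul, Complex.norm_of_nonneg (by linarith)]
    set a := ‖(𝓕 w : L2 n) ξ‖
    have ha : 0 ≤ a := norm_nonneg _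
    -- For `|ξ| ≥ 1` the symbol `⟨ξ⟩^s - 1` of `W - w` is at least `c0`; for `|ξ| ≤ 1` the Lipschitz
    -- bound of the character suffices.
    rcases le_total 1 ‖ξ‖ with hξ | hξ
    · have hb : c0 ≤ bracket s ξ - 1 := by
        have : (2 : ℝ) ^ (s / 2) ≤ bracket s ξ := by
          unfold bracket
          apply Real.rpow_le_rpow (by norm_num) (by nlinarith) (by positivity)
        rw [hc0def]; linarith
      have h5 : 1 ≤ c0⁻¹ * (bracket s ξ - 1) := by
        rw [inv_mul_eq_div, le_div_iff₀ hc0]; linarith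
      have h6 : 0 ≤ ‖char h ξ - 1‖ * a := by positivity
      have h7 : 0 ≤ 2 * π * ‖h‖ * a := by positivity
      calc ‖char h ξ - 1‖ * a ≤ (c0⁻¹ * (bracket s ξ - 1)) * (‖char h ξ - 1‖ * a) := by nlinarith
        _ ≤ _ := by nlinarith
    · have h5 : ‖char h ξ - 1‖ ≤ 2 * π * ‖h‖ := by
        refine (norm_char_sub_one_le h ξ).trans ?_
        have : ‖ξ‖ * ‖h‖ ≤ ‖h‖ := mul_le_of_le_one_left (norm_nonneg _) hξ
        gcongr
      have h6 : 0 ≤ c0⁻¹ * (‖char h ξ - 1‖ * ((bracket s ξ - 1) * a)) := by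
        have : 0 ≤ bracket s ξ - 1 := by linarith
        positivity
      nlinarith
  have h1 : shift h W - W = (shift h (W - w) - (W - w)) + (shift h w - w) := by
    rw [map_sub]; abel
  have h2 : ‖shift h W - W‖ ≤ ‖shift h (W - w) - (W - w)‖ + ‖shift h w - w‖ := by
    conv_lhs => rw [h1]
    exact norm_add_le _ _
  have hA : 0 ≤ ‖shift h (W - w) - (W - w)‖ := norm_nonneg _
  have hB : 0 ≤ ‖h‖ * ‖w‖ := by positivity
  have hci : 0 < c0⁻¹ := inv_pos.2 hc0
  have hpi := Real.pi_pos
  nlinarith [mul_nonneg hpi.le hA, mul_nonneg hci.le hB]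

/-- The `i`-th shift direction at the dyadic step `2^{-j}`. -/
def dyadicStep (i : Fin n) (j : ℕ) : E n := EuclideanSpace.single i (scale j)

lemma norm_dyadicStep (i : Fin n) (j : ℕ) : ‖dyadicStep i j‖ = scale j := by
  simp [dyadicStep, abs_of_pos (scale_pos j)]

lemma dyadicStep_eq (i : Fin n) (j : ℕ) :
    dyadicStep i j = dyadicStep i (j + 1) + dyadicStep i (j + 1) := by
  unfold dyadicStep
  rw [scale_eq j]
  ext k
  simp only [PiLp.add_apply, PiLp.single_apply]
  split_ifs <;> ring

/-- A frequency component of size at least one is seen by some dyadic shift. -/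
lemma exists_one_le_norm_char_sub_one {r : ℝ} (hr : 0 ≤ r) (i : Fin n) {ξ : E n}
    (h : 1 ≤ |ξ i|) : ∃ j : ℕ, 1 ≤ ‖char (dyadicStep i j) ξ - 1‖ ∧
      |ξ i| ^ r * scale j ^ r ≤ 1 := by
  obtain ⟨k, hk1, hk2⟩ : ∃ k : ℕ, (2 : ℝ) ^ k ≤ |ξ i| ∧ |ξ i| < 2 ^ (k + 1) :=
    exists_nat_pow_near h (by norm_num)
  -- For the step `2^{-k-2}` the absolute value of the phase `2π ξ·h` lies between `π / 2` and `π`.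
  refine ⟨k + 2, ?_, ?_⟩
  · have h1 : inner ℝ ξ (dyadicStep i (k + 2)) = scale (k + 2) * ξ i := by
      rw [dyadicStep, EuclideanSpace.inner_single_right]; simp
    rw [char_eq, h1, Complex.norm_exp_I_mul_ofReal_sub_one]
    have hs : scale (k + 2) = (1 / 4) * (2 ^ k)⁻¹ := by
      unfold scale; rw [pow_add, one_div, inv_pow]; ring
    have hp : (0 : ℝ) < 2 ^ k := by positivity
    set θ := scale (k + 2) * |ξ i| with hθ
    have hθ1 : 1 / 4 ≤ θ := by
      rw [hθ, hs, mul_assoc, inv_mul_eq_div]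
      have : 1 ≤ |ξ i| / 2 ^ k := by rw [le_div_iff₀ hp]; linarith
      linarith
    have hθ2 : θ ≤ 1 / 2 := by
      rw [hθ, hs, mul_assoc, inv_mul_eq_div]
      have : |ξ i| / 2 ^ k ≤ 2 := by
        rw [div_le_iff₀ hp]; rw [pow_succ] at hk2; linarith
      linarith
    have hpi := Real.pi_pos
    have habs : ‖2 * Real.sin (2 * π * (scale (k + 2) * ξ i) / 2)‖ = 2 * Real.sin (π * θ) := by
      have e : 2 * π * (scale (k + 2) * ξ i) / 2 = π * (scale (k + 2) * ξ i) := by ring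
      rw [e, norm_mul, Real.norm_eq_abs, Real.norm_eq_abs, abs_two]
      congr 1
      have e2 : π * θ = |π * (scale (k + 2) * ξ i)| := by
        rw [abs_mul, abs_mul, abs_of_pos hpi, abs_of_pos (scale_pos _)]
      rw [e2, ← Real.abs_sin_eq_sin_abs_of_abs_le_pi]
      rw [← e2]; nlinarith
    rw [habs]
    have h6 : Real.sin (π / 6) ≤ Real.sin (π * θ) := by
      apply Real.sin_le_sin_of_le_of_le_pi_div_two <;> nlinarith
    rw [Real.sin_pi_div_six] at h6
    linarith
  · rw [← Real.mul_rpow (abs_nonneg _) (scale_pos _).le]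
    refine Real.rpow_le_one (mul_nonneg (abs_nonneg _) (scale_pos _).le) ?_ hr
    have hs : scale (k + 2) = (1 / 2) * (2 ^ (k + 1))⁻¹ := by
      unfold scale; rw [pow_add, pow_add, one_div, inv_pow]; ring
    have hp : (0 : ℝ) < 2 ^ (k + 1) := by positivity
    rw [hs]
    have : |ξ i| * (2 ^ (k + 1))⁻¹ ≤ 1 := by
      rw [← div_eq_mul_inv, div_le_one hp]; exact hk2.le
    linarith

lemma eLpNorm_two_sq {X F : Type*} [MeasurableSpace X] [NormedAddCommGroup F] (f : X → F)
    (μ : Measure X) : eLpNorm f 2 μ ^ 2 = ∫⁻ x, ‖f x‖ₑ ^ 2 ∂μ := by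
  have := eLpNorm_nnreal_pow_eq_lintegral (f := f) (μ := μ) (p := 2) (by norm_num)
  simpa using this

/-- Either all components of `ξ` are at most one, or the largest one is seen by a dyadic shift. -/
lemma bracket_le_of_dyadic {r : ℝ} (hr : 0 ≤ r) (ξ : E n) :
    bracket r ξ ≤ ((n : ℝ) + 1) ^ (r / 2) ∨ ∃ (i : Fin n) (j : ℕ),
      bracket r ξ ≤ ((n : ℝ) + 1) ^ (r / 2) * (scale j ^ (-r) * ‖char (dyadicStep i j) ξ - 1‖) := by
  have hsum : ‖ξ‖ ^ 2 = ∑ i, |ξ i| ^ 2 := by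
    rw [EuclideanSpace.norm_sq_eq]; simp
  by_cases hall : ∀ i, |ξ i| ≤ 1
  · left
    unfold bracket
    apply Real.rpow_le_rpow (by positivity) _ (by positivity)
    rw [hsum]
    have : ∑ i : Fin n, |ξ i| ^ 2 ≤ ∑ _i : Fin n, (1 : ℝ) :=
      Finset.sum_le_sum fun i _ => pow_le_one₀ (abs_nonneg _) (hall i)
    simp at this
    simp only [sq_abs]
    linarith
  · right
    push Not at hall
    obtain ⟨i0, hi0⟩ := hall
    obtain ⟨i, -, hi⟩ := Finset.exists_max_image Finset.univ (fun i => |ξ i|)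
      ⟨i0, Finset.mem_univ _⟩
    have h1 : 1 ≤ |ξ i| := hi0.le.trans (hi i0 (Finset.mem_univ _))
    obtain ⟨j, hj1, hj2⟩ := exists_one_le_norm_char_sub_one hr i h1
    refine ⟨i, j, ?_⟩
    have hb : bracket r ξ ≤ ((n : ℝ) + 1) ^ (r / 2) * |ξ i| ^ r := by
      have e : |ξ i| ^ r = (|ξ i| ^ 2) ^ (r / 2) := by
        rw [← Real.rpow_natCast, ← Real.rpow_mul (abs_nonneg _)]; congr 1; push_cast; ring
      rw [e, ← Real.mul_rpow (by positivity) (by positivity)]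
      unfold bracket
      apply Real.rpow_le_rpow (by positivity) _ (by positivity)
      rw [hsum]
      have : ∑ k : Fin n, |ξ k| ^ 2 ≤ ∑ _k : Fin n, |ξ i| ^ 2 :=
        Finset.sum_le_sum fun k _ => by
          have := hi k (Finset.mem_univ _)
          gcongr
      simp only [Finset.sum_const, Finset.card_univ, Fintype.card_fin, nsmul_eq_mul] at this
      nlinarith
    refine hb.trans ?_
    gcongr
    have hs := Real.rpow_pos_of_pos (scale_pos j) r
    rw [Real.rpow_neg (scale_pos j).le, inv_mul_eq_div, le_div_iff₀ hs]
    linarith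

/-- Dyadic difference quotients of order `s` in all coordinate directions yield membership in `H^r`
for every `r < s`. -/
lemma exists_eLpNorm_bracket_le (n : ℕ) {r s : ℝ} (hr : 0 ≤ r) (hrs : r < s) :
    ∃ C : ℝ, 0 ≤ C ∧ ∀ (F : L2 n) (T : ℝ), 0 ≤ T → ‖F‖ ≤ T →
      (∀ i j, ‖shift (dyadicStep i j) F - F‖ ≤ T * scale j ^ s) →
      eLpNorm (fun ξ => (bracket r ξ : ℂ) * (𝓕 F : L2 n) ξ) 2 volume ≤ ENNReal.ofReal (C * T) := by
  set q : ℝ := (1 / 2 : ℝ) ^ (2 * (s - r)) with hq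
  have hq0 : 0 ≤ q := by positivity
  have hq1 : q < 1 := Real.rpow_lt_one (by norm_num) (by norm_num) (by linarith)
  have hn1 : (0 : ℝ) < (n : ℝ) + 1 := by positivity
  set A : ℝ := ((n : ℝ) + 1) ^ (r / 2) with hA
  have hA0 : 0 ≤ A := by positivity
  have h1q : 0 < 1 - q := by linarith
  set Q : ℝ := A ^ 2 * (1 + n * (1 - q)⁻¹) with hQ
  have hQ0 : 0 ≤ Q := by positivity
  refine ⟨Real.sqrt Q, Real.sqrt_nonneg _, fun F T hT hF hsh => ?_⟩
  set a : E n → ℂ := fun ξ => (𝓕 F : L2 n) ξ with ha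
  have hnorm : ∀ f : L2 n, ∫⁻ ξ, ‖(𝓕 f : L2 n) ξ‖ₑ ^ 2 = ENNReal.ofReal (‖f‖ ^ 2) := fun f => by
    rw [← eLpNorm_two_sq, ← Lp.enorm_def, ← ofReal_norm, Lp.norm_fourier_eq,
      ENNReal.ofReal_pow (norm_nonneg _)]
  have hmeas : AEMeasurable (fun ξ => ‖a ξ‖ₑ ^ 2) volume :=
    ((Lp.aestronglyMeasurable (𝓕 F : L2 n)).enorm).pow_const 2
  have hterm : ∀ i j, ∫⁻ ξ, ENNReal.ofReal (scale j ^ (-r)) ^ 2 *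
      ‖(char (dyadicStep i j) ξ - 1) * a ξ‖ₑ ^ 2 ≤ ENNReal.ofReal (T ^ 2 * q ^ j) := fun i j => by
    have hs0 := scale_pos j
    rw [lintegral_const_mul' _ _ (by simp)]
    have : ∫⁻ ξ, ‖(char (dyadicStep i j) ξ - 1) * a ξ‖ₑ ^ 2 =
        ENNReal.ofReal (‖shift (dyadicStep i j) F - F‖ ^ 2) := by
      rw [← hnorm]
      refine lintegral_congr_ae ?_
      filter_upwards [fourier_shift_sub (dyadicStep i j) F] with ξ h
      rw [h]
    rw [this, ← ENNReal.ofReal_pow (by positivity), ← ENNReal.ofReal_mul (by positivity)]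
    apply ENNReal.ofReal_le_ofReal
    have e : q ^ j = (scale j ^ (-r)) ^ 2 * (scale j ^ s) ^ 2 := by
      rw [← mul_pow, ← Real.rpow_add hs0, hq, scale, ← Real.rpow_natCast, ← Real.rpow_natCast,
        ← Real.rpow_natCast, ← Real.rpow_mul (by norm_num), ← Real.rpow_mul (by norm_num),
        ← Real.rpow_mul (by norm_num)]
      congr 1; push_cast; ring
    rw [e]
    have := hsh i j
    calc _ ≤ (scale j ^ (-r)) ^ 2 * (T * scale j ^ s) ^ 2 := by gcongr
      _ = _ := by ring
  -- A good step depends on `ξ`, so all dyadic steps are summed; since `r < s`, the integrals of the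
  -- terms form a geometric series with ratio `q`.
  have hpt : ∀ ξ, ‖(bracket r ξ : ℂ) * a ξ‖ₑ ^ 2 ≤ ENNReal.ofReal A ^ 2 * (‖a ξ‖ₑ ^ 2 +
      ∑ i : Fin n, ∑' j : ℕ, ENNReal.ofReal (scale j ^ (-r)) ^ 2 *
        ‖(char (dyadicStep i j) ξ - 1) * a ξ‖ₑ ^ 2) := fun ξ => by
    have hb : ‖(bracket r ξ : ℂ)‖ₑ = ENNReal.ofReal (bracket r ξ) := by
      rw [← ofReal_norm, Complex.norm_of_nonneg (bracket_pos r ξ).le]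
    rw [enorm_mul, hb]
    rcases bracket_le_of_dyadic hr ξ with h | ⟨i, j, h⟩
    · calc _ ≤ (ENNReal.ofReal A * ‖a ξ‖ₑ) ^ 2 := by gcongr
        _ = ENNReal.ofReal A ^ 2 * ‖a ξ‖ₑ ^ 2 := by ring
        _ ≤ _ := by gcongr; exact le_self_add
    · calc _ ≤ (ENNReal.ofReal (A * (scale j ^ (-r) * ‖char (dyadicStep i j) ξ - 1‖)) *
              ‖a ξ‖ₑ) ^ 2 := by gcongr
        _ = ENNReal.ofReal A ^ 2 * (ENNReal.ofReal (scale j ^ (-r)) ^ 2 *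
              ‖(char (dyadicStep i j) ξ - 1) * a ξ‖ₑ ^ 2) := by
            rw [ENNReal.ofReal_mul hA0,
              ENNReal.ofReal_mul (Real.rpow_nonneg (scale_pos j).le _), ofReal_norm, enorm_mul]
            ring
        _ ≤ _ := by
            gcongr
            refine le_trans ?_ le_add_self
            refine le_trans ?_ (Finset.single_le_sum (f := fun i => ∑' j : ℕ,
              ENNReal.ofReal (scale j ^ (-r)) ^ 2 * ‖(char (dyadicStep i j) ξ - 1) * a ξ‖ₑ ^ 2)
              (fun _ _ => zero_le) (Finset.mem_univ i))
            exact ENNReal.le_tsum j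
  have hmeas' : ∀ i j, AEMeasurable (fun ξ => ENNReal.ofReal (scale j ^ (-r)) ^ 2 *
      ‖(char (dyadicStep i j) ξ - 1) * a ξ‖ₑ ^ 2) volume := fun i j => by
    have h1 : AEStronglyMeasurable (fun ξ => (char (dyadicStep i j) ξ - 1) * a ξ) volume :=
      (((continuous_char _).sub continuous_const).aestronglyMeasurable).mul
        (Lp.aestronglyMeasurable (𝓕 F : L2 n))
    exact (h1.enorm.pow_const 2).const_mul _
  have hfin : eLpNorm (fun ξ => (bracket r ξ : ℂ) * a ξ) 2 volume ^ 2 ≤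
      ENNReal.ofReal (Real.sqrt Q * T) ^ 2 := by
    rw [eLpNorm_two_sq]
    refine (lintegral_mono hpt).trans ?_
    rw [lintegral_const_mul' _ _ (by simp), lintegral_add_left' hmeas,
      lintegral_finsetSum' _ fun i _ => AEMeasurable.tsum fun j => hmeas' i j]
    have e1 : ∫⁻ ξ, ‖a ξ‖ₑ ^ 2 ≤ ENNReal.ofReal (T ^ 2) := by
      rw [hnorm F]; apply ENNReal.ofReal_le_ofReal; gcongr
    have e2 : ∀ i : Fin n, ∫⁻ ξ, ∑' j : ℕ, ENNReal.ofReal (scale j ^ (-r)) ^ 2 *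
        ‖(char (dyadicStep i j) ξ - 1) * a ξ‖ₑ ^ 2 ≤ ENNReal.ofReal (T ^ 2 * (1 - q)⁻¹) :=
        fun i => by
      rw [lintegral_tsum fun j => hmeas' i j]
      refine (ENNReal.tsum_le_tsum fun j => hterm i j).trans ?_
      rw [← ENNReal.ofReal_tsum_of_nonneg (fun j => by positivity)
        ((summable_geometric_of_lt_one hq0 hq1).mul_left _), tsum_mul_left,
        tsum_geometric_of_lt_one hq0 hq1]
    calc _ ≤ ENNReal.ofReal A ^ 2 * (ENNReal.ofReal (T ^ 2) +
            ∑ i : Fin n, ENNReal.ofReal (T ^ 2 * (1 - q)⁻¹)) := by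
          gcongr with i; exact e2 i
      _ = ENNReal.ofReal (Real.sqrt Q * T) ^ 2 := by
          rw [Finset.sum_const, Finset.card_univ, Fintype.card_fin, nsmul_eq_mul,
            ← ENNReal.ofReal_natCast, ← ENNReal.ofReal_mul (by positivity),
            ← ENNReal.ofReal_add (by positivity) (by positivity), ← ENNReal.ofReal_pow hA0,
            ← ENNReal.ofReal_mul (by positivity), ← ENNReal.ofReal_pow (by positivity), mul_pow,
            Real.sq_sqrt hQ0, hQ]
          congr 1; ring
  exact (ENNReal.pow_le_pow_left_iff two_ne_zero).1 hfin

end Quotients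

/-! ### The weighted trace inequality -/

section Trace

open FourierTransform
open scoped Real LineDeriv

variable {n : ℕ}

/-- The measure `t^{1-2α} dt` on the half-line. -/
def halfLineMeasure (α : ℝ) : Measure ℝ :=
  (volume.restrict (Set.Ioi 0)).withDensity fun t => ENNReal.ofReal (t ^ (1 - 2 * α))

lemma measurable_weight (α : ℝ) : Measurable fun t : ℝ => ENNReal.ofReal (t ^ (1 - 2 * α)) :=
  (measurable_id.pow_const _).ennreal_ofReal

instance (α : ℝ) : SFinite (halfLineMeasure α) := by
  unfold halfLineMeasure; infer_instance

lemma weightedMeasure_eq_prod (n : ℕ) (α : ℝ) :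
    weightedMeasure n α = (volume : Measure (E n)).prod (halfLineMeasure α) := by
  unfold weightedMeasure halfLineMeasure
  rw [prod_withDensity_right (measurable_weight α)]
  congr 1
  have h : ({p | 0 < p.2} : Set (E n × ℝ)) = Set.univ ×ˢ Set.Ioi 0 := by ext p; simp
  rw [h, Measure.volume_eq_prod, ← Measure.prod_restrict, Measure.restrict_univ]

lemma lintegral_weightedMeasure (α : ℝ) {f : E n × ℝ → ℝ≥0∞} (hf : Measurable f) :
    ∫⁻ p, f p ∂(weightedMeasure n α) = ∫⁻ t, ∫⁻ x, f (x, t) ∂volume ∂(halfLineMeasure α) := by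
  rw [weightedMeasure_eq_prod, lintegral_prod_symm' _ hf]

lemma lintegral_halfLine (α : ℝ) {f : ℝ → ℝ≥0∞} :
    ∫⁻ t, f t ∂(halfLineMeasure α) = ∫⁻ t in Set.Ioi 0, ENNReal.ofReal (t ^ (1 - 2 * α)) * f t := by
  unfold halfLineMeasure
  rw [lintegral_withDensity_eq_lintegral_mul_non_measurable _ (measurable_weight α)]
  · rfl
  · exact ae_of_all _ fun x => ENNReal.ofReal_lt_top

lemma sq_add_le (a b : ℝ≥0∞) : (a + b) ^ 2 ≤ 4 * (a ^ 2 + b ^ 2) := by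
  rcases le_total a b with h | h
  · calc (a + b) ^ 2 ≤ (b + b) ^ 2 := by gcongr
      _ = 4 * b ^ 2 := by ring
      _ ≤ _ := by gcongr; exact le_add_self
  · calc (a + b) ^ 2 ≤ (a + a) ^ 2 := by gcongr
      _ = 4 * a ^ 2 := by ring
      _ ≤ _ := by gcongr; exact le_self_add

/-- Cauchy-Schwarz with the weight `t^{1-2α}`; its reciprocal is integrable at the origin as
`α > 0`. -/
lemma sq_lintegral_le {α R : ℝ} (hα : 0 < α) (hR : 0 < R) {f : ℝ → ℂ} (hf : Continuous f) :
    (∫⁻ t in Set.Ioo 0 R, ‖f t‖ₑ) ^ 2 ≤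
      ENNReal.ofReal (R ^ (2 * α) / (2 * α)) * ∫⁻ t, ‖f t‖ₑ ^ 2 ∂(halfLineMeasure α) := by
  have hw1 : Measurable fun t : ℝ => ENNReal.ofReal (t ^ ((2 * α - 1) / 2)) :=
    (measurable_id.pow_const _).ennreal_ofReal
  have hw2 : Measurable fun t : ℝ => ENNReal.ofReal (t ^ ((1 - 2 * α) / 2)) * ‖f t‖ₑ :=
    (measurable_id.pow_const _).ennreal_ofReal.mul hf.measurable.enorm
  have hH := ENNReal.lintegral_mul_le_Lp_mul_Lq (volume.restrict (Set.Ioo 0 R))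
    Real.HolderConjugate.two_two hw1.aemeasurable hw2.aemeasurable
  have h1 : ∫⁻ t in Set.Ioo 0 R, ‖f t‖ₑ = ∫⁻ t in Set.Ioo 0 R,
      ((fun t : ℝ => ENNReal.ofReal (t ^ ((2 * α - 1) / 2))) *
        fun t : ℝ => ENNReal.ofReal (t ^ ((1 - 2 * α) / 2)) * ‖f t‖ₑ) t := by
    refine setLIntegral_congr_fun measurableSet_Ioo fun t ht => ?_
    simp only [Pi.mul_apply]
    have ht0 : 0 < t := ht.1
    rw [← mul_assoc, ← ENNReal.ofReal_mul (by positivity), ← Real.rpow_add ht0]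
    have : (2 * α - 1) / 2 + (1 - 2 * α) / 2 = 0 := by ring
    rw [this]; simp
  have h2 : ∫⁻ t in Set.Ioo 0 R, ENNReal.ofReal (t ^ ((2 * α - 1) / 2)) ^ (2 : ℝ) =
      ENNReal.ofReal (R ^ (2 * α) / (2 * α)) := by
    have hint : IntegrableOn (fun t : ℝ => t ^ (2 * α - 1)) (Set.Ioo 0 R) := by
      have := intervalIntegral.intervalIntegrable_rpow' (a := 0) (b := R) (r := 2 * α - 1)
        (by linarith)
      rw [intervalIntegrable_iff_integrableOn_Ioo_of_le hR.le] at this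
      exact this
    have e : ∫ t in Set.Ioo 0 R, t ^ (2 * α - 1) = R ^ (2 * α) / (2 * α) := by
      rw [← integral_Ioc_eq_integral_Ioo, ← intervalIntegral.integral_of_le hR.le,
        integral_rpow (Or.inl (by linarith))]
      rw [sub_add_cancel, Real.zero_rpow (by linarith), sub_zero]
    rw [← e, ofReal_integral_eq_lintegral_ofReal hint]
    · refine setLIntegral_congr_fun measurableSet_Ioo fun t ht => ?_
      have ht0 : 0 < t := ht.1
      rw [ENNReal.ofReal_rpow_of_nonneg (by positivity) (by norm_num), ← Real.rpow_mul ht0.le]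
      congr 2; ring
    · filter_upwards [ae_restrict_mem measurableSet_Ioo] with t ht
      exact Real.rpow_nonneg ht.1.le _
  have h3 : ∫⁻ t in Set.Ioo 0 R, (ENNReal.ofReal (t ^ ((1 - 2 * α) / 2)) * ‖f t‖ₑ) ^ (2 : ℝ) ≤
      ∫⁻ t, ‖f t‖ₑ ^ 2 ∂(halfLineMeasure α) := by
    rw [lintegral_halfLine]
    refine le_trans (le_of_eq ?_) (lintegral_mono_set (fun t ht => ht.1 : Set.Ioo 0 R ⊆ Set.Ioi 0))
    refine setLIntegral_congr_fun measurableSet_Ioo fun t ht => ?_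
    have ht0 : 0 < t := ht.1
    rw [ENNReal.mul_rpow_of_nonneg _ _ (by norm_num),
      ENNReal.ofReal_rpow_of_nonneg (by positivity) (by norm_num), ← Real.rpow_mul ht0.le]
    norm_num
  rw [h1]
  calc _ ≤ (ENNReal.ofReal (R ^ (2 * α) / (2 * α)) ^ (1 / 2 : ℝ) *
        (∫⁻ t, ‖f t‖ₑ ^ 2 ∂(halfLineMeasure α)) ^ (1 / 2 : ℝ)) ^ 2 := by
        gcongr
        refine hH.trans ?_
        rw [h2]
        gcongr
    _ = _ := by
        rw [mul_pow, ← ENNReal.rpow_natCast, ← ENNReal.rpow_natCast, ← ENNReal.rpow_mul,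
          ← ENNReal.rpow_mul]
        norm_num

/-- The trace inequality for one frequency: average `f 0 = f s - ∫₀ˢ f'` over `s ∈ (0, 1/ρ)`. -/
lemma enorm_sq_trace_le {α ρ : ℝ} (hα : 0 < α) (hρ : 0 < ρ) {f f' : ℝ → ℂ}
    (hf : ∀ t, HasDerivAt f (f' t) t) (hf' : Continuous f') :
    ENNReal.ofReal (ρ ^ (2 * α)) * ‖f 0‖ₑ ^ 2 ≤ ENNReal.ofReal (2 / α) *
      (ENNReal.ofReal (ρ ^ 2) * ∫⁻ t, ‖f t‖ₑ ^ 2 ∂(halfLineMeasure α) +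
        ∫⁻ t, ‖f' t‖ₑ ^ 2 ∂(halfLineMeasure α)) := by
  set R := ρ⁻¹ with hR
  have hR0 : 0 < R := inv_pos.2 hρ
  have hfc : Continuous f := continuous_iff_continuousAt.2 fun t => (hf t).continuousAt
  set A := ∫⁻ t in Set.Ioo 0 R, ‖f t‖ₑ
  set B := ∫⁻ t in Set.Ioo 0 R, ‖f' t‖ₑ with hB
  have h1 : ∀ s ∈ Set.Ioo 0 R, ‖f 0‖ₑ ≤ ‖f s‖ₑ + B := fun s hs => by
    have e := intervalIntegral.integral_eq_sub_of_hasDerivAt (a := 0) (b := s) (fun t _ => hf t)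
      (hf'.intervalIntegrable _ _)
    have e' : f 0 = f s - ∫ t in (0)..s, f' t := by rw [e]; ring
    rw [e']
    refine enorm_sub_le.trans ?_
    gcongr
    rw [intervalIntegral.integral_of_le hs.1.le]
    refine (enorm_integral_le_lintegral_enorm _).trans ?_
    exact lintegral_mono_set fun t ht => ⟨ht.1, ht.2.trans_lt hs.2⟩
  have h2 : ENNReal.ofReal R * ‖f 0‖ₑ ≤ A + ENNReal.ofReal R * B := by
    have := setLIntegral_mono' (μ := volume) measurableSet_Ioo h1
    rw [lintegral_add_left hfc.measurable.enorm] at this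
    simp only [lintegral_const, Measure.restrict_apply MeasurableSet.univ, Set.univ_inter,
      Real.volume_Ioo, sub_zero] at this
    rw [mul_comm, mul_comm (ENNReal.ofReal R)]
    exact this
  have hA := sq_lintegral_le hα hR0 hfc
  have hB' := sq_lintegral_le hα hR0 hf'
  set X := ∫⁻ t, ‖f t‖ₑ ^ 2 ∂(halfLineMeasure α)
  set Y := ∫⁻ t, ‖f' t‖ₑ ^ 2 ∂(halfLineMeasure α)
  set K := ENNReal.ofReal (R ^ (2 * α) / (2 * α))
  have h3 : ENNReal.ofReal R ^ 2 * ‖f 0‖ₑ ^ 2 ≤ 4 * (K * X + ENNReal.ofReal R ^ 2 * (K * Y)) := by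
    calc _ = (ENNReal.ofReal R * ‖f 0‖ₑ) ^ 2 := by ring
      _ ≤ (A + ENNReal.ofReal R * B) ^ 2 := by gcongr
      _ ≤ 4 * (A ^ 2 + (ENNReal.ofReal R * B) ^ 2) := sq_add_le _ _
      _ ≤ _ := by rw [mul_pow]; gcongr
  have hρR : ENNReal.ofReal ρ ^ 2 * ENNReal.ofReal R ^ 2 = 1 := by
    rw [← mul_pow, ← ENNReal.ofReal_mul hρ.le, hR, mul_inv_cancel₀ hρ.ne']; simp
  have hK : ENNReal.ofReal (ρ ^ (2 * α)) * K = ENNReal.ofReal (1 / (2 * α)) := by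
    rw [← ENNReal.ofReal_mul (by positivity), hR, Real.inv_rpow hρ.le]
    congr 1
    have : 0 < ρ ^ (2 * α) := by positivity
    field_simp
  have h4 : (4 : ℝ≥0∞) * ENNReal.ofReal (1 / (2 * α)) = ENNReal.ofReal (2 / α) := by
    rw [show (4 : ℝ≥0∞) = ENNReal.ofReal 4 by simp, ← ENNReal.ofReal_mul (by norm_num)]
    congr 1; field_simp; norm_num
  calc ENNReal.ofReal (ρ ^ (2 * α)) * ‖f 0‖ₑ ^ 2
      = ENNReal.ofReal (ρ ^ (2 * α)) * ENNReal.ofReal ρ ^ 2 *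
          (ENNReal.ofReal R ^ 2 * ‖f 0‖ₑ ^ 2) := by
        rw [show ENNReal.ofReal (ρ ^ (2 * α)) * ENNReal.ofReal ρ ^ 2 *
          (ENNReal.ofReal R ^ 2 * ‖f 0‖ₑ ^ 2) = ENNReal.ofReal (ρ ^ (2 * α)) *
          (ENNReal.ofReal ρ ^ 2 * ENNReal.ofReal R ^ 2) * ‖f 0‖ₑ ^ 2 by ring, hρR, mul_one]
    _ ≤ ENNReal.ofReal (ρ ^ (2 * α)) * ENNReal.ofReal ρ ^ 2 *
          (4 * (K * X + ENNReal.ofReal R ^ 2 * (K * Y))) := by gcongr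
    _ = 4 * (ENNReal.ofReal (ρ ^ (2 * α)) * K) * (ENNReal.ofReal ρ ^ 2 * X +
          (ENNReal.ofReal ρ ^ 2 * ENNReal.ofReal R ^ 2) * Y) := by ring
    _ = _ := by rw [hρR, hK, h4, one_mul, ← ENNReal.ofReal_pow hρ.le]

/-- The slice `x ↦ ψ(x, t)` of a smooth compactly supported function, as a Schwartz function. -/
def slice {ψ : E n × ℝ → ℂ} (hψ : ContDiff ℝ ∞ ψ) (hc : HasCompactSupport ψ) (t : ℝ) :
    𝓢(E n, ℂ) :=
  HasCompactSupport.toSchwartzMap (f := fun x => ψ (x, t))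
    (HasCompactSupport.intro (hc.isCompact.image continuous_fst) fun x hx => by
      by_contra h
      exact hx ⟨(x, t), subset_tsupport ψ h, rfl⟩)
    (hψ.comp (by fun_prop : ContDiff ℝ ∞ fun x : E n => (x, t)))

lemma slice_apply {ψ : E n × ℝ → ℂ} (hψ : ContDiff ℝ ∞ ψ) (hc : HasCompactSupport ψ) (t : ℝ)
    (x : E n) : slice hψ hc t x = ψ (x, t) := rfl

lemma contDiff_fderiv_apply {ψ : E n × ℝ → ℂ} (hψ : ContDiff ℝ ∞ ψ) (m : E n × ℝ) :
    ContDiff ℝ ∞ fun p => fderiv ℝ ψ p m :=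
  (hψ.fderiv_right (by simp)).clm_apply contDiff_const

lemma hasCompactSupport_fderiv_apply {ψ : E n × ℝ → ℂ} (hc : HasCompactSupport ψ) (m : E n × ℝ) :
    HasCompactSupport fun p => fderiv ℝ ψ p m :=
  hc.fderiv_apply ℝ m

lemma fourier_slice_apply {ψ : E n × ℝ → ℂ} (hψ : ContDiff ℝ ∞ ψ) (hc : HasCompactSupport ψ)
    (t : ℝ) (ξ : E n) :
    (𝓕 (slice hψ hc t) : 𝓢(E n, ℂ)) ξ = ∫ x, 𝐞 (-inner ℝ x ξ) • ψ (x, t) := by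
  rw [SchwartzMap.fourier_coe, Real.fourier_eq]
  rfl

lemma measurable_fourier_slice {ψ : E n × ℝ → ℂ} (hψ : ContDiff ℝ ∞ ψ) (hc : HasCompactSupport ψ) :
    Measurable fun p : E n × ℝ => (𝓕 (slice hψ hc p.2) : 𝓢(E n, ℂ)) p.1 := by
  simp only [fourier_slice_apply]
  have hψc := hψ.continuous
  have : Continuous fun q : (E n × ℝ) × E n => 𝐞 (-inner ℝ q.2 q.1.1) • ψ (q.2, q.1.2) := by
    fun_prop
  exact this.stronglyMeasurable.integral_prod_right'.measurable

lemma hasDerivAt_fourier_slice {ψ : E n × ℝ → ℂ} (hψ : ContDiff ℝ ∞ ψ) (hc : HasCompactSupport ψ)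
    (ξ : E n) (t : ℝ) :
    HasDerivAt (fun t => (𝓕 (slice hψ hc t) : 𝓢(E n, ℂ)) ξ)
      ((𝓕 (slice (contDiff_fderiv_apply hψ (0, 1)) (hasCompactSupport_fderiv_apply hc (0, 1)) t) :
        𝓢(E n, ℂ)) ξ) t := by
  simp only [fourier_slice_apply]
  have hd := contDiff_fderiv_apply hψ (0, 1)
  have hdc := hasCompactSupport_fderiv_apply hc (0, 1)
  obtain ⟨C, hC⟩ := hd.continuous.bounded_above_of_compact_support hdc
  set K : Set (E n) := Prod.fst '' (tsupport fun p => fderiv ℝ ψ p (0, 1)) with hK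
  have hKc : IsCompact K := hdc.isCompact.image continuous_fst
  have hcont : ∀ t, Continuous fun x => 𝐞 (-inner ℝ x ξ) • ψ (x, t) := fun t => by
    have := hψ.continuous; fun_prop
  have hcont' : ∀ t, Continuous fun x => 𝐞 (-inner ℝ x ξ) • fderiv ℝ ψ (x, t) (0, 1) := fun t => by
    have := hd.continuous
    have h2 : Continuous fun x : E n => fderiv ℝ ψ (x, t) (0, 1) :=
      this.comp (by fun_prop : Continuous fun x : E n => (x, t))
    fun_prop
  refine (hasDerivAt_integral_of_dominated_loc_of_deriv_le (s := Set.univ)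
    (F' := fun t x => 𝐞 (-inner ℝ x ξ) • fderiv ℝ ψ (x, t) (0, 1))
    (bound := K.indicator fun _ => C) Filter.univ_mem
    (Eventually.of_forall fun t => (hcont t).aestronglyMeasurable) ?_
    (hcont' t).aestronglyMeasurable ?_ ?_ ?_).2
  · exact (Real.fourierIntegral_convergent_iff ξ).2 (slice hψ hc t).integrable
  · refine ae_of_all _ fun x s _ => ?_
    rw [Circle.norm_smul]
    by_cases hx : x ∈ K
    · rw [Set.indicator_of_mem hx]; exact hC _
    · rw [Set.indicator_of_notMem hx]
      have : fderiv ℝ ψ (x, s) (0, 1) = 0 := by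
        by_contra h
        exact hx ⟨(x, s), subset_tsupport (fun p => fderiv ℝ ψ p (0, 1)) h, rfl⟩
      rw [this, norm_zero]
  · exact (integrable_indicator_iff hKc.measurableSet).2 (integrableOn_const hKc.measure_lt_top.ne)
  · refine ae_of_all _ fun x s _ => ?_
    have h1 : HasDerivAt (fun s : ℝ => ψ (x, s)) (fderiv ℝ ψ (x, s) (0, 1)) s := by
      have h2 := ((hψ.differentiable (by simp)) (x, s)).hasFDerivAt
      exact h2.comp_hasDerivAt s ((hasDerivAt_const s x).prodMk (hasDerivAt_id s))
    exact h1.const_smul _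

lemma fourier_slice_fderiv {ψ : E n × ℝ → ℂ} (hψ : ContDiff ℝ ∞ ψ) (hc : HasCompactSupport ψ)
    (m ξ : E n) (t : ℝ) :
    (𝓕 (slice (contDiff_fderiv_apply hψ (m, 0)) (hasCompactSupport_fderiv_apply hc (m, 0)) t) :
      𝓢(E n, ℂ)) ξ = (2 * π * Complex.I) * (inner ℝ ξ m * (𝓕 (slice hψ hc t) : 𝓢(E n, ℂ)) ξ) := by
  have h1 : slice (contDiff_fderiv_apply hψ (m, 0)) (hasCompactSupport_fderiv_apply hc (m, 0)) t =
      ∂_{m} (slice hψ hc t) := by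
    ext x
    rw [slice_apply, SchwartzMap.lineDerivOp_apply_eq_fderiv]
    have h2 := ((hψ.differentiable (by simp)) (x, t)).hasFDerivAt
    have h3 : HasFDerivAt (fun x : E n => (x, t)) (ContinuousLinearMap.inl ℝ (E n) ℝ) x :=
      hasFDerivAt_prodMk_left x t
    have h4 := h2.comp x h3
    have h5 : fderiv ℝ (slice hψ hc t) x = (fderiv ℝ ψ (x, t)).comp
        (ContinuousLinearMap.inl ℝ (E n) ℝ) := h4.fderiv
    rw [h5]; simp
  rw [h1, SchwartzMap.fourier_lineDerivOp_eq]
  have hg : (fun x : E n => inner ℝ x m).HasTemperateGrowth := by fun_prop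
  simp [SchwartzMap.smulLeftCLM_apply_apply hg]

lemma lintegral_fourier_eq (φ : 𝓢(E n, ℂ)) :
    ∫⁻ ξ, ‖(𝓕 φ : 𝓢(E n, ℂ)) ξ‖ₑ ^ 2 = ∫⁻ x, ‖φ x‖ₑ ^ 2 := by
  rw [← eLpNorm_two_sq, ← eLpNorm_two_sq]
  have h : ∀ φ : 𝓢(E n, ℂ), eLpNorm φ 2 volume = ‖φ.toLp 2 volume‖ₑ := fun φ => by
    rw [Lp.enorm_def]; exact (eLpNorm_congr_ae (φ.coeFn_toLp 2 volume)).symm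
  rw [h, h, ← ofReal_norm, ← ofReal_norm, SchwartzMap.norm_fourier_toL2_eq]

/-- Plancherel in the tangential variables. -/
lemma lintegral_fourier_slice {ψ : E n × ℝ → ℂ} (hψ : ContDiff ℝ ∞ ψ) (hc : HasCompactSupport ψ)
    (α : ℝ) :
    ∫⁻ ξ, ∫⁻ t, ‖(𝓕 (slice hψ hc t) : 𝓢(E n, ℂ)) ξ‖ₑ ^ 2 ∂(halfLineMeasure α) =
      ∫⁻ p, ‖ψ p‖ₑ ^ 2 ∂(weightedMeasure n α) := by
  rw [lintegral_lintegral_swap, lintegral_weightedMeasure α]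
  · refine lintegral_congr fun t => ?_
    exact lintegral_fourier_eq _
  · exact hψ.continuous.measurable.enorm.pow_const 2
  · exact ((measurable_fourier_slice hψ hc).enorm.pow_const 2).aemeasurable

lemma enorm_sq_eq_sum {ι : Type*} [Fintype ι] (x : EuclideanSpace ℂ ι) :
    ‖x‖ₑ ^ 2 = ∑ k, ‖x k‖ₑ ^ 2 := by
  simp only [← ofReal_norm, ← ENNReal.ofReal_pow (norm_nonneg _)]
  rw [EuclideanSpace.norm_sq_eq, ENNReal.ofReal_sum_of_nonneg fun _ _ => by positivity]

lemma bracket_sub_one_sq_le {α : ℝ} (h0 : 0 < α) (h1 : α < 1) (ξ : E n) :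
    (bracket α ξ - 1) ^ 2 ≤ ‖ξ‖ ^ (2 * α) := by
  have h2 : bracket α ξ ≤ 1 + ‖ξ‖ ^ α := by
    unfold bracket
    have := Real.rpow_add_le_add_rpow (p := α / 2) zero_le_one (sq_nonneg ‖ξ‖) (by linarith)
      (by linarith)
    rw [Real.one_rpow, ← Real.rpow_natCast, ← Real.rpow_mul (norm_nonneg _)] at this
    convert this using 3
    · simp
    · push_cast; ring
  have h3 := one_le_bracket h0.le ξ
  calc _ ≤ (‖ξ‖ ^ α) ^ 2 := by
        apply pow_le_pow_left₀ <;> linarith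
    _ = _ := by rw [← Real.rpow_natCast, ← Real.rpow_mul (norm_nonneg _)]; congr 1; push_cast; ring

/-- The weighted trace inequality for smooth functions. It follows from the inequality for one
frequency with `ρ = |ξ|`, so that only the homogeneous part `⟨ξ⟩^α - 1 ≤ |ξ|^α` is controlled. -/
lemma lintegral_trace_le {α : ℝ} (h0 : 0 < α) (h1 : α < 1) {ψ : E n × ℝ → ℂ}
    (hψ : ContDiff ℝ ∞ ψ) (hc : HasCompactSupport ψ) :
    ∫⁻ ξ, ENNReal.ofReal ((bracket α ξ - 1) ^ 2) * ‖(𝓕 (slice hψ hc 0) : 𝓢(E n, ℂ)) ξ‖ₑ ^ 2 ≤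
      ENNReal.ofReal (2 / α) * eLpNorm (classicalGrad ψ) 2 (weightedMeasure n α) ^ 2 := by
  -- `J m ξ` is the weighted energy of the derivative along `m` at the tangential frequency `ξ`.
  let J : (E n × ℝ) → E n → ℝ≥0∞ := fun m ξ => ∫⁻ t, ‖(𝓕 (slice (contDiff_fderiv_apply hψ m)
    (hasCompactSupport_fderiv_apply hc m) t) : 𝓢(E n, ℂ)) ξ‖ₑ ^ 2 ∂(halfLineMeasure α)
  have hJm : ∀ m, Measurable (J m) := fun m =>
    ((measurable_fourier_slice (contDiff_fderiv_apply hψ m)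
      (hasCompactSupport_fderiv_apply hc m)).enorm.pow_const 2).lintegral_prod_right'
  have hpt : ∀ ξ, ENNReal.ofReal ((bracket α ξ - 1) ^ 2) *
      ‖(𝓕 (slice hψ hc 0) : 𝓢(E n, ℂ)) ξ‖ₑ ^ 2 ≤
      ENNReal.ofReal (2 / α) * (∑ i : Fin n, J (EuclideanSpace.single i 1, 0) ξ + J (0, 1) ξ) :=
    fun ξ => by
    rcases eq_or_ne ξ 0 with rfl | hξ
    · simp [bracket]
    have hρ : 0 < ‖ξ‖ := norm_pos_iff.2 hξ
    have hder := hasDerivAt_fourier_slice hψ hc ξ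
    have hcont : Continuous fun t => (𝓕 (slice (contDiff_fderiv_apply hψ (0, 1))
        (hasCompactSupport_fderiv_apply hc (0, 1)) t) : 𝓢(E n, ℂ)) ξ :=
      continuous_iff_continuousAt.2 fun t => (hasDerivAt_fourier_slice _ _ ξ t).continuousAt
    have hcont0 : Continuous fun t => (𝓕 (slice hψ hc t) : 𝓢(E n, ℂ)) ξ :=
      continuous_iff_continuousAt.2 fun t => (hder t).continuousAt
    calc _ ≤ ENNReal.ofReal (‖ξ‖ ^ (2 * α)) * ‖(𝓕 (slice hψ hc 0) : 𝓢(E n, ℂ)) ξ‖ₑ ^ 2 := by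
          gcongr; exact bracket_sub_one_sq_le h0 h1 ξ
      _ ≤ _ := enorm_sq_trace_le h0 hρ hder hcont
      _ ≤ _ := by
          gcongr
          rw [EuclideanSpace.norm_sq_eq, ENNReal.ofReal_sum_of_nonneg fun _ _ => by positivity,
            Finset.sum_mul]
          refine Finset.sum_le_sum fun i _ => ?_
          rw [← lintegral_const_mul' _ _ (by simp)]
          refine lintegral_mono fun t => ?_
          simp only
          rw [fourier_slice_fderiv hψ hc, enorm_mul (2 * π * Complex.I : ℂ), mul_pow]
          have e1 : (1 : ℝ≥0∞) ≤ ‖(2 * π * Complex.I : ℂ)‖ₑ ^ 2 := by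
            apply one_le_pow_of_one_le'
            rw [← ofReal_norm, ENNReal.one_le_ofReal]
            simp only [norm_mul, Complex.norm_I, mul_one, Complex.norm_ofNat, Complex.norm_real,
              Real.norm_eq_abs, abs_of_pos Real.pi_pos]
            linarith [Real.pi_gt_three]
          have e2 : ENNReal.ofReal (‖ξ i‖ ^ 2) =
              ‖((inner ℝ ξ (EuclideanSpace.single i (1 : ℝ)) : ℝ) : ℂ)‖ₑ ^ 2 := by
            rw [EuclideanSpace.inner_single_right, ← ofReal_norm, Complex.norm_real,
              ENNReal.ofReal_pow (norm_nonneg _)]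
            simp
          rw [e2, ← mul_pow, ← enorm_mul]
          exact le_mul_of_one_le_left' e1
  have hJi : ∀ m, ∫⁻ ξ, J m ξ = ∫⁻ p, ‖fderiv ℝ ψ p m‖ₑ ^ 2 ∂(weightedMeasure n α) := fun m =>
    lintegral_fourier_slice _ _ α
  refine (lintegral_mono hpt).trans ?_
  rw [lintegral_const_mul' _ _ (by simp), lintegral_add_right _ (hJm _),
    lintegral_finsetSum _ fun i _ => hJm _, eLpNorm_two_sq]
  gcongr
  simp only [hJi, enorm_sq_eq_sum, Fintype.sum_sum_type, classicalGrad]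
  have hm : ∀ m : E n × ℝ, Measurable fun p => ‖fderiv ℝ ψ p m‖ₑ ^ 2 := fun m =>
    (contDiff_fderiv_apply hψ m).continuous.measurable.enorm.pow_const 2
  simp only [Sum.elim_inl, Sum.elim_inr, Finset.univ_unique, Finset.sum_singleton]
  rw [lintegral_add_right _ (hm _), lintegral_finsetSum _ fun i _ => hm _]

end Trace

/-! ### Operations on the energy space -/

section EnergySpace

open FourierTransform

variable {n : ℕ}

lemma two_le_traceExponent_real (hn : 2 ≤ n) {α : ℝ} (h0 : 0 < α) (h1 : α < 1) :
    2 ≤ 2 * n / (n - 2 * α) := by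
  have : (2 : ℝ) ≤ n := by exact_mod_cast hn
  rw [le_div_iff₀ (by linarith)]; nlinarith

lemma one_le_traceExponent (hn : 2 ≤ n) {α : ℝ} (h0 : 0 < α) (h1 : α < 1) :
    1 ≤ traceExponent n α := by
  unfold traceExponent
  rw [ENNReal.one_le_ofReal]
  linarith [two_le_traceExponent_real hn h0 h1]

lemma classicalGrad_sub {ψ φ : E n × ℝ → ℂ} (hψ : Differentiable ℝ ψ) (hφ : Differentiable ℝ φ) :
    classicalGrad (ψ - φ) = classicalGrad ψ - classicalGrad φ := by
  funext p
  ext k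
  rcases k with i | i <;>
  simp [classicalGrad, fderiv_sub (hψ p) (hφ p)]

lemma continuous_classicalGrad {ψ : E n × ℝ → ℂ} (hψ : ContDiff ℝ ∞ ψ) :
    Continuous (classicalGrad ψ) := by
  unfold classicalGrad
  refine (PiLp.continuous_toLp 2 _).comp (continuous_pi fun k => ?_)
  rcases k with i | i
  · exact (contDiff_fderiv_apply hψ _).continuous
  · exact (contDiff_fderiv_apply hψ _).continuous

/-- The tangential shift `(x, t) ↦ (x + h, t)`. -/
def tangentialShift (h : E n) (p : E n × ℝ) : E n × ℝ := (p.1 + h, p.2)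

lemma tangentialShift_eq (h : E n) : tangentialShift h = fun p => p + (h, 0) := by
  funext p; simp [tangentialShift, Prod.ext_iff]

lemma measurePreserving_tangentialShift (h : E n) (α : ℝ) :
    MeasurePreserving (tangentialShift h) (weightedMeasure n α) (weightedMeasure n α) := by
  rw [weightedMeasure_eq_prod]
  exact (measurePreserving_add_right volume h).prod (MeasurePreserving.id _)

lemma contDiff_tangentialShift (h : E n) : ContDiff ℝ ∞ (tangentialShift h) := by
  rw [tangentialShift_eq]; fun_prop

lemma classicalGrad_comp_tangentialShift (ψ : E n × ℝ → ℂ) (h : E n) :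
    classicalGrad (ψ ∘ tangentialShift h) = classicalGrad ψ ∘ tangentialShift h := by
  have : ∀ p, fderiv ℝ (ψ ∘ tangentialShift h) p = fderiv ℝ ψ (tangentialShift h p) := fun p => by
    rw [tangentialShift_eq]
    exact fderiv_comp_add_right (f := ψ) (x := p) (h, (0 : ℝ))
  funext p
  simp [classicalGrad, this]

/-- Componentwise complex conjugation of a field. -/
def conjField (G : Field n) : Field n := fun p => WithLp.toLp 2 fun k => star (G p k)

lemma norm_conjField (G : Field n) (p : E n × ℝ) : ‖conjField G p‖ = ‖G p‖ := by
  rw [EuclideanSpace.norm_eq, EuclideanSpace.norm_eq]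
  simp [conjField]

lemma conjField_sub (G H : Field n) : conjField (G - H) = conjField G - conjField H := by
  funext p; ext k; simp [conjField]

lemma aestronglyMeasurable_conjField {G : Field n} {μ : Measure (E n × ℝ)}
    (hG : AEStronglyMeasurable G μ) : AEStronglyMeasurable (conjField G) μ := by
  have : Continuous fun v : EuclideanSpace ℂ (Fin n ⊕ Unit) =>
      (WithLp.toLp 2 fun k => star (v k) : EuclideanSpace ℂ (Fin n ⊕ Unit)) := by
    refine (PiLp.continuous_toLp 2 _).comp (continuous_pi fun k => ?_)
    exact continuous_star.comp ((EuclideanSpace.proj k).continuous)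
  exact this.comp_aestronglyMeasurable hG

lemma classicalGrad_star {ψ : E n × ℝ → ℂ} (hψ : Differentiable ℝ ψ) :
    classicalGrad (star ψ) = conjField (classicalGrad ψ) := by
  have : ∀ p, fderiv ℝ (star ψ) p = (Complex.conjCLE : ℂ →L[ℝ] ℂ).comp (fderiv ℝ ψ p) := fun p =>
    ((Complex.conjCLE : ℂ →L[ℝ] ℂ).hasFDerivAt.comp p (hψ p).hasFDerivAt).fderiv
  funext p
  ext k
  rcases k with i | i <;> simp [classicalGrad, conjField, this]

variable {α : ℝ} {u u' : E n × ℝ → ℂ} {G G' : Field n} {v v' : E n → ℂ}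

lemma InEnergySpace.congr_trace (h : InEnergySpace α u G v) (hv : v =ᵐ[volume] v') :
    InEnergySpace α u G v' := by
  obtain ⟨ψ, h1, h2, h3, h4, h5⟩ := h.approx
  refine ⟨h.aesm_fun, h.memLp_grad, h.aesm_trace.congr hv, ψ, h1, h2, h3, h4, ?_⟩
  convert! h5 using 2 with k
  refine eLpNorm_congr_ae ?_
  filter_upwards [hv] with x hx
  rw [hx]

lemma InEnergySpace.sub (hp : 1 ≤ traceExponent n α) (h : InEnergySpace α u G v)
    (h' : InEnergySpace α u' G' v') : InEnergySpace α (u - u') (G - G') (v - v') := by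
  obtain ⟨ψ, h1, h2, h3, h4, h5⟩ := h.approx
  obtain ⟨φ, k1, k2, k3, k4, k5⟩ := h'.approx
  refine ⟨h.aesm_fun.sub h'.aesm_fun, h.memLp_grad.sub h'.memLp_grad,
    h.aesm_trace.sub h'.aesm_trace, fun k => ψ k - φ k, fun k => (h1 k).sub (k1 k),
    fun k => (h2 k).sub (k2 k), ?_, fun R => ?_, ?_⟩
  · refine tendsto_of_tendsto_of_tendsto_of_le_of_le tendsto_const_nhds
      (by simpa using h3.add k3) (fun _ => zero_le) fun k => ?_
    have e : classicalGrad (ψ k - φ k) - (G - G') =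
        (classicalGrad (ψ k) - G) - (classicalGrad (φ k) - G') := by
      rw [classicalGrad_sub ((h1 k).differentiable (by simp)) ((k1 k).differentiable (by simp))]
      abel
    simp only [e]
    exact eLpNorm_sub_le
      ((continuous_classicalGrad (h1 k)).aestronglyMeasurable.sub h.memLp_grad.1)
      ((continuous_classicalGrad (k1 k)).aestronglyMeasurable.sub h'.memLp_grad.1) (by norm_num)
  · refine tendsto_of_tendsto_of_tendsto_of_le_of_le tendsto_const_nhds
      (by simpa using (h4 R).add (k4 R)) (fun _ => zero_le) fun k => ?_
    have e : (ψ k - φ k) - (u - u') = (ψ k - u) - (φ k - u') := by abel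
    simp only [e]
    exact eLpNorm_sub_le
      ((h1 k).continuous.aestronglyMeasurable.sub
        (h.aesm_fun.mono_measure Measure.restrict_le_self))
      ((k1 k).continuous.aestronglyMeasurable.sub
        (h'.aesm_fun.mono_measure Measure.restrict_le_self))
      (by norm_num)
  · refine tendsto_of_tendsto_of_tendsto_of_le_of_le tendsto_const_nhds
      (by simpa using h5.add k5) (fun _ => zero_le) fun k => ?_
    have e : (fun x : E n => (ψ k - φ k) (x, 0) - (v - v') x) =
        (fun x => ψ k (x, 0) - v x) - (fun x => φ k (x, 0) - v' x) := by
      funext x; simp only [Pi.sub_apply]; ring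
    simp only [e]
    have c1 : Continuous fun x : E n => ψ k (x, 0) := (h1 k).continuous.comp (by fun_prop)
    have c2 : Continuous fun x : E n => φ k (x, 0) := (k1 k).continuous.comp (by fun_prop)
    exact eLpNorm_sub_le (c1.aestronglyMeasurable.sub h.aesm_trace)
      (c2.aestronglyMeasurable.sub h'.aesm_trace) hp

lemma hasCompactSupport_comp_tangentialShift {ψ : E n × ℝ → ℂ} (hψ : HasCompactSupport ψ)
    (h : E n) : HasCompactSupport (ψ ∘ tangentialShift h) := by
  rw [tangentialShift_eq]
  exact hψ.comp_homeomorph (Homeomorph.addRight (h, (0 : ℝ)))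

lemma InEnergySpace.comp_tangentialShift (hu : InEnergySpace α u G v) (h : E n) :
    InEnergySpace α (u ∘ tangentialShift h) (G ∘ tangentialShift h) (fun x => v (x + h)) := by
  obtain ⟨ψ, h1, h2, h3, h4, h5⟩ := hu.approx
  have mp := measurePreserving_tangentialShift h α
  have mp' := measurePreserving_add_right (volume : Measure (E n)) h
  refine ⟨hu.aesm_fun.comp_measurePreserving mp, hu.memLp_grad.comp_measurePreserving mp,
    hu.aesm_trace.comp_measurePreserving mp', fun k => ψ k ∘ tangentialShift h,
    fun k => (h1 k).comp (contDiff_tangentialShift h),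
    fun k => hasCompactSupport_comp_tangentialShift (h2 k) h, ?_, fun R => ?_, ?_⟩
  · refine h3.congr fun k => ?_
    have e : classicalGrad (ψ k ∘ tangentialShift h) - G ∘ tangentialShift h =
        (classicalGrad (ψ k) - G) ∘ tangentialShift h := by
      rw [classicalGrad_comp_tangentialShift]; rfl
    rw [e, eLpNorm_comp_measurePreserving
      ((continuous_classicalGrad (h1 k)).aestronglyMeasurable.sub hu.memLp_grad.1) mp]
  · refine tendsto_of_tendsto_of_tendsto_of_le_of_le tendsto_const_nhds (h4 (R + ‖h‖))
      (fun _ => zero_le) fun k => ?_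
    have hsub : Metric.ball 0 R ⊆ tangentialShift h ⁻¹' Metric.ball 0 (R + ‖h‖) := fun p hp => by
      rw [Set.mem_preimage, tangentialShift_eq, mem_ball_zero_iff]
      rw [mem_ball_zero_iff] at hp
      refine (norm_add_le _ _).trans_lt ?_
      simpa using hp
    have mpr := mp.restrict_preimage (s := Metric.ball 0 (R + ‖h‖)) measurableSet_ball
    refine (eLpNorm_mono_measure _ (Measure.restrict_mono hsub le_rfl)).trans (le_of_eq ?_)
    have e : ψ k ∘ tangentialShift h - u ∘ tangentialShift h = (ψ k - u) ∘ tangentialShift h := rfl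
    rw [e, eLpNorm_comp_measurePreserving ((h1 k).continuous.aestronglyMeasurable.sub
      (hu.aesm_fun.mono_measure Measure.restrict_le_self)) mpr]
  · refine h5.congr fun k => ?_
    have c1 : Continuous fun x : E n => ψ k (x, 0) := (h1 k).continuous.comp (by fun_prop)
    have e : (fun x : E n => (ψ k ∘ tangentialShift h) (x, 0) - v (x + h)) =
        ((fun x => ψ k (x, 0)) - v) ∘ fun x => x + h := rfl
    rw [e, eLpNorm_comp_measurePreserving (c1.aestronglyMeasurable.sub hu.aesm_trace) mp']
    rfl

lemma InEnergySpace.star (hu : InEnergySpace α u G v) :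
    InEnergySpace α (star u) (conjField G) (star v) := by
  obtain ⟨ψ, h1, h2, h3, h4, h5⟩ := hu.approx
  refine ⟨continuous_star.comp_aestronglyMeasurable hu.aesm_fun,
    ⟨aestronglyMeasurable_conjField hu.memLp_grad.1, ?_⟩,
    continuous_star.comp_aestronglyMeasurable hu.aesm_trace, fun k => Star.star (ψ k),
    fun k => (Complex.conjCLE : ℂ →L[ℝ] ℂ).contDiff.comp (h1 k),
    fun k => (h2 k).comp_left (g := Star.star) (star_zero _), ?_, fun R => ?_, ?_⟩
  · rw [eLpNorm_congr_norm_ae (ae_of_all _ (norm_conjField G))]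
    exact hu.memLp_grad.2
  · convert! h3 using 2 with k
    rw [classicalGrad_star ((h1 k).differentiable (by simp)), ← conjField_sub]
    exact eLpNorm_congr_norm_ae (ae_of_all _ (norm_conjField _))
  · convert! h4 R using 2 with k
    rw [← star_sub]
    exact eLpNorm_star
  · convert! h5 using 2 with k
    rw [← eLpNorm_star]
    congr 1
    funext x
    simp

/-- The energy space is closed under limits of functions, gradients and traces. -/
lemma inEnergySpace_of_tendsto (hp : 1 ≤ traceExponent n α) {us : ℕ → E n × ℝ → ℂ}
    {Gs : ℕ → Field n} {vs : ℕ → E n → ℂ} (hs : ∀ k, InEnergySpace α (us k) (Gs k) (vs k))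
    (hu : AEStronglyMeasurable u (weightedMeasure n α)) (hG : MemLp G 2 (weightedMeasure n α))
    (hv : AEStronglyMeasurable v volume)
    (hlim1 : Tendsto (fun k => eLpNorm (Gs k - G) 2 (weightedMeasure n α)) atTop (𝓝 0))
    (hlim2 : ∀ R : ℝ, Tendsto (fun k => eLpNorm (us k - u) 2
      ((weightedMeasure n α).restrict (Metric.ball 0 R))) atTop (𝓝 0))
    (hlim3 : Tendsto (fun k => eLpNorm (vs k - v) (traceExponent n α) volume) atTop (𝓝 0)) :
    InEnergySpace α u G v := by
  have hε : ∀ k : ℕ, (0 : ℝ≥0∞) < (k + 1 : ℝ≥0∞)⁻¹ := fun k => by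
    rw [ENNReal.inv_pos]; exact_mod_cast ENNReal.natCast_ne_top (k + 1)
  have hε0 : Tendsto (fun k : ℕ => ((k : ℝ≥0∞) + 1)⁻¹) atTop (𝓝 0) := by
    have := ENNReal.tendsto_inv_nat_nhds_zero.comp (tendsto_add_atTop_nat 1)
    simpa [Function.comp_def] using this
  have hex : ∀ k : ℕ, ∃ ψ : E n × ℝ → ℂ, ContDiff ℝ ∞ ψ ∧ HasCompactSupport ψ ∧
      eLpNorm (classicalGrad ψ - Gs k) 2 (weightedMeasure n α) ≤ (k + 1 : ℝ≥0∞)⁻¹ ∧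
      eLpNorm (ψ - us k) 2 ((weightedMeasure n α).restrict (Metric.ball 0 k)) ≤
        (k + 1 : ℝ≥0∞)⁻¹ ∧
      eLpNorm (fun x => ψ (x, 0) - vs k x) (traceExponent n α) volume ≤ (k + 1 : ℝ≥0∞)⁻¹ := by
    intro k
    obtain ⟨ψ, h1, h2, h3, h4, h5⟩ := (hs k).approx
    obtain ⟨j, e3, e4, e5⟩ := ((h3.eventually_le_const (hε k)).and
      (((h4 k).eventually_le_const (hε k)).and (h5.eventually_le_const (hε k)))).exists
    exact ⟨ψ j, h1 j, h2 j, e3, e4, e5⟩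
  choose ψ h1 h2 h3 h4 h5 using hex
  refine ⟨hu, hG, hv, ψ, h1, h2, ?_, fun R => ?_, ?_⟩
  · refine tendsto_of_tendsto_of_tendsto_of_le_of_le tendsto_const_nhds
      (by simpa using hε0.add hlim1) (fun _ => zero_le) fun k => ?_
    have e : classicalGrad (ψ k) - G = (classicalGrad (ψ k) - Gs k) + (Gs k - G) := by abel
    simp only [e]
    refine (eLpNorm_add_le ((continuous_classicalGrad (h1 k)).aestronglyMeasurable.sub
      (hs k).memLp_grad.1) ((hs k).memLp_grad.1.sub hG.1) (by norm_num)).trans ?_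
    gcongr
    exact h3 k
  · refine tendsto_of_tendsto_of_tendsto_of_le_of_le' tendsto_const_nhds
      (by simpa using hε0.add (hlim2 R)) (Eventually.of_forall fun _ => zero_le) ?_
    filter_upwards [eventually_ge_atTop ⌈R⌉₊] with k hk
    have hRk : R ≤ k := (Nat.le_ceil R).trans (by exact_mod_cast hk)
    have e : ψ k - u = (ψ k - us k) + (us k - u) := by abel
    simp only [e]
    refine (eLpNorm_add_le ((h1 k).continuous.aestronglyMeasurable.sub
      ((hs k).aesm_fun.mono_measure Measure.restrict_le_self))
      (((hs k).aesm_fun.sub hu).mono_measure Measure.restrict_le_self) (by norm_num)).trans ?_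
    gcongr
    refine le_trans (eLpNorm_mono_measure _ ?_) (h4 k)
    exact Measure.restrict_mono (Metric.ball_subset_ball hRk) le_rfl
  · refine tendsto_of_tendsto_of_tendsto_of_le_of_le tendsto_const_nhds
      (by simpa using hε0.add hlim3) (fun _ => zero_le) fun k => ?_
    have e : (fun x : E n => ψ k (x, 0) - v x) = (fun x => ψ k (x, 0) - vs k x) + (vs k - v) := by
      funext x; simp only [Pi.sub_apply, Pi.add_apply]; ring
    simp only [e]
    have c1 : Continuous fun x : E n => ψ k (x, 0) := (h1 k).continuous.comp (by fun_prop)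
    refine (eLpNorm_add_le (c1.aestronglyMeasurable.sub (hs k).aesm_trace)
      ((hs k).aesm_trace.sub hv) hp).trans ?_
    gcongr
    exact h5 k

/-- The weighted trace inequality on the energy space, for traces in `H^α`: it bounds
`J^α w - w`, the part of `J^α w` that does not see the frequency zero. -/
lemma InEnergySpace.norm_trace_le (hn : 2 ≤ n) (h0 : 0 < α) (h1 : α < 1) {w W : L2 n}
    (hu : InEnergySpace α u G w)
    (hW : besselPotential (E n) ℂ α (w : 𝓢'(E n, ℂ)) = (W : 𝓢'(E n, ℂ))) :
    ‖W - w‖ ≤ Real.sqrt (2 / α) * (eLpNorm G 2 (weightedMeasure n α)).toReal := by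
  set c := Real.sqrt (2 / α) with hc
  set g := (eLpNorm G 2 (weightedMeasure n α)).toReal with hg
  have hp := one_le_traceExponent hn h0 h1
  have : ENNReal.HolderConjugate (traceExponent n α) (1 - (traceExponent n α)⁻¹)⁻¹ :=
    ENNReal.HolderConjugate.inv_one_sub_inv' hp
  -- The traces of the approximating functions converge in the trace exponent only, so that the
  -- claim is tested with Schwartz functions, using Hölder's inequality with the conjugate exponent `q`.
  set q := (1 - (traceExponent n α)⁻¹)⁻¹ with hq
  obtain ⟨ψ, k1, k2, k3, k4, k5⟩ := hu.approx
  -- `B` is the Bessel potential moved to the test function.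
  let B : 𝓢(E n, ℂ) → 𝓢(E n, ℂ) := fun η => 𝓕 (SchwartzMap.smulLeftCLM ℂ
    (fun ξ => (((1 + ‖ξ‖ ^ 2) ^ (α / 2) : ℝ) : ℂ)) (𝓕⁻ η))
  have hB : ∀ (f F : L2 n), besselPotential (E n) ℂ α (f : 𝓢'(E n, ℂ)) = (F : 𝓢'(E n, ℂ)) →
      ∀ η : 𝓢(E n, ℂ), ∫ x, η x * (F - f : L2 n) x = ∫ x, (B η - η) x * f x := by
    intro f F hF η
    have e1 : ∫ x, B η x * f x = ∫ x, η x * F x := by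
      have := congrArg (fun u : 𝓢'(E n, ℂ) => u η) hF
      simp only [besselPotential, fourierMultiplierCLM_apply_apply,
        Lp.toTemperedDistribution_apply, smul_eq_mul] at this
      exact this
    have i1 : ∀ (ζ : 𝓢(E n, ℂ)) (k : L2 n), Integrable fun x => ζ x * k x := fun ζ k =>
      (ζ.memLp 2 volume).integrable_mul (Lp.memLp k)
    have e2 : ∫ x, η x * (F - f : L2 n) x = ∫ x, (η x * F x - η x * f x) := by
      refine integral_congr_ae ?_
      filter_upwards [Lp.coeFn_sub F f] with x hx
      rw [hx, Pi.sub_apply]; ring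
    rw [e2, integral_sub (i1 _ _) (i1 _ _), ← e1, ← integral_sub (i1 _ _) (i1 _ _)]
    refine integral_congr_ae (ae_of_all _ fun x => ?_)
    simp only [sub_apply]; ring
  -- The bound holds for the approximating functions by Plancherel's theorem.
  have hk : ∀ k (η : 𝓢(E n, ℂ)), ‖∫ x, (B η - η) x * ψ k (x, 0)‖ₑ ≤
      ‖η.toLp 2 volume‖ₑ * (ENNReal.ofReal c *
        eLpNorm (classicalGrad (ψ k)) 2 (weightedMeasure n α)) := by
    intro k η
    set a := slice (k1 k) (k2 k) 0 with ha
    have ham : MemSobolev α 2 (a : 𝓢'(E n, ℂ)) := a.memSobolev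
    obtain ⟨A, hA⟩ := ham
    have hA' : besselPotential (E n) ℂ α ((a.toLp 2 volume : L2 n) : 𝓢'(E n, ℂ)) =
        (A : 𝓢'(E n, ℂ)) := by
      rw [Lp.toTemperedDistribution_toLp_eq]; exact hA
    have e1 : ∫ x, (B η - η) x * ψ k (x, 0) = ∫ x, η x * (A - a.toLp 2 volume : L2 n) x := by
      rw [hB _ _ hA']
      refine integral_congr_ae ?_
      filter_upwards [a.coeFn_toLp 2 volume] with x hx
      rw [hx]; rfl
    have e2 : ‖A - a.toLp 2 volume‖ₑ ≤ ENNReal.ofReal c *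
        eLpNorm (classicalGrad (ψ k)) 2 (weightedMeasure n α) := by
      rw [← ENNReal.pow_le_pow_left_iff two_ne_zero, mul_pow, ← ENNReal.ofReal_pow
        (Real.sqrt_nonneg _), Real.sq_sqrt (by positivity)]
      refine le_trans (le_of_eq ?_) (lintegral_trace_le h0 h1 (k1 k) (k2 k))
      rw [← ofReal_norm, ← Lp.norm_fourier_eq, ofReal_norm, Lp.enorm_def, eLpNorm_two_sq]
      have hsub : (𝓕 (A - a.toLp 2 volume) : L2 n) = 𝓕 A - 𝓕 (a.toLp 2 volume) :=
        (Lp.fourierTransformₗᵢ (E n) ℂ).map_sub _ _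
      rw [besselPotential_eq_iff, SchwartzMap.toLp_fourier_eq] at hA'
      rw [hsub, SchwartzMap.toLp_fourier_eq]
      refine lintegral_congr_ae ?_
      filter_upwards [hA', (𝓕 a : 𝓢(E n, ℂ)).coeFn_toLp 2 volume,
        Lp.coeFn_sub (𝓕 A : L2 n) ((𝓕 a : 𝓢(E n, ℂ)).toLp 2 volume)] with ξ e1 e2 e3
      rw [e3, Pi.sub_apply, e1, e2]
      have hb := one_le_bracket h0.le ξ
      have : (bracket α ξ : ℂ) * (𝓕 a : 𝓢(E n, ℂ)) ξ - (𝓕 a : 𝓢(E n, ℂ)) ξ =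
          ((bracket α ξ - 1 : ℝ) : ℂ) * (𝓕 a : 𝓢(E n, ℂ)) ξ := by push_cast; ring
      rw [this, enorm_mul, mul_pow]
      congr 1
      rw [← ofReal_norm, Complex.norm_of_nonneg (by linarith), ENNReal.ofReal_pow (by linarith)]
    rw [e1]
    have e3 : ‖∫ x, η x * (A - a.toLp 2 volume : L2 n) x‖ₑ ≤
        ‖η.toLp 2 volume‖ₑ * ‖A - a.toLp 2 volume‖ₑ := by
      refine (enorm_integral_le_lintegral_enorm _).trans ?_
      have := eLpNorm_smul_le_mul_eLpNorm (p := 2) (q := 2) (r := 1)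
        (Lp.aestronglyMeasurable (A - a.toLp 2 volume : L2 n))
        (η.memLp 2 volume).1
      rw [eLpNorm_one_eq_lintegral_enorm] at this
      rw [Lp.enorm_def, Lp.enorm_def, eLpNorm_congr_ae (η.coeFn_toLp 2 volume)]
      exact this
    exact e3.trans (by gcongr)
  -- Both sides pass to the limit.
  have hlim : ∀ η : 𝓢(E n, ℂ), ‖∫ x, η x * (W - w : L2 n) x‖ ≤ c * g * ‖η.toLp 2 volume‖ := by
    intro η
    have t1 : Tendsto (fun k => ∫ x, (B η - η) x * ψ k (x, 0)) atTop
        (𝓝 (∫ x, (B η - η) x * w x)) := by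
      rw [tendsto_iff_edist_tendsto_0]
      have hfin : eLpNorm (B η - η) q volume ≠ ⊤ := ((B η - η).memLp q volume).2.ne
      have := ENNReal.Tendsto.const_mul k5 (Or.inr hfin)
      rw [mul_zero] at this
      refine tendsto_of_tendsto_of_tendsto_of_le_of_le tendsto_const_nhds this
        (fun _ => zero_le) fun k => ?_
      have hψc : HasCompactSupport fun x : E n => ψ k (x, 0) :=
        HasCompactSupport.intro ((k2 k).isCompact.image continuous_fst) fun x hx => by
          by_contra h
          exact hx ⟨(x, 0), subset_tsupport (ψ k) h, rfl⟩
      have c1 : Continuous fun x : E n => ψ k (x, 0) := (k1 k).continuous.comp (by fun_prop)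
      have i1 : Integrable fun x => (B η - η) x * ψ k (x, 0) :=
        ((B η - η).continuous.mul c1).integrable_of_hasCompactSupport hψc.mul_left
      have i2 : Integrable fun x => (B η - η) x * w x :=
        ((B η - η).memLp 2 volume).integrable_mul (Lp.memLp w)
      rw [edist_eq_enorm_sub, ← integral_sub i1 i2]
      refine (enorm_integral_le_lintegral_enorm _).trans ?_
      have : ENNReal.HolderTriple q (traceExponent n α) 1 :=
        (inferInstance : ENNReal.HolderTriple (traceExponent n α) q 1).symm
      have := eLpNorm_smul_le_mul_eLpNorm (p := q) (q := traceExponent n α) (r := 1)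
        (f := fun x => ψ k (x, 0) - w x) (φ := B η - η)
        (c1.aestronglyMeasurable.sub hu.aesm_trace) ((B η - η).memLp q volume).1
      rw [eLpNorm_one_eq_lintegral_enorm] at this
      refine le_trans (le_of_eq ?_) this
      refine lintegral_congr fun x => ?_
      rw [Pi.smul_apply', smul_eq_mul, mul_sub]
    have t2 : Tendsto (fun k => eLpNorm (classicalGrad (ψ k)) 2 (weightedMeasure n α)) atTop
        (𝓝 (eLpNorm G 2 (weightedMeasure n α))) := by
      have hup : Tendsto (fun k => eLpNorm G 2 (weightedMeasure n α) +
          eLpNorm (classicalGrad (ψ k) - G) 2 (weightedMeasure n α)) atTop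
          (𝓝 (eLpNorm G 2 (weightedMeasure n α))) := by
        simpa using tendsto_const_nhds.add k3
      have hlo : Tendsto (fun k => eLpNorm G 2 (weightedMeasure n α) -
          eLpNorm (classicalGrad (ψ k) - G) 2 (weightedMeasure n α)) atTop
          (𝓝 (eLpNorm G 2 (weightedMeasure n α))) := by
        simpa using ENNReal.Tendsto.sub
          (tendsto_const_nhds (x := eLpNorm G 2 (weightedMeasure n α)))
          k3 (Or.inl hu.memLp_grad.2.ne)
      have hm := fun k => (continuous_classicalGrad (k1 k)).aestronglyMeasurable
        (μ := weightedMeasure n α)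
      refine tendsto_of_tendsto_of_tendsto_of_le_of_le hlo hup (fun k => ?_) fun k => ?_
      · rw [tsub_le_iff_right]
        have e : G = classicalGrad (ψ k) - (classicalGrad (ψ k) - G) := by abel
        conv_lhs => rw [e]
        exact eLpNorm_sub_le (hm k) ((hm k).sub hu.memLp_grad.1) (by norm_num)
      · have e : classicalGrad (ψ k) = G + (classicalGrad (ψ k) - G) := by abel
        conv_lhs => rw [e]
        exact eLpNorm_add_le hu.memLp_grad.1 ((hm k).sub hu.memLp_grad.1) (by norm_num)
    have t3 : ‖∫ x, (B η - η) x * w x‖ₑ ≤ ‖η.toLp 2 volume‖ₑ * (ENNReal.ofReal c *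
        eLpNorm G 2 (weightedMeasure n α)) := by
      refine le_of_tendsto_of_tendsto (continuous_enorm.tendsto _ |>.comp t1) ?_
        (Eventually.of_forall fun k => hk k η)
      exact ENNReal.Tendsto.const_mul (ENNReal.Tendsto.const_mul t2 (Or.inr (by simp)))
        (Or.inr (by simp))
    rw [hB w W hW]
    have t4 : ‖η.toLp 2 volume‖ₑ * (ENNReal.ofReal c * eLpNorm G 2 (weightedMeasure n α)) =
        ENNReal.ofReal (c * g * ‖η.toLp 2 volume‖) := by
      rw [hg, ENNReal.ofReal_mul (by positivity), ENNReal.ofReal_mul (Real.sqrt_nonneg _),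
        ENNReal.ofReal_toReal hu.memLp_grad.2.ne, ofReal_norm, mul_comm]
    rw [t4, ← ofReal_norm, ENNReal.ofReal_le_ofReal_iff (by positivity)] at t3
    exact t3
  -- Schwartz functions are dense in `L²`.
  have hd : ∀ f : L2 n, ‖inner ℂ f (W - w)‖ ≤ c * g * ‖f‖ := by
    intro f
    refine DenseRange.induction_on (p := fun f : L2 n => ‖inner ℂ f (W - w)‖ ≤ c * g * ‖f‖)
      (SchwartzMap.denseRange_toLpCLM (p := 2) ENNReal.ofNat_ne_top) f ?_ ?_
    · exact isClosed_le (by fun_prop) (by fun_prop)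
    · intro φ
      let φ' : 𝓢(E n, ℂ) := SchwartzMap.postcompCLM (𝕜 := ℝ) (Complex.conjCLE : ℂ →L[ℝ] ℂ) φ
      have hφ' : ∀ x, φ' x = Star.star (φ x) := fun x => rfl
      have e1 : inner ℂ (φ.toLp 2 volume) (W - w) = ∫ x, φ' x * (W - w : L2 n) x := by
        rw [L2.inner_def]
        refine integral_congr_ae ?_
        filter_upwards [φ.coeFn_toLp 2 volume] with x hx
        rw [hx, hφ', RCLike.inner_apply, mul_comm]; rfl
      have e2 : ‖φ'.toLp 2 volume‖ = ‖φ.toLp 2 volume‖ := by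
        rw [SchwartzMap.norm_toLp, SchwartzMap.norm_toLp]
        congr 1
        exact eLpNorm_congr_norm_ae (ae_of_all _ fun x => by rw [hφ', norm_star])
      change ‖inner ℂ (φ.toLp 2 volume) (W - w)‖ ≤ c * g * ‖φ.toLp 2 volume‖
      rw [e1, ← e2]
      exact hlim φ'
  have h2 := hd (W - w)
  rw [inner_self_eq_norm_sq_to_K] at h2
  by_cases hz : ‖W - w‖ = 0
  · rw [hz]; positivity
  · have hpos : 0 < ‖W - w‖ := lt_of_le_of_ne (norm_nonneg _) (Ne.symm hz)
    rw [norm_pow, RCLike.norm_ofReal, abs_of_pos hpos, sq] at h2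
    exact le_of_mul_le_mul_right h2 hpos

end EnergySpace

/-! ### The Sobolev embedding at the critical exponent -/

section Sobolev

open FourierTransform

variable {n : ℕ}

lemma continuous_fourierInv_of_integrable {g : E n → ℂ} (hg : Integrable g) :
    Continuous (𝓕⁻ g) := by
  have h := VectorFourier.fourierIntegral_continuous (μ := (volume : Measure (E n)))
    (L := -innerₗ (E n)) Real.continuous_fourierChar
    (show Continuous fun p : E n × E n => -inner ℝ p.1 p.2 from continuous_inner.neg) hg
  exact h

lemma enorm_fourierInv_le (g : E n → ℂ) (x : E n) : ‖𝓕⁻ g x‖ₑ ≤ ∫⁻ ξ, ‖g ξ‖ₑ := by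
  rw [Real.fourierInv_eq]
  refine (enorm_integral_le_lintegral_enorm _).trans (le_of_eq ?_)
  refine lintegral_congr fun ξ => ?_
  rw [← ofReal_norm, ← ofReal_norm, Circle.norm_smul]

/-- On `L¹ ∩ L²` the inverse Fourier transform is given by the integral. -/
lemma coeFn_fourierInv {g : L2 n} (hg : Integrable g) :
    (𝓕⁻ g : L2 n) =ᵐ[volume] 𝓕⁻ (g : E n → ℂ) := by
  refine ae_eq_of_integral_schwartz_eq (locallyIntegrable_coe _)
    (continuous_fourierInv_of_integrable hg).locallyIntegrable fun η => ?_
  have e1 : ∫ x, η x * (𝓕⁻ g : L2 n) x = ∫ x, (𝓕⁻ η : 𝓢(E n, ℂ)) x * g x := by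
    have := congrArg (fun u : 𝓢'(E n, ℂ) => u η) (Lp.fourierInv_toTemperedDistribution_eq g)
    simpa using this.symm
  rw [e1]
  have h := VectorFourier.integral_fourierIntegral_smul_eq_flip
    (μ := (volume : Measure (E n))) (ν := (volume : Measure (E n)))
    (L := -innerₗ (E n)) Real.continuous_fourierChar
    (show Continuous fun p : E n × E n => -inner ℝ p.1 p.2 from continuous_inner.neg)
      η.integrable hg
  have h1 : ∀ (f : E n → ℂ) (x : E n), VectorFourier.fourierIntegral Real.fourierChar volume
      (-innerₗ (E n)) f x = 𝓕⁻ f x := fun f x => by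
    rw [Real.fourierInv_eq]
    simp [VectorFourier.fourierIntegral]
  have h2 : ∀ (f : E n → ℂ) (x : E n), VectorFourier.fourierIntegral Real.fourierChar volume
      (-innerₗ (E n)).flip f x = 𝓕⁻ f x := fun f x => by
    rw [Real.fourierInv_eq]
    simp [VectorFourier.fourierIntegral, real_inner_comm]
  simp only [h1, h2, smul_eq_mul] at h
  rw [← h]
  simp only [SchwartzMap.fourierInv_coe]

/-- The scaling of `∫ |ξ|^{-2α}` over balls. -/
lemma exists_lintegral_ball_le (hn : 1 ≤ n) {α : ℝ} (h1 : 2 * α < n) :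
    ∃ c : ℝ, 0 < c ∧ ∀ A : ℝ, 0 < A →
      ∫⁻ ξ in Metric.ball (0 : E n) A, ENNReal.ofReal (‖ξ‖ ^ (-(2 * α))) ≤
        ENNReal.ofReal (c * A ^ ((n : ℝ) - 2 * α)) := by
  have : Nonempty (Fin n) := ⟨⟨0, hn⟩⟩
  have hm : Measurable fun ξ : E n => ‖ξ‖ ^ (-(2 * α)) := measurable_norm.pow_const _
  have hint : ∀ A : ℝ, IntegrableOn (fun ξ : E n => ‖ξ‖ ^ (-(2 * α))) (Metric.ball 0 A) :=
    fun A => integrableOn_ball_of_norm_le_rpow (μ := volume) (C := 1) (α := 2 * α)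
      (by simpa using hn) (by simpa using h1)
      (ae_of_all _ fun ξ => by
        rw [Real.norm_of_nonneg (Real.rpow_nonneg (norm_nonneg _) _), one_mul])
      hm.aestronglyMeasurable
  refine ⟨(∫ ξ in Metric.ball (0 : E n) 1, ‖ξ‖ ^ (-(2 * α))) + 1, ?_, fun A hA => ?_⟩
  · have : 0 ≤ ∫ ξ in Metric.ball (0 : E n) 1, ‖ξ‖ ^ (-(2 * α)) :=
      integral_nonneg fun ξ => Real.rpow_nonneg (norm_nonneg _) _
    linarith
  · rw [← ofReal_integral_eq_lintegral_ofReal (hint A)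
      (ae_of_all _ fun ξ => Real.rpow_nonneg (norm_nonneg _) _)]
    refine ENNReal.ofReal_le_ofReal ?_
    have h := Measure.setIntegral_comp_smul_of_pos (volume : Measure (E n))
      (fun ξ : E n => ‖ξ‖ ^ (-(2 * α))) (Metric.ball 0 1) hA
    rw [smul_unitBall_of_pos hA] at h
    have e : ∀ ξ : E n, ‖A • ξ‖ ^ (-(2 * α)) = A ^ (-(2 * α)) * ‖ξ‖ ^ (-(2 * α)) := fun ξ => by
      rw [norm_smul, Real.norm_of_nonneg hA.le, Real.mul_rpow hA.le (norm_nonneg _)]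
    simp only [e, integral_const_mul, finrank_euclideanSpace, Fintype.card_fin, smul_eq_mul] at h
    have h2 : ∫ ξ in Metric.ball (0 : E n) A, ‖ξ‖ ^ (-(2 * α)) =
        A ^ ((n : ℝ) - 2 * α) * ∫ ξ in Metric.ball (0 : E n) 1, ‖ξ‖ ^ (-(2 * α)) := by
      rw [sub_eq_add_neg, Real.rpow_add hA, Real.rpow_natCast, mul_assoc, h, ← mul_assoc,
        mul_inv_cancel₀ (by positivity), one_mul]
    rw [h2]
    have : 0 ≤ A ^ ((n : ℝ) - 2 * α) := by positivity
    nlinarith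

lemma bracket_neg_sq_le {α : ℝ} (h0 : 0 < α) {ξ : E n} (hξ : ξ ≠ 0) :
    bracket (-α) ξ ^ 2 ≤ ‖ξ‖ ^ (-(2 * α)) := by
  have hξ' : 0 < ‖ξ‖ := norm_pos_iff.2 hξ
  unfold bracket
  rw [← Real.rpow_natCast, ← Real.rpow_mul (by positivity)]
  calc (1 + ‖ξ‖ ^ 2) ^ (-α / 2 * (2 : ℕ)) ≤ (‖ξ‖ ^ 2) ^ (-α / 2 * (2 : ℕ)) :=
        Real.rpow_le_rpow_of_nonpos (by positivity) (by linarith) (by push_cast; linarith)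
    _ = _ := by
        rw [← Real.rpow_natCast, ← Real.rpow_mul hξ'.le]
        congr 1; push_cast; ring

/-- The `L²` function with the frequencies of `f` in the set `S`. -/
def frequencyCut (S : Set (E n)) (hS : MeasurableSet S) (f : L2 n) : L2 n :=
  𝓕⁻ (((Lp.memLp (𝓕 f : L2 n)).indicator hS).toLp _ : L2 n)

lemma fourier_frequencyCut (S : Set (E n)) (hS : MeasurableSet S) (f : L2 n) :
    (𝓕 (frequencyCut S hS f) : L2 n) =ᵐ[volume] S.indicator (𝓕 f : L2 n) := by
  unfold frequencyCut
  rw [fourier_fourierInv_eq]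
  exact ((Lp.memLp (𝓕 f : L2 n)).indicator hS).coeFn_toLp

lemma frequencyCut_add_compl {S : Set (E n)} (hS : MeasurableSet S) (f : L2 n) :
    frequencyCut S hS f + frequencyCut Sᶜ hS.compl f = f := by
  have h : (𝓕 (frequencyCut S hS f + frequencyCut Sᶜ hS.compl f) : L2 n) = 𝓕 f := by
    have e : (𝓕 (frequencyCut S hS f + frequencyCut Sᶜ hS.compl f) : L2 n) =
        𝓕 (frequencyCut S hS f) + 𝓕 (frequencyCut Sᶜ hS.compl f) :=
      (Lp.fourierTransformₗᵢ (E n) ℂ).map_add _ _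
    rw [e]
    apply Lp.ext
    filter_upwards [fourier_frequencyCut S hS f, fourier_frequencyCut Sᶜ hS.compl f,
      Lp.coeFn_add (𝓕 (frequencyCut S hS f) : L2 n) (𝓕 (frequencyCut Sᶜ hS.compl f))]
      with ξ h1 h2 h3
    rw [h3, Pi.add_apply, h1, h2]
    exact congrFun (Set.indicator_self_add_compl S _) ξ
  have := congrArg (fun g : L2 n => (𝓕⁻ g : L2 n)) h
  simpa only [fourierInv_fourier_eq] using this

lemma enorm_sq_eq_lintegral_fourier (f : L2 n) :
    ‖f‖ₑ ^ 2 = ∫⁻ ξ, ‖(𝓕 f : L2 n) ξ‖ₑ ^ 2 := by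
  rw [← eLpNorm_two_sq, ← Lp.enorm_def, ← ofReal_norm, ← ofReal_norm, Lp.norm_fourier_eq]

/-- Low frequencies are bounded: Cauchy-Schwarz on the Fourier side. -/
lemma exists_enorm_frequencyCut_le (hn : 1 ≤ n) {α : ℝ} (h0 : 0 < α) (h1 : 2 * α < n) :
    ∃ c : ℝ, 0 < c ∧ ∀ (f F : L2 n) (A : ℝ), 0 < A →
      besselPotential (E n) ℂ α (f : 𝓢'(E n, ℂ)) = (F : 𝓢'(E n, ℂ)) →
      ∀ᵐ x : E n, ‖frequencyCut (Metric.ball 0 A) measurableSet_ball f x‖ₑ ≤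
        ENNReal.ofReal (c * A ^ (((n : ℝ) - 2 * α) / 2)) * ‖F‖ₑ := by
  obtain ⟨c, hc, hcA⟩ := exists_lintegral_ball_le hn h1
  refine ⟨Real.sqrt c, Real.sqrt_pos.2 hc, fun f F A hA hF => ?_⟩
  rw [besselPotential_eq_iff] at hF
  set g : L2 n := ((Lp.memLp (𝓕 f : L2 n)).indicator
    (measurableSet_ball (x := (0 : E n)) (ε := A))).toLp _ with hg
  have hgc : g =ᵐ[volume] (Metric.ball 0 A).indicator (𝓕 f : L2 n) :=
    ((Lp.memLp (𝓕 f : L2 n)).indicator measurableSet_ball).coeFn_toLp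
  have hm : Measurable fun ξ : E n => ENNReal.ofReal (bracket (-α) ξ) :=
    (continuous_bracket _).measurable.ennreal_ofReal
  have hle : ∫⁻ ξ, ‖g ξ‖ₑ ≤ ENNReal.ofReal (Real.sqrt c * A ^ (((n : ℝ) - 2 * α) / 2)) * ‖F‖ₑ := by
    have e1 : ∫⁻ ξ, ‖g ξ‖ₑ = ∫⁻ ξ in Metric.ball (0 : E n) A,
        ENNReal.ofReal (bracket (-α) ξ) * ‖(𝓕 F : L2 n) ξ‖ₑ := by
      rw [← lintegral_indicator measurableSet_ball]
      refine lintegral_congr_ae ?_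
      filter_upwards [hgc, hF] with ξ e1 e2
      rw [e1]
      by_cases hξ : ξ ∈ Metric.ball (0 : E n) A
      · rw [Set.indicator_of_mem hξ, Set.indicator_of_mem hξ, e2, enorm_mul, ← mul_assoc]
        have hb := bracket_pos α ξ
        rw [bracket_neg, ← ofReal_norm (bracket α ξ : ℂ), Complex.norm_of_nonneg hb.le,
          ← ENNReal.ofReal_mul (by positivity), inv_mul_cancel₀ hb.ne']
        simp
      · rw [Set.indicator_of_notMem hξ, Set.indicator_of_notMem hξ, enorm_zero]
    have hH := ENNReal.lintegral_mul_le_Lp_mul_Lq (volume.restrict (Metric.ball (0 : E n) A))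
      Real.HolderConjugate.two_two hm.aemeasurable
      (Lp.aestronglyMeasurable (𝓕 F : L2 n)).enorm.restrict
    have e2 : ∫⁻ ξ in Metric.ball (0 : E n) A, ENNReal.ofReal (bracket (-α) ξ) ^ (2 : ℝ) ≤
        ENNReal.ofReal (c * A ^ ((n : ℝ) - 2 * α)) := by
      refine le_trans (lintegral_mono_ae ?_) (hcA A hA)
      have : Nonempty (Fin n) := ⟨⟨0, hn⟩⟩
      have hz : ∀ᵐ ξ : E n, ξ ≠ 0 := Measure.ae_ne volume 0
      filter_upwards [ae_restrict_of_ae hz] with ξ hξ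
      rw [ENNReal.ofReal_rpow_of_nonneg (bracket_pos _ _).le (by norm_num), Real.rpow_two]
      exact ENNReal.ofReal_le_ofReal (bracket_neg_sq_le h0 hξ)
    have e3 : ∫⁻ ξ in Metric.ball (0 : E n) A, ‖(𝓕 F : L2 n) ξ‖ₑ ^ (2 : ℝ) ≤ ‖F‖ₑ ^ 2 := by
      rw [enorm_sq_eq_lintegral_fourier]
      simp only [ENNReal.rpow_two]
      exact setLIntegral_le_lintegral _ _
    rw [e1]
    refine hH.trans ?_
    calc _ ≤ ENNReal.ofReal (c * A ^ ((n : ℝ) - 2 * α)) ^ (1 / 2 : ℝ) *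
          (‖F‖ₑ ^ 2) ^ (1 / 2 : ℝ) := by gcongr
      _ = _ := by
          congr 1
          · rw [ENNReal.ofReal_rpow_of_nonneg (by positivity) (by norm_num),
              Real.mul_rpow hc.le (by positivity), Real.sqrt_eq_rpow, ← Real.rpow_mul hA.le]
            congr 3; ring
          · rw [← ENNReal.rpow_natCast, ← ENNReal.rpow_mul]; norm_num
  have hgi : Integrable g := ⟨Lp.aestronglyMeasurable g, hle.trans_lt
    (ENNReal.mul_lt_top ENNReal.ofReal_lt_top (by simp))⟩
  filter_upwards [coeFn_fourierInv hgi] with x hx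
  have : frequencyCut (Metric.ball 0 A) measurableSet_ball f x = (𝓕⁻ g : L2 n) x := rfl
  rw [this, hx]
  exact (enorm_fourierInv_le _ x).trans hle

/-- Few points where `f` is large: at height `l`, the frequencies below `(l / κ)^{1/a}` contribute
at most `l / 2`, and Chebyshev's inequality bounds the contribution of the others. -/
lemma volume_lt_norm_le {f : L2 n} {c N a l : ℝ} (hc : 0 < c) (hN : 0 < N) (ha : 0 < a)
    (hl : 0 < l)
    (hlow : ∀ A : ℝ, 0 < A →
      ∀ᵐ x : E n, ‖frequencyCut (Metric.ball 0 A) measurableSet_ball f x‖ ≤ c * A ^ a * N) :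
    volume {x | l < ‖f x‖} ≤ ENNReal.ofReal (4 / l ^ 2) *
      ∫⁻ ξ, {ξ : E n | l ≤ 2 * c * N * ‖ξ‖ ^ a}.indicator (fun ξ => ‖(𝓕 f : L2 n) ξ‖ₑ ^ 2) ξ := by
  set A := (l / (2 * c * N)) ^ a⁻¹ with hA
  have hA0 : 0 < A := by positivity
  have hAa : A ^ a = l / (2 * c * N) := by
    rw [hA, ← Real.rpow_mul (by positivity), inv_mul_cancel₀ ha.ne', Real.rpow_one]
  have hS : ((Metric.ball (0 : E n) A)ᶜ) = {ξ : E n | l ≤ 2 * c * N * ‖ξ‖ ^ a} := by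
    ext ξ
    rw [Set.mem_compl_iff, mem_ball_zero_iff, not_lt, Set.mem_ofPred_eq,
      ← Real.rpow_le_rpow_iff hA0.le (norm_nonneg _) ha, hAa, div_le_iff₀' (by positivity)]
  set fh := frequencyCut (Metric.ball (0 : E n) A)ᶜ measurableSet_ball.compl f with hfh
  have h1 : volume {x | l < ‖f x‖} ≤ volume {x | ENNReal.ofReal (l ^ 2 / 4) ≤ ‖fh x‖ₑ ^ 2} := by
    refine measure_mono_ae ?_
    filter_upwards [hlow A hA0, Lp.coeFn_add (frequencyCut (Metric.ball 0 A) measurableSet_ball f)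
      fh] with x e1 e2 (hx : l < ‖f x‖)
    rw [hfh, frequencyCut_add_compl, ← hfh, Pi.add_apply] at e2
    have e3 : c * A ^ a * N = l / 2 := by rw [hAa]; field_simp
    have e4 : l / 2 ≤ ‖fh x‖ := by
      have := norm_add_le (frequencyCut (Metric.ball 0 A) measurableSet_ball f x) (fh x)
      rw [← e2] at this
      linarith
    change ENNReal.ofReal (l ^ 2 / 4) ≤ ‖fh x‖ₑ ^ 2
    rw [← ofReal_norm, ← ENNReal.ofReal_pow (norm_nonneg _)]
    exact ENNReal.ofReal_le_ofReal (by nlinarith)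
  have h2 := mul_meas_ge_le_lintegral₀ (μ := (volume : Measure (E n)))
    (f := fun x => ‖fh x‖ₑ ^ 2) ((Lp.aestronglyMeasurable fh).enorm.pow_const 2)
    (ENNReal.ofReal (l ^ 2 / 4))
  have h3 : ∫⁻ x, ‖fh x‖ₑ ^ 2 = ∫⁻ ξ, {ξ : E n | l ≤ 2 * c * N * ‖ξ‖ ^ a}.indicator
      (fun ξ => ‖(𝓕 f : L2 n) ξ‖ₑ ^ 2) ξ := by
    rw [← eLpNorm_two_sq, ← Lp.enorm_def, enorm_sq_eq_lintegral_fourier, ← hS]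
    refine lintegral_congr_ae ?_
    filter_upwards [fourier_frequencyCut _ measurableSet_ball.compl f] with ξ hξ
    rw [hξ]
    by_cases h : ξ ∈ (Metric.ball (0 : E n) A)ᶜ
    · rw [Set.indicator_of_mem h, Set.indicator_of_mem h]
    · rw [Set.indicator_of_notMem h, Set.indicator_of_notMem h]; simp
  rw [← h3]
  calc volume {x | l < ‖f x‖}
      = ENNReal.ofReal (4 / l ^ 2) *
          (ENNReal.ofReal (l ^ 2 / 4) * volume {x | l < ‖f x‖}) := by
        rw [← mul_assoc, ← ENNReal.ofReal_mul (by positivity)]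
        have : 4 / l ^ 2 * (l ^ 2 / 4) = 1 := by field_simp
        rw [this, ENNReal.ofReal_one, one_mul]
    _ ≤ _ := by gcongr; exact (by gcongr : _ ≤ _).trans h2

/-- The Sobolev embedding `H^α ⊆ L^{2n/(n-2α)}`, by splitting the frequencies of `f` separately for
each height in the layer cake formula. -/
lemma exists_eLpNorm_traceExponent_le (hn : 2 ≤ n) {α : ℝ} (h0 : 0 < α) (h1 : α < 1) :
    ∃ C : ℝ, 0 ≤ C ∧ ∀ f F : L2 n,
      besselPotential (E n) ℂ α (f : 𝓢'(E n, ℂ)) = (F : 𝓢'(E n, ℂ)) →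
      eLpNorm f (traceExponent n α) volume ≤ ENNReal.ofReal C * ‖F‖ₑ := by
  have hn' : (2 : ℝ) ≤ n := by exact_mod_cast hn
  obtain ⟨c, hc, hlow⟩ := exists_enorm_frequencyCut_le (n := n) (by omega) h0 (by linarith)
  set a : ℝ := (n - 2 * α) / 2 with ha
  set p : ℝ := 2 * n / (n - 2 * α) with hp
  have ha0 : 0 < a := by rw [ha]; linarith
  have hp2 : p - 2 = 2 * α / a := by
    have : (n : ℝ) - 2 * α ≠ 0 := by linarith
    rw [hp, ha]; field_simp; ring
  have hp20 : 0 < p - 2 := by rw [hp2]; positivity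
  set K : ℝ := p * (4 * (2 * c) ^ (p - 2) / (p - 2)) with hK
  have hp0 : 0 < p := by linarith
  have hK0 : 0 ≤ K := by rw [hK]; positivity
  refine ⟨K ^ p⁻¹, by positivity, fun f F hF => ?_⟩
  have hle := (besselPotential_eq_iff α f F).1 hF
  have hpt : traceExponent n α = ENNReal.ofReal p := rfl
  rcases (norm_nonneg F).eq_or_lt with hN | hN
  · have hF0 : F = 0 := norm_eq_zero.1 hN.symm
    have hf0 : f = 0 := by
      have : ‖f‖ₑ ^ 2 = 0 := by
        rw [enorm_sq_eq_lintegral_fourier]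
        have h00 : (𝓕 (0 : L2 n) : L2 n) = 0 := (Lp.fourierTransformₗᵢ (E n) ℂ).map_zero
        rw [hF0, h00] at hle
        refine (lintegral_congr_ae ?_).trans lintegral_zero
        filter_upwards [hle, Lp.coeFn_zero ℂ 2 (volume : Measure (E n))] with ξ e1 e2
        rw [e2] at e1
        have := (bracket_pos α ξ).ne'
        have : (𝓕 f : L2 n) ξ = 0 := by simpa [this] using e1
        simp [this]
      simpa using this
    rw [hf0, eLpNorm_congr_ae (Lp.coeFn_zero ℂ 2 (volume : Measure (E n)))]
    simp
  set N := ‖F‖ with hNdef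
  have hlow' : ∀ A : ℝ, 0 < A → ∀ᵐ x : E n,
      ‖frequencyCut (Metric.ball 0 A) measurableSet_ball f x‖ ≤ c * A ^ a * N := fun A hA => by
    filter_upwards [hlow f F A hA hF] with x hx
    rw [← ofReal_norm, ← ofReal_norm, ← ENNReal.ofReal_mul (by positivity),
      ENNReal.ofReal_le_ofReal_iff (by positivity)] at hx
    exact hx
  have hmf : Measurable fun ξ => ‖(𝓕 f : L2 n) ξ‖ₑ ^ 2 :=
    (Lp.stronglyMeasurable (𝓕 f : L2 n)).measurable.enorm.pow_const 2
  have key : ∫⁻ x, ‖f x‖ₑ ^ p ≤ ENNReal.ofReal (K * N ^ p) := by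
    have e0 : ∀ x, ‖f x‖ₑ ^ p = ENNReal.ofReal (‖f x‖ ^ p) := fun x => by
      rw [← ofReal_norm, ENNReal.ofReal_rpow_of_nonneg (norm_nonneg _) hp0.le]
    simp only [e0]
    rw [lintegral_rpow_eq_lintegral_meas_lt_mul volume (ae_of_all _ fun x => norm_nonneg _)
      (Lp.aestronglyMeasurable f).norm.aemeasurable hp0]
    -- `Φ l ξ` is the contribution of the frequency `ξ` to the bound of the level set at height `l`.
    let Φ : ℝ → E n → ℝ≥0∞ := fun l ξ => ENNReal.ofReal (4 * l ^ (p - 3)) *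
      {ξ : E n | l ≤ 2 * c * N * ‖ξ‖ ^ a}.indicator (fun ξ => ‖(𝓕 f : L2 n) ξ‖ₑ ^ 2) ξ
    have hΦm : Measurable (Function.uncurry Φ) := by
      refine Measurable.mul (by fun_prop) ?_
      have hs : MeasurableSet {q : ℝ × E n | q.1 ≤ 2 * c * N * ‖q.2‖ ^ a} :=
        measurableSet_le measurable_fst
          (((measurable_norm.comp measurable_snd).pow_const a).const_mul _)
      exact ((hmf.comp measurable_snd).indicator hs)
    have e1 : ∫⁻ l in Set.Ioi (0 : ℝ), volume {x | l < ‖f x‖} * ENNReal.ofReal (l ^ (p - 1)) ≤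
        ∫⁻ l in Set.Ioi (0 : ℝ), ∫⁻ ξ, Φ l ξ := by
      refine setLIntegral_mono_ae (Measurable.lintegral_prod_right' (f := Function.uncurry Φ)
        hΦm).aemeasurable (ae_of_all _ fun l (hl : 0 < l) => ?_)
      simp only [Φ]
      rw [lintegral_const_mul' _ _ ENNReal.ofReal_ne_top]
      have := volume_lt_norm_le hc hN ha0 hl hlow'
      calc _ ≤ ENNReal.ofReal (4 / l ^ 2) * (∫⁻ ξ, {ξ : E n | l ≤ 2 * c * N * ‖ξ‖ ^ a}.indicator
            (fun ξ => ‖(𝓕 f : L2 n) ξ‖ₑ ^ 2) ξ) * ENNReal.ofReal (l ^ (p - 1)) := by gcongr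
        _ = _ := by
            rw [mul_right_comm, ← ENNReal.ofReal_mul (by positivity)]
            congr 2
            rw [div_mul_eq_mul_div, mul_div_assoc, ← Real.rpow_natCast l 2, ← Real.rpow_sub hl]
            congr 2; push_cast; ring
    have e2 : ∫⁻ l in Set.Ioi (0 : ℝ), ∫⁻ ξ, Φ l ξ = ∫⁻ ξ, ∫⁻ l in Set.Ioi (0 : ℝ), Φ l ξ :=
      lintegral_lintegral_swap hΦm.aemeasurable
    -- A fixed frequency only enters at heights `l ≤ 2 c N |ξ|^a`, and `a (p - 2) = 2α`.
    have e3 : ∀ ξ, ∫⁻ l in Set.Ioi (0 : ℝ), Φ l ξ = ENNReal.ofReal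
        (4 * (2 * c * N) ^ (p - 2) / (p - 2) * ‖ξ‖ ^ (2 * α)) * ‖(𝓕 f : L2 n) ξ‖ₑ ^ 2 := by
      intro ξ
      set R := 2 * c * N * ‖ξ‖ ^ a with hR
      have hR0 : 0 ≤ R := by positivity
      have f1 : ∫⁻ l in Set.Ioi (0 : ℝ), Φ l ξ =
          ∫⁻ l in Set.Ioc (0 : ℝ) R, ENNReal.ofReal (4 * l ^ (p - 3)) *
            ‖(𝓕 f : L2 n) ξ‖ₑ ^ 2 := by
        rw [← lintegral_indicator measurableSet_Ioi, ← lintegral_indicator measurableSet_Ioc]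
        refine lintegral_congr fun l => ?_
        by_cases hl : 0 < l
        · rw [Set.indicator_of_mem (show l ∈ Set.Ioi (0 : ℝ) from hl)]
          by_cases hlR : l ≤ R
          · rw [Set.indicator_of_mem (show l ∈ Set.Ioc (0 : ℝ) R from ⟨hl, hlR⟩)]
            simp only [Φ]
            rw [Set.indicator_of_mem (show ξ ∈ {ξ : E n | l ≤ 2 * c * N * ‖ξ‖ ^ a} from hlR)]
          · rw [Set.indicator_of_notMem (show l ∉ Set.Ioc (0 : ℝ) R from fun h => hlR h.2)]
            simp only [Φ]
            rw [Set.indicator_of_notMem (show ξ ∉ {ξ : E n | l ≤ 2 * c * N * ‖ξ‖ ^ a} from hlR),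
              mul_zero]
        · rw [Set.indicator_of_notMem (show l ∉ Set.Ioi (0 : ℝ) from hl),
            Set.indicator_of_notMem (show l ∉ Set.Ioc (0 : ℝ) R from fun h => hl h.1)]
      have hint : IntegrableOn (fun l : ℝ => 4 * l ^ (p - 3)) (Set.Ioc 0 R) := by
        have := intervalIntegral.intervalIntegrable_rpow' (a := 0) (b := R) (r := p - 3)
          (by linarith)
        rw [intervalIntegrable_iff_integrableOn_Ioc_of_le hR0] at this
        exact this.const_mul 4
      have f2 : ∫ l in Set.Ioc 0 R, 4 * l ^ (p - 3) = 4 * (R ^ (p - 2) / (p - 2)) := by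
        rw [integral_const_mul, ← intervalIntegral.integral_of_le hR0,
          integral_rpow (Or.inl (by linarith))]
        have : p - 3 + 1 = p - 2 := by ring
        rw [this, Real.zero_rpow hp20.ne', sub_zero]
      rw [f1, lintegral_mul_const'' _ hint.1.aemeasurable.ennreal_ofReal,
        ← ofReal_integral_eq_lintegral_ofReal hint, f2]
      · congr 2
        rw [hR, Real.mul_rpow (by positivity) (by positivity), ← Real.rpow_mul (norm_nonneg _)]
        have : a * (p - 2) = 2 * α := by rw [hp2]; field_simp
        rw [this]; ring
      · filter_upwards [ae_restrict_mem measurableSet_Ioc] with l hl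
        have := hl.1
        positivity
    have e4 : ∫⁻ ξ, ∫⁻ l in Set.Ioi (0 : ℝ), Φ l ξ ≤
        ENNReal.ofReal (4 * (2 * c * N) ^ (p - 2) / (p - 2)) * ENNReal.ofReal (N ^ 2) := by
      have g1 : ENNReal.ofReal (N ^ 2) = ∫⁻ ξ, ‖(𝓕 F : L2 n) ξ‖ₑ ^ 2 := by
        rw [← enorm_sq_eq_lintegral_fourier, ← ofReal_norm, ENNReal.ofReal_pow (norm_nonneg _)]
      rw [g1, ← lintegral_const_mul' _ _ ENNReal.ofReal_ne_top]
      refine lintegral_mono_ae ?_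
      filter_upwards [hle] with ξ hξ
      rw [e3, hξ, enorm_mul, mul_pow, ENNReal.ofReal_mul (by positivity), mul_assoc]
      gcongr
      have hb := bracket_pos α ξ
      rw [← ofReal_norm (bracket α ξ : ℂ), Complex.norm_of_nonneg hb.le,
        ← ENNReal.ofReal_pow hb.le]
      refine ENNReal.ofReal_le_ofReal ?_
      unfold bracket
      rw [← Real.rpow_natCast, ← Real.rpow_mul (by positivity)]
      calc ‖ξ‖ ^ (2 * α) = (‖ξ‖ ^ 2) ^ (α / 2 * (2 : ℕ)) := by
            rw [← Real.rpow_natCast, ← Real.rpow_mul (norm_nonneg _)]; congr 1; push_cast; ring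
        _ ≤ _ := Real.rpow_le_rpow (by positivity) (by linarith) (by push_cast; linarith)
    calc _ ≤ ENNReal.ofReal p * (ENNReal.ofReal (4 * (2 * c * N) ^ (p - 2) / (p - 2)) *
          ENNReal.ofReal (N ^ 2)) := by
          gcongr
          exact e1.trans (e2.le.trans e4)
      _ = _ := by
          rw [← ENNReal.ofReal_mul (by positivity), ← ENNReal.ofReal_mul hp0.le]
          congr 1
          rw [hK, Real.mul_rpow (by positivity) hN.le]
          have : N ^ p = N ^ (p - 2) * N ^ 2 := by
            rw [← Real.rpow_natCast N 2, ← Real.rpow_add hN]; congr 1; push_cast; ring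
          rw [this]; ring
  rw [hpt, eLpNorm_eq_lintegral_rpow_enorm_toReal (by simpa using hp0) ENNReal.ofReal_ne_top,
    ENNReal.toReal_ofReal hp0.le, one_div]
  calc _ ≤ (ENNReal.ofReal (K * N ^ p)) ^ p⁻¹ := by gcongr
    _ = _ := by
        rw [ENNReal.ofReal_rpow_of_nonneg (by positivity) (by positivity),
          Real.mul_rpow hK0 (by positivity), ← Real.rpow_mul hN.le, mul_inv_cancel₀ hp0.ne',
          Real.rpow_one, ENNReal.ofReal_mul (by positivity), hNdef, ofReal_norm]

end Sobolev

/-! ### An extension operator that commutes with tangential shifts -/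

section Extension

open FourierTransform
open scoped Real

variable {n : ℕ}

/-- The function of `(x, t)` whose Fourier transform in `x` is `χ(⟨ξ⟩ t) a(ξ)`. -/
def freqExtension (χ : ℝ → ℂ) (a : 𝓢(E n, ℂ)) (p : E n × ℝ) : ℂ :=
  ∫ ξ, χ (bracket 1 ξ * p.2) * (char p.1 ξ * a ξ)

lemma freqExtension_eq_fourierInv (χ : ℝ → ℂ) (a : 𝓢(E n, ℂ)) (x : E n) (t : ℝ) :
    freqExtension χ a (x, t) = 𝓕⁻ (fun ξ => χ (bracket 1 ξ * t) * a ξ) x := by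
  rw [Real.fourierInv_eq]
  refine integral_congr_ae (ae_of_all _ fun ξ => ?_)
  simp only [char, Circle.smul_def, smul_eq_mul]
  ring

/-- Multiplication by `2πi ξ_i`. -/
def mulFreq (i : Fin n) (a : 𝓢(E n, ℂ)) : 𝓢(E n, ℂ) :=
  SchwartzMap.smulLeftCLM ℂ (fun ξ : E n => 2 * π * Complex.I * ((ξ i : ℝ) : ℂ)) a

lemma mulFreq_apply (i : Fin n) (a : 𝓢(E n, ℂ)) (ξ : E n) :
    mulFreq i a ξ = 2 * π * Complex.I * ((ξ i : ℝ) : ℂ) * a ξ := by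
  have h : (fun ξ : E n => 2 * π * Complex.I * ((ξ i : ℝ) : ℂ)).HasTemperateGrowth := by
    have h1 : (fun ξ : E n => ξ i).HasTemperateGrowth :=
      (EuclideanSpace.proj (𝕜 := ℝ) i : E n →L[ℝ] ℝ).hasTemperateGrowth
    have h2 : (fun ξ : E n => ((ξ i : ℝ) : ℂ)).HasTemperateGrowth := by fun_prop
    exact (Function.HasTemperateGrowth.const _).mul h2
  rw [mulFreq, SchwartzMap.smulLeftCLM_apply_apply h, smul_eq_mul]

/-- Multiplication by `⟨ξ⟩`. -/
def mulBracket (a : 𝓢(E n, ℂ)) : 𝓢(E n, ℂ) :=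
  SchwartzMap.smulLeftCLM ℂ (fun ξ : E n => (bracket 1 ξ : ℂ)) a

lemma mulBracket_apply (a : 𝓢(E n, ℂ)) (ξ : E n) : mulBracket a ξ = bracket 1 ξ * a ξ := by
  rw [mulBracket, SchwartzMap.smulLeftCLM_apply_apply (hasTemperateGrowth_bracket 1), smul_eq_mul]

/-- The functional `(x, t) ↦ x_i`. -/
def tangentialCoord (i : Fin n) : E n × ℝ →L[ℝ] ℂ :=
  Complex.ofRealCLM ∘L (EuclideanSpace.proj (𝕜 := ℝ) i : E n →L[ℝ] ℝ) ∘L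
    ContinuousLinearMap.fst ℝ (E n) ℝ

/-- The functional `(x, t) ↦ t`. -/
def normalCoord (n : ℕ) : E n × ℝ →L[ℝ] ℂ :=
  Complex.ofRealCLM ∘L ContinuousLinearMap.snd ℝ (E n) ℝ

lemma tangentialCoord_apply (i : Fin n) (p : E n × ℝ) : tangentialCoord i p = (p.1 i : ℂ) := rfl

lemma normalCoord_apply (p : E n × ℝ) : normalCoord n p = (p.2 : ℂ) := rfl

lemma char_eq_exp (h ξ : E n) :
    char h ξ = Complex.exp (∑ i, 2 * π * Complex.I * ((ξ i : ℝ) : ℂ) * (h i : ℂ)) := by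
  rw [char, Real.fourierChar_apply, PiLp.inner_apply]
  congr 1
  push_cast
  rw [Finset.mul_sum, Finset.sum_mul]
  refine Finset.sum_congr rfl fun i _ => ?_
  simp
  ring

lemma hasFDerivAt_char (p : E n × ℝ) (ξ : E n) :
    HasFDerivAt (fun p : E n × ℝ => char p.1 ξ)
      (char p.1 ξ • ∑ i, (2 * π * Complex.I * ((ξ i : ℝ) : ℂ)) • tangentialCoord i) p := by
  simp only [char_eq_exp]
  refine HasFDerivAt.cexp ?_
  refine HasFDerivAt.fun_sum fun i _ => ?_
  exact (tangentialCoord i).hasFDerivAt.const_mul _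

lemma hasFDerivAt_integrand {χ : ℝ → ℂ} (hχ : ContDiff ℝ ∞ χ) (a : 𝓢(E n, ℂ)) (ξ : E n)
    (p : E n × ℝ) :
    HasFDerivAt (fun p : E n × ℝ => χ (bracket 1 ξ * p.2) * (char p.1 ξ * a ξ))
      (∑ i, (χ (bracket 1 ξ * p.2) * (char p.1 ξ * mulFreq i a ξ)) • tangentialCoord i +
        (deriv χ (bracket 1 ξ * p.2) * (char p.1 ξ * mulBracket a ξ)) • normalCoord n) p := by
  have h1 := (hasFDerivAt_char p ξ).mul_const (a ξ)
  have h2 : HasFDerivAt (fun p : E n × ℝ => χ (bracket 1 ξ * p.2))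
      ((bracket 1 ξ * deriv χ (bracket 1 ξ * p.2)) • normalCoord n) p := by
    have h3 : HasDerivAt χ (deriv χ (bracket 1 ξ * p.2)) (bracket 1 ξ * p.2) :=
      ((hχ.differentiable (by simp)) _).hasDerivAt
    have h4 : HasFDerivAt (fun p : E n × ℝ => bracket 1 ξ * p.2)
        (bracket 1 ξ • ContinuousLinearMap.snd ℝ (E n) ℝ) p :=
      (ContinuousLinearMap.snd ℝ (E n) ℝ).hasFDerivAt.const_mul _
    refine (h3.hasFDerivAt.comp p h4).congr_fderiv ?_
    ext q <;> simp [normalCoord]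
  refine (h2.mul h1).congr_fderiv ?_
  ext q <;> simp [tangentialCoord_apply, normalCoord_apply, mulFreq_apply, mulBracket_apply]
  · simp only [Finset.mul_sum]
    refine Finset.sum_congr rfl fun i _ => ?_
    ring
  · ring

lemma exists_norm_le {χ : ℝ → ℂ} (hχ : ContDiff ℝ ∞ χ) (hc : HasCompactSupport χ) :
    ∃ C : ℝ, 0 ≤ C ∧ ∀ t, ‖χ t‖ ≤ C := by
  obtain ⟨C, hC⟩ := hχ.continuous.bounded_above_of_compact_support hc
  exact ⟨C, (norm_nonneg _).trans (hC 0), hC⟩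

lemma aestronglyMeasurable_integrand {χ : ℝ → ℂ} (hχ : ContDiff ℝ ∞ χ) (a : 𝓢(E n, ℂ))
    (p : E n × ℝ) :
    AEStronglyMeasurable (fun ξ => χ (bracket 1 ξ * p.2) * (char p.1 ξ * a ξ)) volume := by
  have h1 : Continuous fun ξ : E n => χ (bracket 1 ξ * p.2) :=
    hχ.continuous.comp ((continuous_bracket 1).mul continuous_const)
  exact (h1.mul ((continuous_char p.1).mul a.continuous)).aestronglyMeasurable

lemma norm_integrand_le {χ : ℝ → ℂ} {C : ℝ} (hC : ∀ t, ‖χ t‖ ≤ C) (a : 𝓢(E n, ℂ))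
    (p : E n × ℝ) (ξ : E n) : ‖χ (bracket 1 ξ * p.2) * (char p.1 ξ * a ξ)‖ ≤ C * ‖a ξ‖ := by
  rw [norm_mul, norm_mul, norm_char, one_mul]
  gcongr
  exact hC _

lemma integrable_integrand {χ : ℝ → ℂ} (hχ : ContDiff ℝ ∞ χ) (hc : HasCompactSupport χ)
    (a : 𝓢(E n, ℂ)) (p : E n × ℝ) :
    Integrable (fun ξ => χ (bracket 1 ξ * p.2) * (char p.1 ξ * a ξ)) := by
  obtain ⟨C, -, hC⟩ := exists_norm_le hχ hc
  exact (a.integrable.norm.const_mul C).mono' (aestronglyMeasurable_integrand hχ a p)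
    (ae_of_all _ (norm_integrand_le hC a p))

/-- The derivative in `(x, t)` of the integrand of `freqExtension`. -/
def integrandDeriv (χ : ℝ → ℂ) (a : 𝓢(E n, ℂ)) (p : E n × ℝ) (ξ : E n) : E n × ℝ →L[ℝ] ℂ :=
  ∑ i, (χ (bracket 1 ξ * p.2) * (char p.1 ξ * mulFreq i a ξ)) • tangentialCoord i +
    (deriv χ (bracket 1 ξ * p.2) * (char p.1 ξ * mulBracket a ξ)) • normalCoord n

lemma continuous_integrandDeriv {χ : ℝ → ℂ} (hχ : ContDiff ℝ ∞ χ) (a : 𝓢(E n, ℂ))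
    (p : E n × ℝ) : Continuous (integrandDeriv χ a p) := by
  have h : ∀ {η : ℝ → ℂ}, ContDiff ℝ ∞ η → ∀ b : 𝓢(E n, ℂ), Continuous fun ξ : E n =>
      η (bracket 1 ξ * p.2) * (char p.1 ξ * b ξ) := fun hη b =>
    (hη.continuous.comp ((continuous_bracket 1).mul continuous_const)).mul
      ((continuous_char p.1).mul b.continuous)
  unfold integrandDeriv
  exact (continuous_finsetSum _ fun i _ => (h hχ (mulFreq i a)).smul continuous_const).add
    ((h (contDiff_infty_iff_deriv.1 hχ).2 (mulBracket a)).smul continuous_const)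

lemma exists_norm_integrandDeriv_le {χ : ℝ → ℂ} (hχ : ContDiff ℝ ∞ χ) (hc : HasCompactSupport χ)
    (a : 𝓢(E n, ℂ)) : ∃ b : E n → ℝ, Integrable b ∧ ∀ p ξ, ‖integrandDeriv χ a p ξ‖ ≤ b ξ := by
  obtain ⟨C, hC0, hC⟩ := exists_norm_le hχ hc
  obtain ⟨C', hC0', hC'⟩ := exists_norm_le (contDiff_infty_iff_deriv.1 hχ).2 hc.deriv
  refine ⟨fun ξ => ∑ i, C * ‖mulFreq i a ξ‖ * ‖tangentialCoord i‖ +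
      C' * ‖mulBracket a ξ‖ * ‖normalCoord n‖,
    (integrable_finsetSum _ fun i _ => ((mulFreq i a).integrable.norm.const_mul C).mul_const _).add
      (((mulBracket a).integrable.norm.const_mul C').mul_const _), fun p ξ => ?_⟩
  refine (norm_add_le _ _).trans (add_le_add ((norm_sum_le _ _).trans
    (Finset.sum_le_sum fun i _ => ?_)) ?_)
  · rw [norm_smul]
    gcongr
    exact norm_integrand_le hC _ p ξ
  · rw [norm_smul]
    gcongr
    exact norm_integrand_le hC' _ p ξ

lemma integrable_integrandDeriv {χ : ℝ → ℂ} (hχ : ContDiff ℝ ∞ χ) (hc : HasCompactSupport χ)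
    (a : 𝓢(E n, ℂ)) (p : E n × ℝ) : Integrable (integrandDeriv χ a p) := by
  obtain ⟨b, hb, hle⟩ := exists_norm_integrandDeriv_le hχ hc a
  exact hb.mono' (continuous_integrandDeriv hχ a p).aestronglyMeasurable (ae_of_all _ (hle p))

lemma integral_integrandDeriv {χ : ℝ → ℂ} (hχ : ContDiff ℝ ∞ χ) (hc : HasCompactSupport χ)
    (a : 𝓢(E n, ℂ)) (p : E n × ℝ) : ∫ ξ, integrandDeriv χ a p ξ =
      ∑ i, freqExtension χ (mulFreq i a) p • tangentialCoord i +
        freqExtension (deriv χ) (mulBracket a) p • normalCoord n := by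
  refine ContinuousLinearMap.ext fun q => ?_
  rw [ContinuousLinearMap.integral_apply (integrable_integrandDeriv hχ hc a p)]
  simp only [integrandDeriv, add_apply, sum_apply, smul_apply, smul_eq_mul]
  have h1 := fun i => (integrable_integrand hχ hc (mulFreq i a) p).mul_const (tangentialCoord i q)
  have h2 := (integrable_integrand (contDiff_infty_iff_deriv.1 hχ).2 hc.deriv (mulBracket a)
    p).mul_const (normalCoord n q)
  rw [integral_add (integrable_finsetSum _ fun i _ => h1 i) h2,
    integral_finsetSum _ fun i _ => h1 i]
  simp only [integral_mul_const]
  rfl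

lemma hasFDerivAt_freqExtension {χ : ℝ → ℂ} (hχ : ContDiff ℝ ∞ χ) (hc : HasCompactSupport χ)
    (a : 𝓢(E n, ℂ)) (p : E n × ℝ) :
    HasFDerivAt (freqExtension χ a)
      (∑ i, freqExtension χ (mulFreq i a) p • tangentialCoord i +
        freqExtension (deriv χ) (mulBracket a) p • normalCoord n) p := by
  obtain ⟨b, hb, hle⟩ := exists_norm_integrandDeriv_le hχ hc a
  rw [← integral_integrandDeriv hχ hc]
  exact hasFDerivAt_integral_of_dominated_of_fderiv_le (𝕜 := ℝ) (μ := (volume : Measure (E n)))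
    (F' := fun (p : E n × ℝ) ξ => integrandDeriv χ a p ξ) (s := Set.univ) (bound := b)
    univ_mem (Eventually.of_forall fun p => aestronglyMeasurable_integrand hχ a p)
    (integrable_integrand hχ hc a p) (integrable_integrandDeriv hχ hc a p).1
    (ae_of_all _ fun ξ p _ => hle p ξ) hb
    (ae_of_all _ fun ξ p _ => hasFDerivAt_integrand hχ a ξ p)

lemma contDiff_freqExtension {χ : ℝ → ℂ} (hχ : ContDiff ℝ ∞ χ) (hc : HasCompactSupport χ)
    (a : 𝓢(E n, ℂ)) : ContDiff ℝ ∞ (freqExtension χ a) := by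
  rw [contDiff_infty]
  intro N
  induction N generalizing χ a with
  | zero =>
    refine contDiff_zero.2 (continuous_iff_continuousAt.2 fun p => ?_)
    exact (hasFDerivAt_freqExtension hχ hc a p).continuousAt
  | succ N ih =>
    rw [Nat.cast_succ, contDiff_succ_iff_hasFDerivAt]
    refine ⟨_, ?_, fun p => hasFDerivAt_freqExtension hχ hc a p⟩
    have hχ' : ContDiff ℝ ∞ (deriv χ) := (contDiff_infty_iff_deriv.1 hχ).2
    exact (ContDiff.sum fun i _ => (ih hχ hc _).smul contDiff_const).add
      ((ih hχ' hc.deriv _).smul contDiff_const)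

lemma classicalGrad_freqExtension_inl {χ : ℝ → ℂ} (hχ : ContDiff ℝ ∞ χ) (hc : HasCompactSupport χ)
    (a : 𝓢(E n, ℂ)) (p : E n × ℝ) (i : Fin n) :
    classicalGrad (freqExtension χ a) p (Sum.inl i) = freqExtension χ (mulFreq i a) p := by
  simp only [classicalGrad, (hasFDerivAt_freqExtension hχ hc a p).fderiv, Sum.elim_inl,
    add_apply, sum_apply, smul_apply, tangentialCoord_apply, normalCoord_apply]
  rw [Finset.sum_eq_single i] <;> simp +contextual

lemma classicalGrad_freqExtension_inr {χ : ℝ → ℂ} (hχ : ContDiff ℝ ∞ χ) (hc : HasCompactSupport χ)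
    (a : 𝓢(E n, ℂ)) (p : E n × ℝ) :
    classicalGrad (freqExtension χ a) p (Sum.inr ()) =
      freqExtension (deriv χ) (mulBracket a) p := by
  simp [classicalGrad, (hasFDerivAt_freqExtension hχ hc a p).fderiv,
    tangentialCoord_apply, normalCoord_apply]

end Extension

section ExtensionBounds

open FourierTransform
open scoped Real

variable {n : ℕ}

/-- Plancherel's theorem on `L¹ ∩ L²`. -/
lemma lintegral_fourierInv_sq {g : E n → ℂ} (h1 : Integrable g) (h2 : MemLp g 2 volume) :
    ∫⁻ x, ‖𝓕⁻ g x‖ₑ ^ 2 = ∫⁻ ξ, ‖g ξ‖ₑ ^ 2 := by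
  set G : L2 n := h2.toLp g with hG
  have hGc : G =ᵐ[volume] g := h2.coeFn_toLp
  have hGi : Integrable G := h1.congr hGc.symm
  have e1 : ∀ x, 𝓕⁻ g x = 𝓕⁻ (G : E n → ℂ) x := fun x => by
    rw [Real.fourierInv_eq, Real.fourierInv_eq]
    refine integral_congr_ae ?_
    filter_upwards [hGc] with ξ hξ
    rw [hξ]
  have e2 : ∫⁻ x, ‖𝓕⁻ g x‖ₑ ^ 2 = ∫⁻ x, ‖(𝓕⁻ G : L2 n) x‖ₑ ^ 2 := by
    refine lintegral_congr_ae ?_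
    filter_upwards [coeFn_fourierInv hGi] with x hx
    rw [hx, e1]
  have e3 : ∫⁻ ξ, ‖g ξ‖ₑ ^ 2 = ∫⁻ ξ, ‖G ξ‖ₑ ^ 2 := by
    refine lintegral_congr_ae ?_
    filter_upwards [hGc] with ξ hξ
    rw [hξ]
  have e4 := enorm_sq_eq_lintegral_fourier (𝓕⁻ G : L2 n)
  rw [fourier_fourierInv_eq, ← eLpNorm_two_sq (f := G), ← Lp.enorm_def] at e4
  rw [e2, e3, ← eLpNorm_two_sq, ← eLpNorm_two_sq, ← Lp.enorm_def, ← Lp.enorm_def, e4]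

lemma halfLineMeasure_Iio {α : ℝ} (h1 : α < 1) {R : ℝ} (hR : 0 < R) :
    halfLineMeasure α (Set.Iio R) = ENNReal.ofReal (R ^ (2 - 2 * α) / (2 - 2 * α)) := by
  have hint : IntegrableOn (fun t : ℝ => t ^ (1 - 2 * α)) (Set.Ioo 0 R) := by
    have := intervalIntegral.intervalIntegrable_rpow' (a := 0) (b := R) (r := 1 - 2 * α)
      (by linarith)
    rwa [intervalIntegrable_iff_integrableOn_Ioo_of_le hR.le] at this
  have e : ∫ t in Set.Ioo 0 R, t ^ (1 - 2 * α) = R ^ (2 - 2 * α) / (2 - 2 * α) := by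
    rw [← integral_Ioc_eq_integral_Ioo, ← intervalIntegral.integral_of_le hR.le,
      integral_rpow (Or.inl (by linarith))]
    have : 1 - 2 * α + 1 = 2 - 2 * α := by ring
    rw [this, Real.zero_rpow (by linarith), sub_zero]
  rw [← lintegral_indicator_one measurableSet_Iio, lintegral_halfLine, ← e,
    ofReal_integral_eq_lintegral_ofReal hint, ← lintegral_indicator measurableSet_Ioi,
    ← lintegral_indicator measurableSet_Ioo]
  · refine lintegral_congr fun t => ?_
    by_cases h0 : 0 < t <;> by_cases ht : t < R <;> simp [h0, ht, Set.indicator]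
  · filter_upwards [ae_restrict_mem measurableSet_Ioo] with t ht
    exact Real.rpow_nonneg ht.1.le _

lemma bracket_one_rpow (s : ℝ) (ξ : E n) : bracket 1 ξ ^ s = bracket s ξ := by
  unfold bracket
  rw [← Real.rpow_mul (by positivity)]
  congr 1; ring

/-- The frequency `ξ` of `freqExtension χ a` lives at heights `t ≲ ⟨ξ⟩⁻¹`, which have weighted
measure of the order `⟨ξ⟩^{2α-2}`. -/
lemma exists_lintegral_freqExtension_le {α : ℝ} (h1 : α < 1) {χ : ℝ → ℂ} (hχ : ContDiff ℝ ∞ χ)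
    (hc : HasCompactSupport χ) :
    ∃ K : ℝ, 0 ≤ K ∧ ∀ a : 𝓢(E n, ℂ),
      ∫⁻ p, ‖freqExtension χ a p‖ₑ ^ 2 ∂(weightedMeasure n α) ≤
        ENNReal.ofReal K * ∫⁻ ξ, ENNReal.ofReal (bracket (2 * α - 2) ξ) * ‖a ξ‖ₑ ^ 2 := by
  obtain ⟨C, hC0, hC⟩ := exists_norm_le hχ hc
  obtain ⟨R, hR0, hR⟩ := hc.isCompact.isBounded.exists_pos_norm_lt
  have hχR : ∀ t, R ≤ t → χ t = 0 := fun t ht => by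
    by_contra h
    have := hR t (subset_tsupport χ h)
    rw [Real.norm_eq_abs] at this
    linarith [le_abs_self t]
  refine ⟨C ^ 2 * (R ^ (2 - 2 * α) / (2 - 2 * α)), ?_, fun a => ?_⟩
  · have : 0 ≤ 2 - 2 * α := by linarith
    positivity
  have hcont : Continuous fun q : ℝ × E n => χ (bracket 1 q.2 * q.1) * a q.2 :=
    (hχ.continuous.comp (((continuous_bracket 1).comp continuous_snd).mul continuous_fst)).mul
      (a.continuous.comp continuous_snd)
  have e1 : ∫⁻ p, ‖freqExtension χ a p‖ₑ ^ 2 ∂(weightedMeasure n α) =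
      ∫⁻ t, ∫⁻ ξ, ‖χ (bracket 1 ξ * t) * a ξ‖ₑ ^ 2 ∂volume ∂(halfLineMeasure α) := by
    rw [lintegral_weightedMeasure α
      ((contDiff_freqExtension hχ hc a).continuous.measurable.enorm.pow_const 2)]
    refine lintegral_congr fun t => ?_
    simp only [freqExtension_eq_fourierInv]
    have hm : AEStronglyMeasurable (fun ξ : E n => χ (bracket 1 ξ * t) * a ξ) volume :=
      (hcont.comp (Continuous.prodMk_right t)).aestronglyMeasurable
    have hle : ∀ ξ : E n, ‖χ (bracket 1 ξ * t) * a ξ‖ ≤ C * ‖a ξ‖ := fun ξ => by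
      rw [norm_mul]; gcongr; exact hC _
    refine lintegral_fourierInv_sq ((a.integrable.norm.const_mul C).mono' hm (ae_of_all _ hle)) ?_
    exact ((a.memLp 2 volume).norm.const_mul C).mono hm (ae_of_all _ fun ξ => by
      simpa [abs_of_nonneg hC0] using hle ξ)
  rw [e1, lintegral_lintegral_swap (by
    exact (hcont.measurable.enorm.pow_const 2).aemeasurable),
    ← lintegral_const_mul' _ _ ENNReal.ofReal_ne_top]
  refine lintegral_mono fun ξ => ?_
  have hb : 0 < bracket 1 ξ := bracket_pos 1 ξ
  calc ∫⁻ t, ‖χ (bracket 1 ξ * t) * a ξ‖ₑ ^ 2 ∂(halfLineMeasure α)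
      ≤ ∫⁻ t, (Set.Iio (R / bracket 1 ξ)).indicator
          (fun _ => ENNReal.ofReal (C ^ 2) * ‖a ξ‖ₑ ^ 2) t ∂(halfLineMeasure α) := by
        refine lintegral_mono fun t => ?_
        by_cases ht : t < R / bracket 1 ξ
        · rw [Set.indicator_of_mem (show t ∈ Set.Iio (R / bracket 1 ξ) from ht), enorm_mul, mul_pow]
          gcongr
          rw [← ofReal_norm, ← ENNReal.ofReal_pow (norm_nonneg _)]
          exact ENNReal.ofReal_le_ofReal (pow_le_pow_left₀ (norm_nonneg _) (hC _) 2)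
        · have : R ≤ bracket 1 ξ * t := by
            rw [not_lt, div_le_iff₀ hb] at ht; linarith
          rw [hχR _ this]; simp
    _ = _ := by
        rw [lintegral_indicator_const measurableSet_Iio, halfLineMeasure_Iio h1 (by positivity),
          mul_right_comm, ← ENNReal.ofReal_mul (by positivity), ← mul_assoc,
          ← ENNReal.ofReal_mul (by have : 0 ≤ 2 - 2 * α := by linarith
                                   positivity)]
        congr 2
        rw [Real.div_rpow hR0.le hb.le, ← bracket_one_rpow (2 * α - 2)]
        have : bracket 1 ξ ^ (2 * α - 2) = (bracket 1 ξ ^ (2 - 2 * α))⁻¹ := by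
          rw [← Real.rpow_neg hb.le]; congr 1; ring
        rw [this]; ring

lemma ofReal_bracket_mul_enorm_mulFreq_le (α : ℝ) (i : Fin n) (a : 𝓢(E n, ℂ)) (ξ : E n) :
    ENNReal.ofReal (bracket (2 * α - 2) ξ) * ‖mulFreq i a ξ‖ₑ ^ 2 ≤
      ENNReal.ofReal ((2 * π) ^ 2) * (ENNReal.ofReal (bracket (2 * α) ξ) * ‖a ξ‖ₑ ^ 2) := by
  have hb := bracket_pos (2 * α - 2) ξ
  rw [mulFreq_apply, enorm_mul, mul_pow, ← mul_assoc, ← mul_assoc, ← ofReal_norm,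
    ← ENNReal.ofReal_pow (norm_nonneg _), ← ENNReal.ofReal_mul hb.le,
    ← ENNReal.ofReal_mul (by positivity)]
  refine mul_le_mul_left (ENNReal.ofReal_le_ofReal ?_) _
  have h2 : bracket (2 * α) ξ = bracket (2 * α - 2) ξ * (1 + ‖ξ‖ ^ 2) := by
    have : bracket 2 ξ = 1 + ‖ξ‖ ^ 2 := by simp [bracket]
    rw [← this, ← bracket_add]; congr 1; ring
  have h3 : ‖2 * π * Complex.I * ((ξ i : ℝ) : ℂ)‖ = 2 * π * |ξ i| := by
    simp [abs_of_pos Real.pi_pos]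
  have h4 : |ξ i| ≤ ‖ξ‖ := by simpa using PiLp.norm_apply_le ξ i
  rw [h3, h2, mul_pow]
  have h5 : |ξ i| ^ 2 ≤ 1 + ‖ξ‖ ^ 2 := by nlinarith [abs_nonneg (ξ i), norm_nonneg ξ]
  have : 0 ≤ bracket (2 * α - 2) ξ * (2 * π) ^ 2 := by positivity
  nlinarith [mul_le_mul_of_nonneg_left h5 this]

lemma ofReal_bracket_mul_enorm_mulBracket (α : ℝ) (a : 𝓢(E n, ℂ)) (ξ : E n) :
    ENNReal.ofReal (bracket (2 * α - 2) ξ) * ‖mulBracket a ξ‖ₑ ^ 2 =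
      ENNReal.ofReal (bracket (2 * α) ξ) * ‖a ξ‖ₑ ^ 2 := by
  have hb := bracket_pos (2 * α - 2) ξ
  rw [mulBracket_apply, enorm_mul, mul_pow, ← mul_assoc, ← ofReal_norm,
    ← ENNReal.ofReal_pow (norm_nonneg _), ← ENNReal.ofReal_mul hb.le,
    Complex.norm_of_nonneg (bracket_pos 1 ξ).le]
  have : bracket (2 * α) ξ = bracket (2 * α - 2) ξ * bracket 1 ξ ^ 2 := by
    rw [← Real.rpow_natCast, bracket_one_rpow, ← bracket_add]; congr 1; push_cast; ring
  rw [this]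

/-- A smooth cutoff function of the height. -/
def heightBump : ContDiffBump (0 : ℝ) := ⟨1, 2, one_pos, one_lt_two⟩

/-- The values of `heightBump` as complex numbers. -/
def heightCutoff (t : ℝ) : ℂ := ((heightBump t : ℝ) : ℂ)

lemma contDiff_heightCutoff : ContDiff ℝ ∞ heightCutoff :=
  Complex.ofRealCLM.contDiff.comp heightBump.contDiff

lemma hasCompactSupport_heightCutoff : HasCompactSupport heightCutoff :=
  heightBump.hasCompactSupport.comp_left (g := fun t : ℝ => (t : ℂ)) Complex.ofReal_zero

lemma heightCutoff_zero : heightCutoff 0 = 1 := by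
  have : heightBump (0 : ℝ) = 1 :=
    heightBump.one_of_mem_closedBall (by simp [heightBump])
  simp [heightCutoff, this]

lemma heightCutoff_eq_zero {t : ℝ} (ht : 2 ≤ |t|) : heightCutoff t = 0 := by
  have : heightBump t = 0 := heightBump.zero_of_le_dist (by simpa [heightBump] using ht)
  simp [heightCutoff, this]

/-- The extension of `φ` to the half-space whose Fourier transform in `x` is
`χ(⟨ξ⟩ t) φ̂(ξ)`, with a cutoff `χ`. -/
def extension (φ : 𝓢(E n, ℂ)) : E n × ℝ → ℂ := freqExtension heightCutoff (𝓕 φ)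

lemma contDiff_extension (φ : 𝓢(E n, ℂ)) : ContDiff ℝ ∞ (extension φ) :=
  contDiff_freqExtension contDiff_heightCutoff hasCompactSupport_heightCutoff _

lemma extension_zero (φ : 𝓢(E n, ℂ)) (x : E n) : extension φ (x, 0) = φ x := by
  unfold extension
  rw [freqExtension_eq_fourierInv]
  have : (fun ξ : E n => heightCutoff (bracket 1 ξ * 0) * (𝓕 φ : 𝓢(E n, ℂ)) ξ) =
      (𝓕 φ : 𝓢(E n, ℂ)) := by
    funext ξ; rw [mul_zero, heightCutoff_zero, one_mul]
  rw [this, ← SchwartzMap.fourierInv_coe, fourierInv_fourier_eq]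

lemma extension_eq_zero (φ : 𝓢(E n, ℂ)) {p : E n × ℝ} (hp : 2 ≤ |p.2|) : extension φ p = 0 := by
  unfold extension freqExtension
  refine integral_eq_zero_of_ae (ae_of_all _ fun ξ => ?_)
  have h1 := one_le_bracket zero_le_one ξ
  have : 2 ≤ |bracket 1 ξ * p.2| := by
    rw [abs_mul, abs_of_pos (bracket_pos 1 ξ)]; nlinarith
  simp [heightCutoff_eq_zero this]

lemma extension_sub (φ φ' : 𝓢(E n, ℂ)) : extension (φ - φ') = extension φ - extension φ' := by
  funext p
  have h := fun φ : 𝓢(E n, ℂ) => integrable_integrand contDiff_heightCutoff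
    hasCompactSupport_heightCutoff (𝓕 φ : 𝓢(E n, ℂ)) p
  rw [Pi.sub_apply]
  unfold extension freqExtension
  rw [← integral_sub (h φ) (h φ')]
  refine integral_congr_ae (ae_of_all _ fun ξ => ?_)
  have : (𝓕 (φ - φ') : 𝓢(E n, ℂ)) = 𝓕 φ - 𝓕 φ' := (SchwartzMap.fourierTransformCLM ℂ).map_sub _ _
  simp only [this, sub_apply]
  ring

lemma char_add (h k ξ : E n) : char (h + k) ξ = char h ξ * char k ξ := by
  simp only [char, inner_add_right, AddChar.map_add_eq_mul, Circle.coe_mul]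

/-- The Fourier transform of the translate `φ(· + h)`. -/
lemma fourier_compSubConst_neg_apply (h : E n) (φ : 𝓢(E n, ℂ)) (ξ : E n) :
    (𝓕 (φ.compSubConstCLM ℂ (-h)) : 𝓢(E n, ℂ)) ξ = char h ξ * (𝓕 φ : 𝓢(E n, ℂ)) ξ := by
  have e : ∀ φ : 𝓢(E n, ℂ), (𝓕 φ : 𝓢(E n, ℂ)) ξ = (𝓕⁻ φ : 𝓢(E n, ℂ)) (-ξ) := fun φ => by
    rw [SchwartzMap.fourier_coe, SchwartzMap.fourierInv_coe, Real.fourierInv_eq_fourier_neg,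
      neg_neg]
  rw [e, e, fourierInv_compSubConst_apply]
  simp [char]

lemma extension_comp_tangentialShift (φ : 𝓢(E n, ℂ)) (h : E n) :
    extension φ ∘ tangentialShift h = extension (φ.compSubConstCLM ℂ (-h)) := by
  funext p
  refine integral_congr_ae (ae_of_all _ fun ξ => ?_)
  simp only [tangentialShift, fourier_compSubConst_neg_apply, char_add]
  ring

lemma exists_lintegral_extension_le {α : ℝ} (h1 : α < 1) :
    ∃ K : ℝ, 0 ≤ K ∧ ∀ φ : 𝓢(E n, ℂ),
      ∫⁻ p, ‖extension φ p‖ₑ ^ 2 ∂(weightedMeasure n α) ≤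
        ENNReal.ofReal K *
          ∫⁻ ξ, ENNReal.ofReal (bracket (2 * α) ξ) * ‖(𝓕 φ : 𝓢(E n, ℂ)) ξ‖ₑ ^ 2 := by
  obtain ⟨K, hK, h⟩ := exists_lintegral_freqExtension_le (n := n) h1 contDiff_heightCutoff
    hasCompactSupport_heightCutoff
  refine ⟨K, hK, fun φ => (h _).trans ?_⟩
  gcongr with ξ
  exact bracket_le (by linarith) ξ

lemma exists_lintegral_classicalGrad_extension_le {α : ℝ} (h1 : α < 1) :
    ∃ K : ℝ, 0 ≤ K ∧ ∀ φ : 𝓢(E n, ℂ),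
      ∫⁻ p, ‖classicalGrad (extension φ) p‖ₑ ^ 2 ∂(weightedMeasure n α) ≤
        ENNReal.ofReal K *
          ∫⁻ ξ, ENNReal.ofReal (bracket (2 * α) ξ) * ‖(𝓕 φ : 𝓢(E n, ℂ)) ξ‖ₑ ^ 2 := by
  have hχ := contDiff_heightCutoff
  have hc := hasCompactSupport_heightCutoff
  have hχ' : ContDiff ℝ ∞ (deriv heightCutoff) := (contDiff_infty_iff_deriv.1 hχ).2
  obtain ⟨K, hK, h⟩ := exists_lintegral_freqExtension_le (n := n) h1 hχ hc
  obtain ⟨K', hK', h'⟩ := exists_lintegral_freqExtension_le (n := n) h1 hχ' hc.deriv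
  refine ⟨n * (K * (2 * π) ^ 2) + K', by positivity, fun φ => ?_⟩
  set I := ∫⁻ ξ, ENNReal.ofReal (bracket (2 * α) ξ) * ‖(𝓕 φ : 𝓢(E n, ℂ)) ξ‖ₑ ^ 2 with hI
  have hm : ∀ {χ : ℝ → ℂ}, ContDiff ℝ ∞ χ → HasCompactSupport χ → ∀ a : 𝓢(E n, ℂ),
      Measurable fun p => ‖freqExtension χ a p‖ₑ ^ 2 := fun hχ hc a =>
    (contDiff_freqExtension hχ hc a).continuous.measurable.enorm.pow_const 2
  -- A tangential derivative multiplies by `2πi ξ_i`; the normal derivative replaces `χ` by `χ'` and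
  -- multiplies by `⟨ξ⟩`.
  have e : ∀ p, ‖classicalGrad (extension φ) p‖ₑ ^ 2 =
      ∑ i : Fin n, ‖freqExtension heightCutoff (mulFreq i (𝓕 φ)) p‖ₑ ^ 2 +
        ‖freqExtension (deriv heightCutoff) (mulBracket (𝓕 φ)) p‖ₑ ^ 2 := fun p => by
    rw [enorm_sq_eq_sum, Fintype.sum_sum_type]
    simp only [extension, classicalGrad_freqExtension_inl hχ hc, Finset.univ_unique,
      Finset.sum_singleton]
    rw [← classicalGrad_freqExtension_inr hχ hc]
  simp only [e]
  rw [lintegral_add_right _ (hm hχ' hc.deriv _), lintegral_finsetSum _ fun i _ => hm hχ hc _]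
  have b1 : ∀ i : Fin n, ∫⁻ p, ‖freqExtension heightCutoff (mulFreq i (𝓕 φ)) p‖ₑ ^ 2
      ∂(weightedMeasure n α) ≤ ENNReal.ofReal (K * (2 * π) ^ 2) * I := fun i => by
    refine (h _).trans ?_
    rw [ENNReal.ofReal_mul hK, mul_assoc, hI]
    refine mul_le_mul' le_rfl ?_
    rw [← lintegral_const_mul' _ _ ENNReal.ofReal_ne_top]
    refine lintegral_mono fun ξ => ?_
    exact ofReal_bracket_mul_enorm_mulFreq_le α i _ ξ
  have b2 : ∫⁻ p, ‖freqExtension (deriv heightCutoff) (mulBracket (𝓕 φ)) p‖ₑ ^ 2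
      ∂(weightedMeasure n α) ≤ ENNReal.ofReal K' * I := by
    refine (h' _).trans (le_of_eq ?_)
    simp only [ofReal_bracket_mul_enorm_mulBracket, hI]
  calc _ ≤ ∑ _i : Fin n, ENNReal.ofReal (K * (2 * π) ^ 2) * I + ENNReal.ofReal K' * I :=
        add_le_add (Finset.sum_le_sum fun i _ => b1 i) b2
    _ = _ := by
        rw [Finset.sum_const, Finset.card_univ, Fintype.card_fin, nsmul_eq_mul, ← mul_assoc,
          ← add_mul, ENNReal.ofReal_add (by positivity) hK',
          ENNReal.ofReal_mul (p := (n : ℝ)) (by positivity),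
          ENNReal.ofReal_natCast]

/-- Dominated convergence for functions that eventually vanish at each point. -/
lemma tendsto_eLpNorm_zero_of_dominated {X F : Type*} [MeasurableSpace X] {μ : Measure X}
    [NormedAddCommGroup F] {p : ℝ≥0∞} (hp0 : p ≠ 0) (hpt : p ≠ ⊤) {f : ℕ → X → F} {g : X → ℝ}
    (hf : ∀ k, AEStronglyMeasurable (f k) μ) (hg : MemLp g p μ) (hle : ∀ k x, ‖f k x‖ ≤ g x)
    (hlim : ∀ x, ∀ᶠ k in atTop, f k x = 0) :
    Tendsto (fun k => eLpNorm (f k) p μ) atTop (𝓝 0) := by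
  have hp : 0 < p.toReal := ENNReal.toReal_pos hp0 hpt
  have h : Tendsto (fun k => ∫⁻ x, ‖f k x‖ₑ ^ p.toReal ∂μ) atTop (𝓝 (∫⁻ _, 0 ∂μ)) := by
    refine tendsto_lintegral_of_dominated_convergence' (fun x => ‖g x‖ₑ ^ p.toReal)
      (fun k => (hf k).enorm.pow_const _) (fun k => ae_of_all _ fun x => ?_)
      (lintegral_rpow_enorm_lt_top_of_eLpNorm_lt_top hp0 hpt hg.2).ne (ae_of_all _ fun x => ?_)
    · refine ENNReal.rpow_le_rpow ?_ hp.le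
      rw [← ofReal_norm, ← ofReal_norm]
      exact ENNReal.ofReal_le_ofReal ((hle k x).trans (le_abs_self _))
    · refine tendsto_const_nhds.congr' ?_
      filter_upwards [hlim x] with k hk
      simp [hk, hp]
  rw [lintegral_zero] at h
  have h2 := h.ennrpow_const (1 / p.toReal)
  rw [ENNReal.zero_rpow_of_pos (by positivity)] at h2
  simpa only [eLpNorm_eq_lintegral_rpow_enorm_toReal hp0 hpt] using h2

/-- A smooth cutoff function of the tangential variables. -/
def tangentialBump (n : ℕ) : ContDiffBump (0 : E n) := ⟨1, 2, one_pos, one_lt_two⟩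

/-- The cutoff at distance `k + 1` in the tangential variables, as a function of `(x, t)`. -/
def tangentialCutoff (n k : ℕ) (p : E n × ℝ) : ℝ := tangentialBump n ((k + 1 : ℝ)⁻¹ • p).1

lemma contDiff_tangentialCutoff (n k : ℕ) : ContDiff ℝ ∞ (tangentialCutoff n k) := by
  unfold tangentialCutoff
  exact (tangentialBump n).contDiff.comp (by fun_prop)

lemma tangentialCutoff_eq_one {k : ℕ} {p : E n × ℝ} (hp : ‖p.1‖ ≤ k + 1) :
    tangentialCutoff n k p = 1 := by
  refine (tangentialBump n).one_of_mem_closedBall ?_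
  have : (0 : ℝ) < k + 1 := by positivity
  rw [mem_closedBall_zero_iff, Prod.smul_fst, norm_smul, norm_inv, Real.norm_of_nonneg this.le,
    inv_mul_le_iff₀ this]
  simpa [tangentialBump] using hp

lemma tangentialCutoff_eq_zero {k : ℕ} {p : E n × ℝ} (hp : 2 * (k + 1) ≤ ‖p.1‖) :
    tangentialCutoff n k p = 0 := by
  refine (tangentialBump n).zero_of_le_dist ?_
  have : (0 : ℝ) < k + 1 := by positivity
  rw [dist_zero_right, Prod.smul_fst, norm_smul, norm_inv, Real.norm_of_nonneg this.le,
    le_inv_mul_iff₀ this]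
  simpa [tangentialBump, mul_comm] using hp

lemma abs_tangentialCutoff_sub_one_le (k : ℕ) (p : E n × ℝ) : |tangentialCutoff n k p - 1| ≤ 1 := by
  have h1 : 0 ≤ tangentialCutoff n k p := (tangentialBump n).nonneg
  have h2 : tangentialCutoff n k p ≤ 1 := (tangentialBump n).le_one
  rw [abs_le]; constructor <;> linarith

lemma exists_norm_fderiv_tangentialCutoff_le (n : ℕ) :
    ∃ C : ℝ, 0 ≤ C ∧ ∀ k p, ‖fderiv ℝ (tangentialCutoff n k) p‖ ≤ C := by
  obtain ⟨C, hC⟩ := ((tangentialBump n).contDiff (n := 1)).continuous_fderiv (by simp)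
    |>.bounded_above_of_compact_support ((tangentialBump n).hasCompactSupport.fderiv ℝ)
  have hC0 : 0 ≤ C := (norm_nonneg _).trans (hC 0)
  refine ⟨C, hC0, fun k p => ?_⟩
  set l : E n × ℝ →L[ℝ] E n := (k + 1 : ℝ)⁻¹ • ContinuousLinearMap.fst ℝ (E n) ℝ with hl
  have hl1 : ‖l‖ ≤ 1 := by
    have h1 : ‖ContinuousLinearMap.fst ℝ (E n) ℝ‖ ≤ 1 := ContinuousLinearMap.norm_fst_le _ _ _
    have h2 : (0 : ℝ) < k + 1 := by positivity
    have h3 : (k + 1 : ℝ)⁻¹ ≤ 1 := inv_le_one_of_one_le₀ (by simp)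
    rw [hl, norm_smul, norm_inv, Real.norm_of_nonneg h2.le]
    nlinarith [norm_nonneg (ContinuousLinearMap.fst ℝ (E n) ℝ), inv_pos.2 h2]
  have h : HasFDerivAt (tangentialCutoff n k)
      ((fderiv ℝ (tangentialBump n) (l p)).comp l) p :=
    ((((tangentialBump n).contDiff (n := 1)).differentiable (by simp)) (l p)).hasFDerivAt.comp p
      l.hasFDerivAt
  rw [h.fderiv]
  refine (ContinuousLinearMap.opNorm_comp_le _ _).trans ?_
  calc _ ≤ C * 1 := by gcongr; exact hC _
    _ = C := mul_one C

/-- Product rule: multiplication of a function by a real cutoff. -/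
lemma norm_classicalGrad_mul_le {s : E n × ℝ → ℝ} {ψ : E n × ℝ → ℂ} {p : E n × ℝ}
    (hs : DifferentiableAt ℝ s p) (hψ : DifferentiableAt ℝ ψ p) {C : ℝ}
    (hC : ‖fderiv ℝ s p‖ ≤ C) :
    ‖classicalGrad (fun p => (s p : ℂ) * ψ p) p‖ ≤
      |s p| * ‖classicalGrad ψ p‖ + (n + 1) * C * ‖ψ p‖ := by
  have hd : HasFDerivAt (fun p => (s p : ℂ) * ψ p)
      ((s p : ℂ) • fderiv ℝ ψ p + ψ p • (Complex.ofRealCLM ∘L fderiv ℝ s p)) p :=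
    (Complex.ofRealCLM.hasFDerivAt.comp p hs.hasFDerivAt).mul hψ.hasFDerivAt
  have e : classicalGrad (fun p => (s p : ℂ) * ψ p) p =
      (s p : ℂ) • classicalGrad ψ p + ψ p • WithLp.toLp 2 (Sum.elim
        (fun i : Fin n => ((fderiv ℝ s p (EuclideanSpace.single i 1, 0) : ℝ) : ℂ))
        (fun _ : Unit => ((fderiv ℝ s p (0, 1) : ℝ) : ℂ))) := by
    ext k
    rcases k with i | i <;> simp [classicalGrad, hd.fderiv]
  have hn : ‖(WithLp.toLp 2 (Sum.elim
        (fun i : Fin n => ((fderiv ℝ s p (EuclideanSpace.single i 1, 0) : ℝ) : ℂ))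
        (fun _ : Unit => ((fderiv ℝ s p (0, 1) : ℝ) : ℂ))) : EuclideanSpace ℂ (Fin n ⊕ Unit))‖ ≤
      (n + 1) * C := by
    have hC0 : 0 ≤ C := (norm_nonneg _).trans hC
    refine abs_le_of_sq_le_sq' ?_ (by positivity) |>.2
    rw [EuclideanSpace.norm_sq_eq, Fintype.sum_sum_type]
    have b1 : ∀ q : E n × ℝ, ‖q‖ ≤ 1 → ‖((fderiv ℝ s p q : ℝ) : ℂ)‖ ^ 2 ≤ C ^ 2 := fun q hq => by
      rw [Complex.norm_real]
      refine pow_le_pow_left₀ (norm_nonneg _) ?_ 2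
      refine ((fderiv ℝ s p).le_opNorm q).trans ?_
      nlinarith [norm_nonneg q]
    have b2 := Finset.sum_le_sum fun (i : Fin n) (_ : i ∈ Finset.univ) =>
      b1 (EuclideanSpace.single i 1, 0) (by simp [Prod.norm_def])
    have b3 := b1 (0, 1) (by simp [Prod.norm_def])
    simp only [Sum.elim_inl, Sum.elim_inr, Finset.univ_unique, Finset.sum_singleton]
    rw [Finset.sum_const, Finset.card_univ, Fintype.card_fin, nsmul_eq_mul] at b2
    have : (0 : ℝ) ≤ n := by positivity
    nlinarith [sq_nonneg C, mul_nonneg this (sq_nonneg C),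
      mul_nonneg (mul_nonneg this this) (sq_nonneg C)]
  rw [e]
  refine (norm_add_le _ _).trans ?_
  rw [norm_smul, norm_smul, Complex.norm_real, Real.norm_eq_abs, mul_comm ‖ψ p‖]
  gcongr

lemma lintegral_bracket_fourier_lt_top (s : ℝ) (φ : 𝓢(E n, ℂ)) :
    ∫⁻ ξ, ENNReal.ofReal (bracket (2 * s) ξ) * ‖(𝓕 φ : 𝓢(E n, ℂ)) ξ‖ₑ ^ 2 < ⊤ := by
  set ψ : 𝓢(E n, ℂ) := SchwartzMap.smulLeftCLM ℂ (fun ξ : E n => (bracket s ξ : ℂ)) (𝓕 φ) with hψ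
  have h : ∀ ξ, ENNReal.ofReal (bracket (2 * s) ξ) * ‖(𝓕 φ : 𝓢(E n, ℂ)) ξ‖ₑ ^ 2 = ‖ψ ξ‖ₑ ^ 2 := by
    intro ξ
    have hb := bracket_pos s ξ
    rw [hψ, SchwartzMap.smulLeftCLM_apply_apply (hasTemperateGrowth_bracket s), smul_eq_mul,
      enorm_mul, mul_pow, ← ofReal_norm (bracket s ξ : ℂ), Complex.norm_of_nonneg hb.le,
      ← ENNReal.ofReal_pow hb.le, two_mul, bracket_add, ← sq (bracket s ξ)]
  simp only [h]
  rw [← eLpNorm_two_sq]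
  exact ENNReal.pow_lt_top (ψ.memLp 2 volume).2

lemma memLp_extension {α : ℝ} (h1 : α < 1) (φ : 𝓢(E n, ℂ)) :
    MemLp (extension φ) 2 (weightedMeasure n α) := by
  obtain ⟨K, hK, h⟩ := exists_lintegral_extension_le (n := n) h1
  refine ⟨(contDiff_extension φ).continuous.aestronglyMeasurable, ?_⟩
  have := (h φ).trans_lt (ENNReal.mul_lt_top ENNReal.ofReal_lt_top
    (lintegral_bracket_fourier_lt_top α φ))
  rw [← eLpNorm_two_sq] at this
  exact (ENNReal.pow_lt_top_iff.1 this).resolve_right two_ne_zero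

lemma memLp_classicalGrad_extension {α : ℝ} (h1 : α < 1) (φ : 𝓢(E n, ℂ)) :
    MemLp (classicalGrad (extension φ)) 2 (weightedMeasure n α) := by
  obtain ⟨K, hK, h⟩ := exists_lintegral_classicalGrad_extension_le (n := n) h1
  refine ⟨(continuous_classicalGrad (contDiff_extension φ)).aestronglyMeasurable, ?_⟩
  have := (h φ).trans_lt (ENNReal.mul_lt_top ENNReal.ofReal_lt_top
    (lintegral_bracket_fourier_lt_top α φ))
  rw [← eLpNorm_two_sq] at this
  exact (ENNReal.pow_lt_top_iff.1 this).resolve_right two_ne_zero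

/-- The extension of a Schwartz function lies in the energy space: it vanishes for large `t`, and
it is cut off in `x`. -/
lemma inEnergySpace_extension (hn : 2 ≤ n) {α : ℝ} (h0 : 0 < α) (h1 : α < 1) (φ : 𝓢(E n, ℂ)) :
    InEnergySpace α (extension φ) (classicalGrad (extension φ)) φ := by
  have hu := memLp_extension h1 φ
  have hG := memLp_classicalGrad_extension h1 φ
  have hsm := contDiff_extension φ
  have hsm1 : Differentiable ℝ (extension φ) := hsm.differentiable (by simp)
  obtain ⟨C, hC0, hC⟩ := exists_norm_fderiv_tangentialCutoff_le n
  set ψ : ℕ → E n × ℝ → ℂ := fun k p => (tangentialCutoff n k p : ℂ) * extension φ p with hψ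
  have hψsm : ∀ k, ContDiff ℝ ∞ (ψ k) := fun k =>
    (Complex.ofRealCLM.contDiff.comp (contDiff_tangentialCutoff n k)).mul hsm
  have hsub : ∀ k, ψ k - extension φ =
      fun p => ((tangentialCutoff n k p - 1 : ℝ) : ℂ) * extension φ p := fun k => by
    funext p; simp only [hψ, Pi.sub_apply]; push_cast; ring
  have hle : ∀ k p, ‖ψ k p - extension φ p‖ ≤ ‖extension φ p‖ := fun k p => by
    rw [← Pi.sub_apply, hsub, norm_mul, Complex.norm_real, Real.norm_eq_abs]
    have := abs_tangentialCutoff_sub_one_le k p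
    nlinarith [norm_nonneg (extension φ p)]
  -- Near each point, the approximating functions are eventually equal to the extension.
  have hev : ∀ p : E n × ℝ, ∀ᶠ k : ℕ in atTop, ψ k - extension φ =ᶠ[𝓝 p] 0 := fun p => by
    filter_upwards [eventually_ge_atTop ⌈‖p.1‖⌉₊] with k hk
    have hk' : ‖p.1‖ < k + 1 := by
      have := Nat.le_ceil ‖p.1‖
      have : ((⌈‖p.1‖⌉₊ : ℕ) : ℝ) ≤ k := by exact_mod_cast hk
      linarith
    have ho : IsOpen {q : E n × ℝ | ‖q.1‖ < k + 1} :=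
      isOpen_lt (by fun_prop) continuous_const
    filter_upwards [ho.mem_nhds hk'] with q (hq : ‖q.1‖ < k + 1)
    rw [hsub]
    change ((tangentialCutoff n k q - 1 : ℝ) : ℂ) * _ = 0
    rw [tangentialCutoff_eq_one hq.le]
    simp
  have hev0 : ∀ p : E n × ℝ, ∀ᶠ k : ℕ in atTop, ψ k p - extension φ p = 0 := fun p => by
    filter_upwards [hev p] with k hk
    exact hk.self_of_nhds
  refine ⟨hu.1, hG, φ.continuous.aestronglyMeasurable, ψ, hψsm, fun k => ?_, ?_, fun R => ?_, ?_⟩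
  · refine HasCompactSupport.intro ((isCompact_closedBall (0 : E n) (2 * (k + 1))).prod
      (isCompact_Icc (a := (-2 : ℝ)) (b := 2))) fun p hp => ?_
    by_cases h : 2 ≤ |p.2|
    · simp only [hψ, extension_eq_zero φ h, mul_zero]
    · have h2 : 2 * ((k : ℝ) + 1) ≤ ‖p.1‖ := by
        by_contra h3
        refine hp ⟨by rw [mem_closedBall_zero_iff]; linarith, ?_⟩
        rw [Set.mem_Icc, ← abs_le]; linarith
      simp only [hψ, tangentialCutoff_eq_zero h2]; simp
  · refine tendsto_eLpNorm_zero_of_dominated two_ne_zero ENNReal.ofNat_ne_top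
      (g := fun p => ‖classicalGrad (extension φ) p‖ + (n + 1) * C * ‖extension φ p‖)
      (fun k => (continuous_classicalGrad (hψsm k)).aestronglyMeasurable.sub hG.1)
      (hG.norm.add (hu.norm.const_mul _)) (fun k p => ?_) fun p => ?_
    · rw [← classicalGrad_sub ((hψsm k).differentiable (by simp)) hsm1, hsub]
      have hd : DifferentiableAt ℝ (fun p => tangentialCutoff n k p - 1) p :=
        (((contDiff_tangentialCutoff n k).differentiable (by simp)) p).sub_const 1
      have hfd : ‖fderiv ℝ (fun p => tangentialCutoff n k p - 1) p‖ ≤ C := by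
        rw [fderiv_sub_const]; exact hC k p
      refine (norm_classicalGrad_mul_le hd (hsm1 p) hfd).trans ?_
      have := abs_tangentialCutoff_sub_one_le k p
      nlinarith [norm_nonneg (classicalGrad (extension φ) p)]
    · filter_upwards [hev p] with k hk
      rw [← classicalGrad_sub ((hψsm k).differentiable (by simp)) hsm1]
      unfold classicalGrad
      rw [hk.fderiv_eq]
      ext i; rcases i with i | i <;> simp
  · exact tendsto_eLpNorm_zero_of_dominated two_ne_zero ENNReal.ofNat_ne_top
      (g := fun p => ‖extension φ p‖)
      (fun k => ((hψsm k).continuous.sub hsm.continuous).aestronglyMeasurable)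
      (hu.norm.mono_measure Measure.restrict_le_self) hle hev0
  · have hp1 := one_le_traceExponent hn h0 h1
    refine tendsto_eLpNorm_zero_of_dominated (one_pos.trans_le hp1).ne' ENNReal.ofReal_ne_top
      (g := fun x => ‖φ x‖) (fun k => ?_) (φ.memLp _ volume).norm (fun k x => ?_) fun x => ?_
    · exact (((hψsm k).continuous.comp (by fun_prop)).sub φ.continuous).aestronglyMeasurable
    · have := hle k (x, 0)
      rwa [extension_zero] at this
    · have := hev0 (x, 0)
      rwa [extension_zero] at this

end ExtensionBounds

section ExtensionLimit

open FourierTransform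
open scoped Real

variable {n : ℕ}

/-- The Bessel potential of order `s` of a Schwartz function. -/
def besselSchwartz (s : ℝ) (ψ : 𝓢(E n, ℂ)) : 𝓢(E n, ℂ) :=
  SchwartzMap.fourierMultiplierCLM ℂ (fun ξ : E n => (bracket s ξ : ℂ)) ψ

lemma fourier_besselSchwartz_apply (s : ℝ) (ψ : 𝓢(E n, ℂ)) (ξ : E n) :
    (𝓕 (besselSchwartz s ψ) : 𝓢(E n, ℂ)) ξ = bracket s ξ * (𝓕 ψ : 𝓢(E n, ℂ)) ξ := by
  rw [besselSchwartz, SchwartzMap.fourierMultiplierCLM_apply, fourier_fourierInv_eq,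
    SchwartzMap.smulLeftCLM_apply_apply (hasTemperateGrowth_bracket s), smul_eq_mul]

lemma besselSchwartz_sub (s : ℝ) (ψ ψ' : 𝓢(E n, ℂ)) :
    besselSchwartz s (ψ - ψ') = besselSchwartz s ψ - besselSchwartz s ψ' := map_sub _ _ _

lemma besselSchwartz_compSubConst (s : ℝ) (ψ : 𝓢(E n, ℂ)) (h : E n) :
    (besselSchwartz s ψ).compSubConstCLM ℂ (-h) = besselSchwartz s (ψ.compSubConstCLM ℂ (-h)) := by
  have : (𝓕 ((besselSchwartz s ψ).compSubConstCLM ℂ (-h)) : 𝓢(E n, ℂ)) =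
      𝓕 (besselSchwartz s (ψ.compSubConstCLM ℂ (-h))) := by
    ext ξ
    rw [fourier_compSubConst_neg_apply, fourier_besselSchwartz_apply, fourier_besselSchwartz_apply,
      fourier_compSubConst_neg_apply]
    ring
  have := congrArg (fun φ : 𝓢(E n, ℂ) => (𝓕⁻ φ : 𝓢(E n, ℂ))) this
  simpa only [fourierInv_fourier_eq] using this

lemma besselPotential_besselSchwartz (s : ℝ) (ψ : 𝓢(E n, ℂ)) :
    besselPotential (E n) ℂ s (((besselSchwartz (-s) ψ).toLp 2 volume : L2 n) : 𝓢'(E n, ℂ)) =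
      ((ψ.toLp 2 volume : L2 n) : 𝓢'(E n, ℂ)) := by
  rw [besselPotential_eq_iff, SchwartzMap.toLp_fourier_eq, SchwartzMap.toLp_fourier_eq]
  filter_upwards [(𝓕 ψ : 𝓢(E n, ℂ)).coeFn_toLp 2 volume,
    (𝓕 (besselSchwartz (-s) ψ) : 𝓢(E n, ℂ)).coeFn_toLp 2 volume] with ξ h1 h2
  have hb : (bracket s ξ : ℂ) ≠ 0 := by exact_mod_cast (bracket_pos s ξ).ne'
  rw [h1, h2, fourier_besselSchwartz_apply, bracket_neg]
  push_cast
  rw [mul_inv_cancel_left₀ hb]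

lemma lintegral_besselSchwartz (s : ℝ) (ψ : 𝓢(E n, ℂ)) :
    ∫⁻ ξ, ENNReal.ofReal (bracket (2 * s) ξ) *
      ‖(𝓕 (besselSchwartz (-s) ψ) : 𝓢(E n, ℂ)) ξ‖ₑ ^ 2 = ‖ψ.toLp 2 volume‖ₑ ^ 2 := by
  rw [Lp.enorm_def, eLpNorm_congr_ae (ψ.coeFn_toLp 2 volume), eLpNorm_two_sq,
    ← lintegral_fourier_eq]
  refine lintegral_congr fun ξ => ?_
  have hb := bracket_pos (-s) ξ
  rw [fourier_besselSchwartz_apply, enorm_mul, mul_pow, ← mul_assoc,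
    ← ofReal_norm (bracket (-s) ξ : ℂ), Complex.norm_of_nonneg hb.le, ← ENNReal.ofReal_pow hb.le,
    ← ENNReal.ofReal_mul (bracket_pos _ _).le, sq (bracket (-s) ξ), ← bracket_add, ← bracket_add]
  have : 2 * s + (-s + -s) = 0 := by ring
  rw [this, bracket_zero, ENNReal.ofReal_one, one_mul]

/-- The square integrable vector fields on the half-space with the weight `t^{1-2α}`. -/
abbrev FieldL2 (n : ℕ) (α : ℝ) : Type :=
  Lp (EuclideanSpace ℂ (Fin n ⊕ Unit)) 2 (weightedMeasure n α)

/-- The tangential shift of vector fields. -/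
def fieldShift (α : ℝ) (h : E n) : FieldL2 n α →ₗᵢ[ℂ] FieldL2 n α :=
  Lp.compMeasurePreservingₗᵢ ℂ (tangentialShift h) (measurePreserving_tangentialShift h α)

lemma coeFn_fieldShift (α : ℝ) (h : E n) (G : FieldL2 n α) :
    fieldShift α h G =ᵐ[weightedMeasure n α] G ∘ tangentialShift h :=
  Lp.coeFn_compMeasurePreserving G (measurePreserving_tangentialShift h α)

/-- The gradient of the extension of `J^{-α} ψ`. -/
def extensionGrad {α : ℝ} (h1 : α < 1) (ψ : 𝓢(E n, ℂ)) : FieldL2 n α :=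
  (memLp_classicalGrad_extension h1 (besselSchwartz (-α) ψ)).toLp _

/-- The extension of `J^{-α} ψ` as a square integrable function. -/
def extensionFun {α : ℝ} (h1 : α < 1) (ψ : 𝓢(E n, ℂ)) : Lp ℂ 2 (weightedMeasure n α) :=
  (memLp_extension h1 (besselSchwartz (-α) ψ)).toLp _

lemma extensionGrad_sub {α : ℝ} (h1 : α < 1) (ψ ψ' : 𝓢(E n, ℂ)) :
    extensionGrad h1 (ψ - ψ') = extensionGrad h1 ψ - extensionGrad h1 ψ' := by
  unfold extensionGrad
  rw [← MemLp.toLp_sub]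
  refine MemLp.toLp_congr _ _ (ae_of_all _ fun p => ?_)
  rw [besselSchwartz_sub, extension_sub, classicalGrad_sub
    ((contDiff_extension _).differentiable (by simp))
    ((contDiff_extension _).differentiable (by simp))]

lemma extensionFun_sub {α : ℝ} (h1 : α < 1) (ψ ψ' : 𝓢(E n, ℂ)) :
    extensionFun h1 (ψ - ψ') = extensionFun h1 ψ - extensionFun h1 ψ' := by
  unfold extensionFun
  rw [← MemLp.toLp_sub]
  refine MemLp.toLp_congr _ _ (ae_of_all _ fun p => ?_)
  rw [besselSchwartz_sub, extension_sub]

lemma fieldShift_extensionGrad {α : ℝ} (h1 : α < 1) (ψ : 𝓢(E n, ℂ)) (h : E n) :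
    fieldShift α h (extensionGrad h1 ψ) = extensionGrad h1 (ψ.compSubConstCLM ℂ (-h)) := by
  apply Lp.ext
  have e1 : (extensionGrad h1 ψ : E n × ℝ → _) ∘ tangentialShift h
      =ᵐ[weightedMeasure n α]
      classicalGrad (extension (besselSchwartz (-α) ψ)) ∘ tangentialShift h :=
    (measurePreserving_tangentialShift h α).quasiMeasurePreserving.ae_eq_comp
      (MemLp.coeFn_toLp _)
  filter_upwards [coeFn_fieldShift α h (extensionGrad h1 ψ), e1, MemLp.coeFn_toLp
    (memLp_classicalGrad_extension h1 (besselSchwartz (-α) (ψ.compSubConstCLM ℂ (-h))))]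
    with p e2 e3 e4
  rw [e2, e3, extensionGrad, e4, ← classicalGrad_comp_tangentialShift,
    extension_comp_tangentialShift, besselSchwartz_compSubConst]

lemma norm_le_of_enorm_sq_le {X Y : Type*} [SeminormedAddCommGroup X] [SeminormedAddCommGroup Y]
    {x : X} {y : Y} {K : ℝ} (h : ‖x‖ₑ ^ 2 ≤ ENNReal.ofReal K * ‖y‖ₑ ^ 2) :
    ‖x‖ ≤ Real.sqrt K * ‖y‖ := by
  rw [← ofReal_norm, ← ofReal_norm, ← ENNReal.ofReal_pow (norm_nonneg _),
    ← ENNReal.ofReal_pow (norm_nonneg _), ← ENNReal.ofReal_mul' (by positivity),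
    ENNReal.ofReal_le_ofReal_iff'] at h
  have h2 : ‖x‖ ^ 2 ≤ Real.sqrt K ^ 2 * ‖y‖ ^ 2 := by
    rcases le_total 0 K with hK | hK
    · rw [Real.sq_sqrt hK]
      rcases h with h | h
      · exact h
      · exact h.trans (by positivity)
    · have : K * ‖y‖ ^ 2 ≤ 0 := mul_nonpos_of_nonpos_of_nonneg hK (by positivity)
      rcases h with h | h <;> nlinarith [mul_nonneg (sq_nonneg (Real.sqrt K)) (sq_nonneg ‖y‖)]
  rw [← mul_pow] at h2
  exact abs_le_of_sq_le_sq' h2 (by positivity) |>.2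

lemma exists_norm_extensionGrad_le {α : ℝ} (h1 : α < 1) :
    ∃ C : ℝ, 0 ≤ C ∧ ∀ ψ : 𝓢(E n, ℂ), ‖extensionGrad h1 ψ‖ ≤ C * ‖ψ.toLp 2 volume‖ := by
  obtain ⟨K, hK, h⟩ := exists_lintegral_classicalGrad_extension_le (n := n) h1
  refine ⟨Real.sqrt K, Real.sqrt_nonneg _, fun ψ => norm_le_of_enorm_sq_le ?_⟩
  have := h (besselSchwartz (-α) ψ)
  rw [lintegral_besselSchwartz, ← eLpNorm_two_sq] at this
  rwa [extensionGrad, Lp.enorm_def, eLpNorm_congr_ae (MemLp.coeFn_toLp _)]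

lemma exists_norm_extensionFun_le {α : ℝ} (h1 : α < 1) :
    ∃ C : ℝ, 0 ≤ C ∧ ∀ ψ : 𝓢(E n, ℂ), ‖extensionFun h1 ψ‖ ≤ C * ‖ψ.toLp 2 volume‖ := by
  obtain ⟨K, hK, h⟩ := exists_lintegral_extension_le (n := n) h1
  refine ⟨Real.sqrt K, Real.sqrt_nonneg _, fun ψ => norm_le_of_enorm_sq_le ?_⟩
  have := h (besselSchwartz (-α) ψ)
  rw [lintegral_besselSchwartz, ← eLpNorm_two_sq] at this
  rwa [extensionFun, Lp.enorm_def, eLpNorm_congr_ae (MemLp.coeFn_toLp _)]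

lemma cauchySeq_of_norm_sub_le {X Y : Type*} [SeminormedAddCommGroup X] [SeminormedAddCommGroup Y]
    {x : ℕ → X} {y : ℕ → Y} {C : ℝ} (hx : CauchySeq x)
    (h : ∀ j k, ‖y j - y k‖ ≤ C * ‖x j - x k‖) : CauchySeq y := by
  rw [Metric.cauchySeq_iff] at hx ⊢
  intro ε hε
  obtain ⟨N, hN⟩ := hx (ε / (|C| + 1)) (by positivity)
  refine ⟨N, fun j hj k hk => ?_⟩
  have h1 := hN j hj k hk
  rw [dist_eq_norm] at h1 ⊢
  rw [lt_div_iff₀ (by positivity)] at h1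
  refine (h j k).trans_lt (lt_of_le_of_lt ?_ h1)
  nlinarith [norm_nonneg (x j - x k), le_abs_self C]

lemma toLp_sub (ψ ψ' : 𝓢(E n, ℂ)) :
    (ψ - ψ').toLp 2 volume = ψ.toLp 2 volume - (ψ'.toLp 2 volume : L2 n) :=
  (SchwartzMap.toLpCLM ℂ ℂ 2 volume).map_sub ψ ψ'

lemma shift_toLp (ψ : 𝓢(E n, ℂ)) (h : E n) :
    shift h (ψ.toLp 2 volume) = (ψ.compSubConstCLM ℂ (-h)).toLp 2 volume := by
  apply Lp.ext
  filter_upwards [coeFn_shift h (ψ.toLp 2 volume),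
    (measurePreserving_add_right (volume : Measure (E n)) h).quasiMeasurePreserving.ae_eq_comp
      (ψ.coeFn_toLp 2 volume), (ψ.compSubConstCLM ℂ (-h)).coeFn_toLp 2 volume] with x e1 e2 e3
  rw [e1, e3, SchwartzMap.compSubConstCLM_apply, sub_neg_eq_add]
  exact e2

/-- Every `f ∈ H^α` is the trace of a function in the energy space, whose gradient is controlled by
`J^α f`, together with its tangential differences. -/
theorem exists_extension (hn : 2 ≤ n) {α : ℝ} (h0 : 0 < α) (h1 : α < 1) :
    ∃ C : ℝ, 0 ≤ C ∧ ∀ f F : L2 n,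
      besselPotential (E n) ℂ α (f : 𝓢'(E n, ℂ)) = (F : 𝓢'(E n, ℂ)) →
      ∃ (u : E n × ℝ → ℂ) (G : FieldL2 n α), InEnergySpace α u G f ∧ ‖G‖ ≤ C * ‖F‖ ∧
        ∀ h : E n, ‖fieldShift α h G - G‖ ≤ C * ‖shift h F - F‖ := by
  obtain ⟨C, hC0, hC⟩ := exists_norm_extensionGrad_le (n := n) h1
  obtain ⟨C', hC0', hC'⟩ := exists_norm_extensionFun_le (n := n) h1
  obtain ⟨D, hD0, hD⟩ := exists_eLpNorm_traceExponent_le hn h0 h1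
  refine ⟨C, hC0, fun f F hF => ?_⟩
  have hp := one_le_traceExponent hn h0 h1
  have hdense : DenseRange fun ψ : 𝓢(E n, ℂ) => (ψ.toLp 2 volume : L2 n) :=
    SchwartzMap.denseRange_toLpCLM (p := 2) ENNReal.ofNat_ne_top
  obtain ⟨y, hy, hyF⟩ := mem_closure_iff_seq_limit.1 (hdense F)
  choose ψ hψ using hy
  have hψF : Tendsto (fun k => ((ψ k).toLp 2 volume : L2 n)) atTop (𝓝 F) := by
    simpa only [hψ] using hyF
  obtain ⟨G, hG⟩ := cauchySeq_tendsto_of_complete (cauchySeq_of_norm_sub_le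
    (y := fun k => extensionGrad h1 (ψ k)) hψF.cauchySeq fun j k => by
      rw [← extensionGrad_sub, ← toLp_sub]; exact hC _)
  obtain ⟨U, hU⟩ := cauchySeq_tendsto_of_complete (cauchySeq_of_norm_sub_le
    (y := fun k => extensionFun h1 (ψ k)) hψF.cauchySeq fun j k => by
      rw [← extensionFun_sub, ← toLp_sub]; exact hC' _)
  refine ⟨U, G, ?_, ?_, fun h => ?_⟩
  · refine inEnergySpace_of_tendsto hp
      (us := fun k => extension (besselSchwartz (-α) (ψ k)))
      (Gs := fun k => classicalGrad (extension (besselSchwartz (-α) (ψ k))))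
      (vs := fun k => besselSchwartz (-α) (ψ k))
      (fun k => inEnergySpace_extension hn h0 h1 _) (Lp.aestronglyMeasurable U) (Lp.memLp G)
      (Lp.aestronglyMeasurable f) ?_ (fun R => ?_) ?_
    · have := tendsto_iff_edist_tendsto_0.1 hG
      refine this.congr fun k => ?_
      rw [Lp.edist_def]
      refine eLpNorm_congr_ae ?_
      filter_upwards [MemLp.coeFn_toLp
        (memLp_classicalGrad_extension h1 (besselSchwartz (-α) (ψ k)))] with p hp
      rw [Pi.sub_apply, Pi.sub_apply, extensionGrad, hp]
    · have := tendsto_iff_edist_tendsto_0.1 hU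
      refine tendsto_of_tendsto_of_tendsto_of_le_of_le tendsto_const_nhds this
        (fun _ => zero_le) fun k => ?_
      rw [Lp.edist_def]
      refine (eLpNorm_mono_measure _ Measure.restrict_le_self).trans (eLpNorm_congr_ae ?_).le
      filter_upwards [MemLp.coeFn_toLp (memLp_extension h1 (besselSchwartz (-α) (ψ k)))] with p hp
      rw [Pi.sub_apply, Pi.sub_apply, extensionFun, hp]
    · have h3 : Tendsto (fun k => ENNReal.ofReal D * ‖(ψ k).toLp 2 volume - F‖ₑ) atTop (𝓝 0) := by
        have := tendsto_iff_edist_tendsto_0.1 hψF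
        simp only [edist_eq_enorm_sub] at this
        simpa using ENNReal.Tendsto.const_mul this (Or.inr (ENNReal.ofReal_ne_top (r := D)))
      refine tendsto_of_tendsto_of_tendsto_of_le_of_le tendsto_const_nhds h3
        (fun _ => zero_le) fun k => ?_
      refine le_trans (eLpNorm_congr_ae ?_).le (hD _ _
        (besselPotential_coe_sub (besselPotential_besselSchwartz α (ψ k)) hF))
      filter_upwards [(besselSchwartz (-α) (ψ k)).coeFn_toLp 2 volume,
        Lp.coeFn_sub ((besselSchwartz (-α) (ψ k)).toLp 2 volume) f] with x e1 e2
      rw [e2, Pi.sub_apply, Pi.sub_apply, e1]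
  · exact le_of_tendsto_of_tendsto' hG.norm (hψF.norm.const_mul C) fun k => hC _
  · refine le_of_tendsto_of_tendsto'
      ((((fieldShift α h).continuous.tendsto G).comp hG).sub hG).norm
      ((((((shift h).continuous.tendsto F).comp hψF).sub hψF).norm).const_mul C) fun k => ?_
    simp only [Function.comp_apply]
    rw [fieldShift_extensionGrad, ← extensionGrad_sub, shift_toLp, ← toLp_sub]
    exact hC _

end ExtensionLimit

/-! ### Multiplication by Schwartz functions on Sobolev spaces -/

section Multiplier

open FourierTransform
open scoped Real

variable {n : ℕ}

/-- Young's inequality for the convolution of an `L¹` function with an `L²` function. -/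
lemma lintegral_sq_convolution_le {k w : E n → ℝ≥0∞} (hk : Measurable k) (hw : Measurable w) :
    ∫⁻ ξ, (∫⁻ z, k z * w (ξ - z)) ^ 2 ≤ (∫⁻ z, k z) ^ 2 * ∫⁻ ξ, w ξ ^ 2 := by
  have h1 : ∀ ξ, (∫⁻ z, k z * w (ξ - z)) ^ 2 ≤ (∫⁻ z, k z) * ∫⁻ z, k z * w (ξ - z) ^ 2 := by
    intro ξ
    have hH := ENNReal.lintegral_mul_le_Lp_mul_Lq (volume : Measure (E n))
      Real.HolderConjugate.two_two (f := fun z => k z ^ (1 / 2 : ℝ))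
      (g := fun z => k z ^ (1 / 2 : ℝ) * w (ξ - z)) (hk.pow_const _).aemeasurable
      ((hk.pow_const _).mul (hw.comp (measurable_const.sub measurable_id))).aemeasurable
    have e1 : ∀ x : ℝ≥0∞, x ^ (1 / 2 : ℝ) * x ^ (1 / 2 : ℝ) = x := fun x => by
      rw [← ENNReal.rpow_add_of_nonneg _ _ (by norm_num) (by norm_num)]; norm_num
    have e2 : ∀ x : ℝ≥0∞, (x ^ (1 / 2 : ℝ)) ^ 2 = x := fun x => by rw [sq, e1]
    simp only [Pi.mul_apply, ← mul_assoc, e1, ENNReal.rpow_two, mul_pow, e2] at hH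
    calc _ ≤ ((∫⁻ z, k z) ^ (1 / 2 : ℝ) * (∫⁻ z, k z * w (ξ - z) ^ 2) ^ (1 / 2 : ℝ)) ^ 2 := by
          gcongr
      _ = _ := by rw [mul_pow, e2, e2]
  calc ∫⁻ ξ, (∫⁻ z, k z * w (ξ - z)) ^ 2
      ≤ ∫⁻ ξ, (∫⁻ z, k z) * ∫⁻ z, k z * w (ξ - z) ^ 2 := lintegral_mono h1
    _ = (∫⁻ z, k z) * ∫⁻ ξ, ∫⁻ z, k z * w (ξ - z) ^ 2 := by
        refine lintegral_const_mul _ ?_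
        exact Measurable.lintegral_prod_right' (f := fun q : E n × E n => k q.2 * w (q.1 - q.2) ^ 2)
          (by fun_prop)
    _ = (∫⁻ z, k z) * ∫⁻ z, ∫⁻ ξ, k z * w (ξ - z) ^ 2 := by
        rw [lintegral_lintegral_swap]
        exact (by fun_prop : Measurable fun q : E n × E n => k q.2 * w (q.1 - q.2) ^ 2).aemeasurable
    _ = (∫⁻ z, k z) * ∫⁻ z, k z * ∫⁻ ξ, w ξ ^ 2 := by
        congr 1
        refine lintegral_congr fun z => ?_
        rw [lintegral_const_mul _ (by fun_prop), lintegral_sub_right_eq_self (fun ξ => w ξ ^ 2) z]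
    _ = _ := by rw [lintegral_mul_const _ hk]; ring

/-- Peetre's inequality. -/
lemma bracket_le_mul (s : ℝ) (ξ ζ : E n) :
    bracket s ξ ≤ 2 ^ (|s| / 2) * bracket |s| (ξ - ζ) * bracket s ζ := by
  have h0 : ∀ ξ ζ : E n, 1 + ‖ξ‖ ^ 2 ≤ 2 * (1 + ‖ξ - ζ‖ ^ 2) * (1 + ‖ζ‖ ^ 2) := fun ξ ζ => by
    have : ‖ξ‖ ≤ ‖ξ - ζ‖ + ‖ζ‖ := by simpa using norm_add_le (ξ - ζ) ζ
    nlinarith [norm_nonneg ξ, norm_nonneg (ξ - ζ), norm_nonneg ζ, sq_nonneg (‖ξ - ζ‖ - ‖ζ‖),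
      mul_nonneg (sq_nonneg ‖ξ - ζ‖) (sq_nonneg ‖ζ‖)]
  have h1 : ∀ (r : ℝ), 0 ≤ r → ∀ ξ ζ : E n,
      bracket r ξ ≤ 2 ^ (r / 2) * bracket r (ξ - ζ) * bracket r ζ := fun r hr ξ ζ => by
    unfold bracket
    rw [← Real.mul_rpow (by norm_num) (by positivity), ← Real.mul_rpow (by positivity)
      (by positivity)]
    exact Real.rpow_le_rpow (by positivity) (h0 ξ ζ) (by positivity)
  rcases le_total 0 s with hs | hs
  · rw [abs_of_nonneg hs]; exact h1 s hs ξ ζ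
  · rw [abs_of_nonpos hs]
    have h2 := h1 (-s) (by linarith) ζ ξ
    have h3 : bracket (-s) (ζ - ξ) = bracket (-s) (ξ - ζ) := by
      unfold bracket; rw [norm_sub_rev]
    rw [h3, bracket_neg s ζ, bracket_neg s ξ] at h2
    have p1 := bracket_pos s ξ
    have p2 := bracket_pos s ζ
    calc bracket s ξ = (bracket s ζ)⁻¹ * (bracket s ζ * bracket s ξ) := by field_simp
      _ ≤ (2 ^ (-s / 2) * bracket (-s) (ξ - ζ) * (bracket s ξ)⁻¹) *
          (bracket s ζ * bracket s ξ) := by gcongr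
      _ = _ := by field_simp

lemma fourierInv_apply_eq (φ : 𝓢(E n, ℂ)) (ξ : E n) :
    (𝓕⁻ φ : 𝓢(E n, ℂ)) ξ = (𝓕 φ : 𝓢(E n, ℂ)) (-ξ) := by
  rw [SchwartzMap.fourier_coe, SchwartzMap.fourierInv_coe, Real.fourierInv_eq_fourier_neg]

lemma fourierInv_besselSchwartz_apply (s : ℝ) (ψ : 𝓢(E n, ℂ)) (ξ : E n) :
    (𝓕⁻ (besselSchwartz s ψ) : 𝓢(E n, ℂ)) ξ = bracket s ξ * (𝓕⁻ ψ : 𝓢(E n, ℂ)) ξ := by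
  rw [fourierInv_apply_eq, fourierInv_apply_eq, fourier_besselSchwartz_apply]
  simp [bracket]

lemma enorm_toLp_sq (φ : 𝓢(E n, ℂ)) :
    ‖φ.toLp 2 volume‖ₑ ^ 2 = ∫⁻ ξ, ‖(𝓕⁻ φ : 𝓢(E n, ℂ)) ξ‖ₑ ^ 2 := by
  rw [Lp.enorm_def, eLpNorm_congr_ae (φ.coeFn_toLp 2 volume), eLpNorm_two_sq,
    ← lintegral_fourier_eq (𝓕⁻ φ), fourier_fourierInv_eq]

/-- The product of two Schwartz functions. -/
def schwartzMul (p φ : 𝓢(E n, ℂ)) : 𝓢(E n, ℂ) := SchwartzMap.smulLeftCLM ℂ p φ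

lemma schwartzMul_apply (p φ : 𝓢(E n, ℂ)) (x : E n) : schwartzMul p φ x = p x * φ x := by
  rw [schwartzMul, SchwartzMap.smulLeftCLM_apply_apply p.hasTemperateGrowth, smul_eq_mul]

lemma fourierInv_schwartzMul_apply (p φ : 𝓢(E n, ℂ)) (ξ : E n) :
    (𝓕⁻ (schwartzMul p φ) : 𝓢(E n, ℂ)) ξ =
      ∫ z, (𝓕⁻ p : 𝓢(E n, ℂ)) z * (𝓕⁻ φ : 𝓢(E n, ℂ)) (ξ - z) := by
  have h : schwartzMul p φ =
      𝓕 (SchwartzMap.convolution (ContinuousLinearMap.mul ℂ ℂ) (𝓕⁻ p) (𝓕⁻ φ)) := by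
    rw [SchwartzMap.fourier_convolution, fourier_fourierInv_eq, fourier_fourierInv_eq]
    ext x
    rw [schwartzMul_apply]
    rfl
  rw [h, fourierInv_fourier_eq, SchwartzMap.convolution_apply]
  rfl

/-- Conjugating the multiplication by a Schwartz function with a Bessel potential gives a bounded
operator on `L²`: on the Fourier side it is an integral operator whose kernel is dominated by an
integrable convolution kernel, thanks to Peetre's inequality. -/
lemma exists_norm_besselSchwartz_schwartzMul_le (s : ℝ) (p : 𝓢(E n, ℂ)) :
    ∃ C : ℝ, 0 ≤ C ∧ ∀ ψ : 𝓢(E n, ℂ),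
      ‖(besselSchwartz s (schwartzMul p (besselSchwartz (-s) ψ))).toLp 2 volume‖ ≤
        C * ‖ψ.toLp 2 volume‖ := by
  set q : 𝓢(E n, ℂ) :=
    SchwartzMap.smulLeftCLM ℂ (fun ξ : E n => (bracket |s| ξ : ℂ)) (𝓕⁻ p) with hq
  have hqa : ∀ z, ‖q z‖ₑ = ENNReal.ofReal (bracket |s| z) * ‖(𝓕⁻ p : 𝓢(E n, ℂ)) z‖ₑ := fun z => by
    rw [hq, SchwartzMap.smulLeftCLM_apply_apply (hasTemperateGrowth_bracket _), smul_eq_mul,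
      enorm_mul, ← ofReal_norm (bracket |s| z : ℂ), Complex.norm_of_nonneg (bracket_pos _ _).le]
  have hqi : ∫⁻ z, ‖q z‖ₑ ≠ ⊤ := q.integrable.2.ne
  set c : ℝ := 2 ^ (|s| / 2) with hc
  set A : ℝ := (∫⁻ z, ‖q z‖ₑ).toReal with hA
  refine ⟨Real.sqrt ((c * A) ^ 2), Real.sqrt_nonneg _, fun ψ => norm_le_of_enorm_sq_le ?_⟩
  have hpt : ∀ ξ, ‖(𝓕⁻ (besselSchwartz s (schwartzMul p (besselSchwartz (-s) ψ))) :
      𝓢(E n, ℂ)) ξ‖ₑ ≤ ∫⁻ z, (ENNReal.ofReal c * ‖q z‖ₑ) * ‖(𝓕⁻ ψ : 𝓢(E n, ℂ)) (ξ - z)‖ₑ := by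
    intro ξ
    rw [fourierInv_besselSchwartz_apply, fourierInv_schwartzMul_apply, enorm_mul,
      ← ofReal_norm (bracket s ξ : ℂ), Complex.norm_of_nonneg (bracket_pos _ _).le]
    calc _ ≤ ENNReal.ofReal (bracket s ξ) * ∫⁻ z, ‖(𝓕⁻ p : 𝓢(E n, ℂ)) z *
          (𝓕⁻ (besselSchwartz (-s) ψ) : 𝓢(E n, ℂ)) (ξ - z)‖ₑ := by
          gcongr; exact enorm_integral_le_lintegral_enorm _
      _ = ∫⁻ z, ENNReal.ofReal (bracket s ξ) * ‖(𝓕⁻ p : 𝓢(E n, ℂ)) z *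
          (𝓕⁻ (besselSchwartz (-s) ψ) : 𝓢(E n, ℂ)) (ξ - z)‖ₑ :=
          (lintegral_const_mul' _ _ ENNReal.ofReal_ne_top).symm
      _ ≤ _ := by
          refine lintegral_mono fun z => ?_
          have hb := bracket_le_mul s ξ (ξ - z)
          rw [sub_sub_cancel] at hb
          have b1 := bracket_pos s (ξ - z)
          rw [fourierInv_besselSchwartz_apply, enorm_mul, enorm_mul, hqa,
            ← ofReal_norm (bracket (-s) (ξ - z) : ℂ), Complex.norm_of_nonneg (bracket_pos _ _).le,
            bracket_neg]
          calc _ ≤ ENNReal.ofReal (c * bracket |s| z * bracket s (ξ - z)) *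
                (‖(𝓕⁻ p : 𝓢(E n, ℂ)) z‖ₑ * (ENNReal.ofReal (bracket s (ξ - z))⁻¹ *
                  ‖(𝓕⁻ ψ : 𝓢(E n, ℂ)) (ξ - z)‖ₑ)) := by gcongr
            _ = (ENNReal.ofReal (c * bracket |s| z) * (ENNReal.ofReal (bracket s (ξ - z)) *
                ENNReal.ofReal (bracket s (ξ - z))⁻¹)) * (‖(𝓕⁻ p : 𝓢(E n, ℂ)) z‖ₑ *
                  ‖(𝓕⁻ ψ : 𝓢(E n, ℂ)) (ξ - z)‖ₑ) := by
                rw [ENNReal.ofReal_mul (q := bracket s (ξ - z))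
                  (mul_nonneg (by positivity) (bracket_pos _ _).le)]
                ring
            _ = _ := by
                rw [← ENNReal.ofReal_mul b1.le, mul_inv_cancel₀ b1.ne', ENNReal.ofReal_one, mul_one,
                  ENNReal.ofReal_mul (by positivity)]
                ring
  rw [enorm_toLp_sq, enorm_toLp_sq]
  calc _ ≤ ∫⁻ ξ, (∫⁻ z, (ENNReal.ofReal c * ‖q z‖ₑ) * ‖(𝓕⁻ ψ : 𝓢(E n, ℂ)) (ξ - z)‖ₑ) ^ 2 :=
        lintegral_mono fun ξ => pow_le_pow_left' (hpt ξ) 2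
    _ ≤ _ := lintegral_sq_convolution_le (k := fun z => ENNReal.ofReal c * ‖q z‖ₑ)
        (w := fun z => ‖(𝓕⁻ ψ : 𝓢(E n, ℂ)) z‖ₑ) (q.continuous.measurable.enorm.const_mul _)
        (𝓕⁻ ψ : 𝓢(E n, ℂ)).continuous.measurable.enorm
    _ = _ := by
        rw [lintegral_const_mul _ q.continuous.measurable.enorm,
          ENNReal.ofReal_pow (by positivity), ENNReal.ofReal_mul (by positivity), hA,
          ENNReal.ofReal_toReal hqi]

lemma besselPotential_coe_schwartz (s : ℝ) (φ : 𝓢(E n, ℂ)) :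
    besselPotential (E n) ℂ s (φ : 𝓢'(E n, ℂ)) = (besselSchwartz s φ : 𝓢'(E n, ℂ)) :=
  fourierMultiplierCLM_toTemperedDistributionCLM_eq (hasTemperateGrowth_bracket s) φ

lemma smulLeftCLM_coe_schwartz (p φ : 𝓢(E n, ℂ)) :
    smulLeftCLM ℂ p (φ : 𝓢'(E n, ℂ)) = (schwartzMul p φ : 𝓢'(E n, ℂ)) := by
  ext u
  rw [smulLeftCLM_apply_apply, SchwartzMap.coe_apply, SchwartzMap.coe_apply]
  refine integral_congr_ae (ae_of_all _ fun x => ?_)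
  simp only [schwartzMul_apply, SchwartzMap.smulLeftCLM_apply_apply p.hasTemperateGrowth,
    smul_eq_mul]
  ring

lemma besselSchwartz_schwartzMul_sub (s : ℝ) (ψ ψ' : 𝓢(E n, ℂ)) (p : 𝓢(E n, ℂ)) :
    besselSchwartz s (schwartzMul p (besselSchwartz (-s) (ψ - ψ'))) =
      besselSchwartz s (schwartzMul p (besselSchwartz (-s) ψ)) -
        besselSchwartz s (schwartzMul p (besselSchwartz (-s) ψ')) := by
  rw [besselSchwartz_sub, schwartzMul, map_sub, besselSchwartz_sub]
  rfl

/-- Multiplication by a Schwartz function preserves Sobolev regularity of any real order. -/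
theorem memSobolev_smulLeftCLM_schwartz {s : ℝ} (p : 𝓢(E n, ℂ)) {f : 𝓢'(E n, ℂ)}
    (hf : MemSobolev s 2 f) : MemSobolev s 2 (smulLeftCLM ℂ p f) := by
  obtain ⟨F, hF⟩ := hf
  obtain ⟨C, hC0, hC⟩ := exists_norm_besselSchwartz_schwartzMul_le s p
  have hdense : DenseRange fun ψ : 𝓢(E n, ℂ) => (ψ.toLp 2 volume : L2 n) :=
    SchwartzMap.denseRange_toLpCLM (p := 2) ENNReal.ofNat_ne_top
  obtain ⟨y, hy, hyF⟩ := mem_closure_iff_seq_limit.1 (hdense F)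
  choose ψ hψ using hy
  have hψF : Tendsto (fun k => ((ψ k).toLp 2 volume : L2 n)) atTop (𝓝 F) := by
    simpa only [hψ] using hyF
  obtain ⟨H, hH⟩ := cauchySeq_tendsto_of_complete (cauchySeq_of_norm_sub_le
    (y := fun k => ((besselSchwartz s (schwartzMul p (besselSchwartz (-s) (ψ k)))).toLp 2 volume :
      L2 n)) hψF.cauchySeq fun j k => by
      rw [← toLp_sub, ← toLp_sub, ← besselSchwartz_schwartzMul_sub]; exact hC _)
  refine ⟨H, ?_⟩
  have hT := (Lp.toTemperedDistributionCLM ℂ (volume : Measure (E n)) 2).continuous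
  let L : 𝓢'(E n, ℂ) →L[ℂ] 𝓢'(E n, ℂ) :=
    besselPotential (E n) ℂ s ∘L smulLeftCLM ℂ p ∘L besselPotential (E n) ℂ (-s)
  have e0 : f = besselPotential (E n) ℂ (-s) (F : 𝓢'(E n, ℂ)) := by
    rw [← hF, besselPotential_besselPotential_apply]; simp
  have e1 : besselPotential (E n) ℂ s (smulLeftCLM ℂ p f) = L (F : 𝓢'(E n, ℂ)) := by
    rw [e0]; rfl
  have e2 : ∀ k, L (((ψ k).toLp 2 volume : L2 n) : 𝓢'(E n, ℂ)) =
      (((besselSchwartz s (schwartzMul p (besselSchwartz (-s) (ψ k)))).toLp 2 volume : L2 n) :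
        𝓢'(E n, ℂ)) := fun k => by
    rw [Lp.toTemperedDistribution_toLp_eq, Lp.toTemperedDistribution_toLp_eq,
      ← besselPotential_coe_schwartz, ← smulLeftCLM_coe_schwartz, ← besselPotential_coe_schwartz]
    rfl
  have t1 := ((L.continuous.comp hT).tendsto F).comp hψF
  have t2 := (hT.tendsto H).comp hH
  rw [e1]
  refine tendsto_nhds_unique t1 (t2.congr fun k => ?_)
  exact (e2 k).symm

end Multiplier

/-! ### The coefficients -/

section Metric

variable {n : ℕ}

lemma contDiff_det {ι : Type*} [Fintype ι] [DecidableEq ι] {A : E n → Matrix ι ι ℝ}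
    (hA : ∀ i j, ContDiff ℝ ∞ fun x => A x i j) : ContDiff ℝ ∞ fun x => (A x).det := by
  simp only [Matrix.det_apply']
  exact ContDiff.sum fun σ _ => contDiff_const.mul (contDiff_prod fun i _ => hA _ _)

lemma contDiff_adjugate {ι : Type*} [Fintype ι] [DecidableEq ι] {A : E n → Matrix ι ι ℝ}
    (hA : ∀ i j, ContDiff ℝ ∞ fun x => A x i j) (i j : ι) :
    ContDiff ℝ ∞ fun x => (A x).adjugate i j := by
  simp only [Matrix.adjugate_apply]
  refine contDiff_det fun k l => ?_
  simp only [Matrix.updateRow_apply]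
  split_ifs
  · exact contDiff_const
  · exact hA k l

/-- A smooth function that is constant near infinity is bounded and Lipschitz. -/
lemma exists_bound_of_eq_const {f : E n → ℝ} (hf : ContDiff ℝ ∞ f) {R c : ℝ}
    (h : ∀ x, R < ‖x‖ → f x = c) :
    ∃ C, 0 ≤ C ∧ (∀ x, |f x| ≤ C) ∧ ∀ x y, |f x - f y| ≤ C * ‖x - y‖ := by
  have hs : HasCompactSupport fun x => f x - c :=
    HasCompactSupport.intro (isCompact_closedBall (0 : E n) R) fun x hx => by
      rw [h x (by simpa using hx), sub_self]
  have hd : ContDiff ℝ ∞ fun x => f x - c := hf.sub contDiff_const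
  obtain ⟨B, hB⟩ := hd.continuous.bounded_above_of_compact_support hs
  obtain ⟨K, hK⟩ := hd.lipschitzWith_of_hasCompactSupport hs (by simp)
  have hB0 : 0 ≤ B := (norm_nonneg _).trans (hB 0)
  refine ⟨B + |c| + K, by positivity, fun x => ?_, fun x y => ?_⟩
  · have := hB x
    rw [Real.norm_eq_abs] at this
    have h2 := abs_sub_abs_le_abs_sub (f x) c
    linarith [K.2, (K : ℝ≥0).coe_nonneg]
  · have := hK.dist_le_mul x y
    rw [Real.dist_eq, dist_eq_norm] at this
    calc |f x - f y| = |f x - c - (f y - c)| := by ring_nf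
      _ ≤ K * ‖x - y‖ := this
      _ ≤ _ := by gcongr; linarith [abs_nonneg c]

namespace IsAdmissibleMetric

variable {g : E n → Matrix (Fin n) (Fin n) ℝ}

lemma posDef (hg : IsAdmissibleMetric g) (x : E n) : (g x).PosDef := by
  obtain ⟨lam, hl, h⟩ := hg.elliptic
  refine Matrix.PosDef.of_dotProduct_mulVec_pos ?_ fun ξ hξ => ?_
  · rw [Matrix.IsHermitian, Matrix.conjTranspose_eq_transpose_of_trivial]
    exact hg.symm x
  · have h1 : 0 < ξ ⬝ᵥ ξ := by
      have := Matrix.dotProduct_star_self_pos_iff.2 hξ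
      simpa using this
    simpa using (mul_pos hl h1).trans_le (h x ξ).1

lemma sqrtDet_pos (hg : IsAdmissibleMetric g) (x : E n) : 0 < sqrtDet g x :=
  Real.sqrt_pos.2 (hg.posDef x).det_pos

lemma contDiff_sqrtDet (hg : IsAdmissibleMetric g) : ContDiff ℝ ∞ (sqrtDet g) :=
  (contDiff_det hg.smooth).sqrt fun x => (hg.posDef x).det_pos.ne'

lemma exists_eq_one (hg : IsAdmissibleMetric g) : ∃ R : ℝ, ∀ x, R < ‖x‖ → g x = 1 := by
  obtain ⟨U, -, hU, h⟩ := hg.euclidean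
  obtain ⟨R, hR⟩ := hU.closure.exists_norm_le
  exact ⟨R, fun x hx => h x fun hx' => absurd (hR x hx') (not_le.2 hx)⟩

lemma contDiff_gTilde (hg : IsAdmissibleMetric g) (k l : Fin n ⊕ Unit) :
    ContDiff ℝ ∞ fun x => gTilde g x k l := by
  have hinv : ∀ i j, ContDiff ℝ ∞ fun x => (g x)⁻¹ i j := fun i j => by
    have : (fun x => (g x)⁻¹ i j) = fun x => ((g x).det)⁻¹ * (g x).adjugate i j := by
      funext x
      rw [Matrix.inv_def, Matrix.smul_apply, Ring.inverse_eq_inv', smul_eq_mul]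
    rw [this]
    exact ((contDiff_det hg.smooth).inv fun x => (hg.posDef x).det_pos.ne').mul
      (contDiff_adjugate hg.smooth i j)
  simp only [gTilde, Matrix.smul_apply, smul_eq_mul]
  refine hg.contDiff_sqrtDet.mul ?_
  rcases k with i | i <;> rcases l with j | j
  · simpa using hinv i j
  all_goals simpa using contDiff_const

lemma gTilde_isSymm (hg : IsAdmissibleMetric g) (x : E n) : (gTilde g x).IsSymm := by
  have : ((g x)⁻¹).IsSymm := by
    rw [Matrix.IsSymm, Matrix.transpose_nonsing_inv, hg.symm x]
  refine Matrix.IsSymm.smul ?_ _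
  exact this.fromBlocks (by simp) Matrix.isSymm_one

lemma gTilde_eq_one {x : E n} (h : g x = 1) : gTilde g x = 1 := by
  simp [gTilde, sqrtDet, h, Matrix.fromBlocks_one]

lemma exists_le_quadratic (hg : IsAdmissibleMetric g) :
    ∃ c : ℝ, 0 < c ∧ ∀ x (v : Fin n ⊕ Unit → ℝ), c * (v ⬝ᵥ v) ≤ v ⬝ᵥ (gTilde g x *ᵥ v) := by
  obtain ⟨lam, hl, h⟩ := hg.elliptic
  obtain ⟨R, hR⟩ := hg.exists_eq_one
  obtain ⟨B, hB0, hB, -⟩ := exists_bound_of_eq_const (f := fun x => (sqrtDet g x)⁻¹)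
    (hg.contDiff_sqrtDet.inv fun x => (hg.sqrtDet_pos x).ne') (R := R) (c := 1)
    fun x hx => by simp [sqrtDet, hR x hx]
  have hlow : ∀ x, (B + 1)⁻¹ ≤ sqrtDet g x := fun x => by
    rw [inv_le_comm₀ (by positivity) (hg.sqrtDet_pos x)]
    linarith [(le_abs_self _).trans (hB x)]
  -- With `η = g⁻¹ ξ` this is the expansion of `0 ≤ (η - λ ξ) · g (η - λ ξ)`.
  have hinv : ∀ x (ξ : Fin n → ℝ), lam * (ξ ⬝ᵥ ξ) ≤ ξ ⬝ᵥ ((g x)⁻¹ *ᵥ ξ) := fun x ξ => by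
    set η := (g x)⁻¹ *ᵥ ξ with hη
    have e1 : g x *ᵥ η = ξ := by
      rw [hη, Matrix.mulVec_mulVec, Matrix.mul_nonsing_inv _ (hg.posDef x).det_pos.ne'.isUnit,
        Matrix.one_mulVec]
    have e2 : η ⬝ᵥ (g x *ᵥ ξ) = ξ ⬝ᵥ ξ := by
      rw [Matrix.dotProduct_mulVec, ← Matrix.mulVec_transpose, hg.symm x, e1]
    have h1 := (h x (η - lam • ξ)).1
    have h2 : 0 ≤ (η - lam • ξ) ⬝ᵥ (η - lam • ξ) :=
      Finset.sum_nonneg fun i _ => mul_self_nonneg _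
    have h3 := (h x ξ).2
    have h4 : (η - lam • ξ) ⬝ᵥ (g x *ᵥ (η - lam • ξ)) =
        ξ ⬝ᵥ η - 2 * lam * (ξ ⬝ᵥ ξ) + lam ^ 2 * (ξ ⬝ᵥ (g x *ᵥ ξ)) := by
      rw [Matrix.mulVec_sub, Matrix.mulVec_smul, e1, sub_dotProduct, dotProduct_sub,
        dotProduct_sub, smul_dotProduct, smul_dotProduct, dotProduct_smul, dotProduct_smul, e2,
        dotProduct_comm η ξ]
      simp only [smul_eq_mul]
      ring
    have h5 : lam ^ 2 * (ξ ⬝ᵥ (g x *ᵥ ξ)) ≤ lam * (ξ ⬝ᵥ ξ) := by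
      calc _ ≤ lam ^ 2 * (lam⁻¹ * (ξ ⬝ᵥ ξ)) := by gcongr
        _ = _ := by field_simp
    nlinarith [mul_nonneg hl.le h2]
  refine ⟨(B + 1)⁻¹ * min lam 1, by positivity, fun x v => ?_⟩
  have hs0 : ∀ {ι : Type} [Fintype ι] (w : ι → ℝ), 0 ≤ w ⬝ᵥ w := fun w =>
    Finset.sum_nonneg fun i _ => mul_self_nonneg _
  have e : v ⬝ᵥ (gTilde g x *ᵥ v) = sqrtDet g x *
      ((v ∘ Sum.inl) ⬝ᵥ ((g x)⁻¹ *ᵥ (v ∘ Sum.inl)) + (v ∘ Sum.inr) ⬝ᵥ (v ∘ Sum.inr)) := by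
    rw [gTilde, Matrix.smul_mulVec, dotProduct_smul, Matrix.fromBlocks_mulVec, smul_eq_mul]
    simp [dotProduct, Fintype.sum_sum_type]
  have e' : v ⬝ᵥ v = (v ∘ Sum.inl) ⬝ᵥ (v ∘ Sum.inl) + (v ∘ Sum.inr) ⬝ᵥ (v ∘ Sum.inr) := by
    simp [dotProduct, Fintype.sum_sum_type]
  rw [e, e', mul_assoc]
  have h1 := hs0 (v ∘ Sum.inl)
  have h2 := hs0 (v ∘ Sum.inr)
  refine mul_le_mul (hlow x) ?_ (by positivity) (hg.sqrtDet_pos x).le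
  have h3 := hinv x (v ∘ Sum.inl)
  have h4 : min lam 1 * ((v ∘ Sum.inl) ⬝ᵥ (v ∘ Sum.inl)) ≤
      lam * ((v ∘ Sum.inl) ⬝ᵥ (v ∘ Sum.inl)) := by gcongr; exact min_le_left _ _
  have h5 : min lam 1 * ((v ∘ Sum.inr) ⬝ᵥ (v ∘ Sum.inr)) ≤
      1 * ((v ∘ Sum.inr) ⬝ᵥ (v ∘ Sum.inr)) := by gcongr; exact min_le_right _ _
  linarith

end IsAdmissibleMetric

/-- A real matrix, acting on complex vectors. -/
def complexOp {ι : Type*} [Fintype ι] [DecidableEq ι] (S : Matrix ι ι ℝ) :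
    EuclideanSpace ℂ ι →L[ℂ] EuclideanSpace ℂ ι :=
  Matrix.toEuclideanCLM (𝕜 := ℂ) (S.map (fun r : ℝ => (r : ℂ)))

section ComplexOp

variable {ι : Type*} [Fintype ι] [DecidableEq ι]

lemma complexOp_apply (S : Matrix ι ι ℝ) (v : EuclideanSpace ℂ ι) (k : ι) :
    complexOp S v k = ∑ l, (S k l : ℂ) * v l := by
  rw [complexOp, Matrix.ofLp_toEuclideanCLM]
  rfl

lemma complexOp_sub (S S' : Matrix ι ι ℝ) (v : EuclideanSpace ℂ ι) :
    complexOp (S - S') v = complexOp S v - complexOp S' v := by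
  ext k
  simp [complexOp_apply, sub_mul, Finset.sum_sub_distrib]

lemma norm_complexOp_le {S : Matrix ι ι ℝ} {c : ℝ} (hc : 0 ≤ c) (hS : ∀ k l, |S k l| ≤ c) :
    ‖complexOp S‖ ≤ Fintype.card ι * (Fintype.card ι * c) := by
  refine ContinuousLinearMap.opNorm_le_bound _ (by positivity) fun v => ?_
  have h1 : ∀ y : EuclideanSpace ℂ ι, ‖y‖ ≤ ∑ k, ‖y k‖ := fun y => by
    rw [EuclideanSpace.norm_eq]
    refine Real.sqrt_le_iff.2 ⟨by positivity, ?_⟩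
    exact Finset.sum_sq_le_sq_sum_of_nonneg fun i _ => norm_nonneg _
  calc ‖complexOp S v‖ ≤ ∑ k, ‖complexOp S v k‖ := h1 _
    _ ≤ ∑ k : ι, ∑ l : ι, c * ‖v‖ := by
        gcongr with k _
        rw [complexOp_apply]
        refine (norm_sum_le _ _).trans ?_
        gcongr with l _
        rw [norm_mul, Complex.norm_real]
        gcongr
        · exact hS k l
        · exact PiLp.norm_apply_le v l
    _ = _ := by simp; ring

lemma inner_complexOp (S : Matrix ι ι ℝ) (v w : EuclideanSpace ℂ ι) :
    inner ℂ v (complexOp S w) = ∑ k, ∑ l, (S k l : ℂ) * w l * starRingEnd ℂ (v k) := by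
  simp only [PiLp.inner_apply, complexOp_apply, RCLike.inner_apply, Finset.sum_mul]

lemma inner_complexOp_comm {S : Matrix ι ι ℝ} (hS : S.IsSymm) (v w : EuclideanSpace ℂ ι) :
    inner ℂ (complexOp S v) w = inner ℂ v (complexOp S w) := by
  rw [← inner_conj_symm, inner_complexOp, inner_complexOp, map_sum, Finset.sum_comm]
  rw [Finset.sum_comm]
  simp only [map_sum, map_mul, Complex.conj_ofReal, Complex.conj_conj]
  rw [Finset.sum_comm]
  refine Finset.sum_congr rfl fun k _ => Finset.sum_congr rfl fun l _ => ?_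
  rw [← hS.apply k l]
  ring

lemma le_re_inner_complexOp {S : Matrix ι ι ℝ} {c : ℝ}
    (hS : ∀ v : ι → ℝ, c * (v ⬝ᵥ v) ≤ v ⬝ᵥ (S *ᵥ v)) (v : EuclideanSpace ℂ ι) :
    c * ‖v‖ ^ 2 ≤ (inner ℂ v (complexOp S v)).re := by
  have h1 := hS fun k => (v k).re
  have h2 := hS fun k => (v k).im
  have e1 : ‖v‖ ^ 2 = (fun k => (v k).re) ⬝ᵥ (fun k => (v k).re) +
      (fun k => (v k).im) ⬝ᵥ (fun k => (v k).im) := by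
    rw [EuclideanSpace.norm_sq_eq]
    simp only [dotProduct, ← Finset.sum_add_distrib, Complex.sq_norm, Complex.normSq_apply]
  have e2 : (inner ℂ v (complexOp S v)).re =
      (fun k => (v k).re) ⬝ᵥ (S *ᵥ fun k => (v k).re) +
      (fun k => (v k).im) ⬝ᵥ (S *ᵥ fun k => (v k).im) := by
    rw [inner_complexOp]
    simp only [dotProduct, Matrix.mulVec, ← Finset.sum_add_distrib, Complex.re_sum, Finset.mul_sum]
    refine Finset.sum_congr rfl fun k _ => Finset.sum_congr rfl fun l _ => ?_
    simp
    ring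
  rw [e1, e2, mul_add]
  exact add_le_add h1 h2

end ComplexOp

/-- The operator field `g̃` is bounded, Lipschitz, and uniformly coercive. -/
lemma IsAdmissibleMetric.exists_complexOp_bounds {g : E n → Matrix (Fin n) (Fin n) ℝ}
    (hg : IsAdmissibleMetric g) :
    ∃ lam m : ℝ, 0 < lam ∧ 0 ≤ m ∧ (∀ x, ‖complexOp (gTilde g x)‖ ≤ m) ∧
      (∀ x y v, ‖complexOp (gTilde g x) v - complexOp (gTilde g y) v‖ ≤ m * ‖x - y‖ * ‖v‖) ∧
      ∀ x v, lam * ‖v‖ ^ 2 ≤ (inner ℂ v (complexOp (gTilde g x) v)).re := by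
  obtain ⟨lam, hl, hlam⟩ := hg.exists_le_quadratic
  obtain ⟨R, hR⟩ := hg.exists_eq_one
  have := fun k l => exists_bound_of_eq_const (hg.contDiff_gTilde k l) (R := R)
    (c := (1 : Matrix (Fin n ⊕ Unit) (Fin n ⊕ Unit) ℝ) k l)
    fun x hx => by rw [gTilde_eq_one (hR x hx)]
  choose C hC0 hC1 hC2 using this
  set B := ∑ k, ∑ l, C k l with hB
  have hle : ∀ k l, C k l ≤ B := fun k l =>
    (Finset.single_le_sum (f := fun l => C k l) (fun l _ => hC0 k l) (Finset.mem_univ l)).trans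
      (Finset.single_le_sum (f := fun k => ∑ l, C k l)
        (fun k _ => Finset.sum_nonneg fun l _ => hC0 k l) (Finset.mem_univ k))
  have hB0 : 0 ≤ B := Finset.sum_nonneg fun k _ => Finset.sum_nonneg fun l _ => hC0 k l
  refine ⟨lam, Fintype.card (Fin n ⊕ Unit) * (Fintype.card (Fin n ⊕ Unit) * B), hl, by positivity,
    fun x => norm_complexOp_le hB0 fun k l => (hC1 k l x).trans (hle k l), fun x y v => ?_,
    fun x v => le_re_inner_complexOp (hlam x) v⟩
  rw [← complexOp_sub]
  refine (ContinuousLinearMap.le_opNorm _ _).trans ?_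
  gcongr
  refine (norm_complexOp_le (c := B * ‖x - y‖) (by positivity) fun k l => ?_).trans_eq (by ring)
  refine (hC2 k l x y).trans ?_
  gcongr
  exact hle k l

end Metric

section Coefficients

variable {n : ℕ} {g : E n → Matrix (Fin n) (Fin n) ℝ}

/-- Multiplication by `g̃` on square integrable fields. It almost commutes with small shifts, since
`g̃` is Lipschitz. -/
lemma IsAdmissibleMetric.exists_coefficientOp (hg : IsAdmissibleMetric g) (α : ℝ) :
    ∃ (lam m : ℝ) (M : FieldL2 n α →L[ℂ] FieldL2 n α), 0 < lam ∧ 0 ≤ m ∧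
      (∀ G, M G =ᵐ[weightedMeasure n α] fun p => complexOp (gTilde g p.1) (G p)) ∧ ‖M‖ ≤ m ∧
      (∀ G H, inner ℂ (M G) H = inner ℂ G (M H)) ∧
      (∀ G, lam * ‖G‖ ^ 2 ≤ (inner ℂ G (M G)).re) ∧
      ∀ h G, ‖M (fieldShift α h G) - fieldShift α h (M G)‖ ≤ m * ‖h‖ * ‖G‖ := by
  obtain ⟨lam, m, hlam, hm, hb, hL, hcoer⟩ := hg.exists_complexOp_bounds
  have hcont : Continuous fun x => complexOp (gTilde g x) := by
    refine (LipschitzWith.of_dist_le_mul (K := ⟨m, hm⟩) fun x y => ?_).continuous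
    rw [dist_eq_norm, dist_eq_norm]
    refine ContinuousLinearMap.opNorm_le_bound _ (by positivity) fun v => ?_
    exact hL x y v
  have hmem : ∀ G : FieldL2 n α, MemLp (fun p => complexOp (gTilde g p.1) (G p)) 2
      (weightedMeasure n α) := fun G => by
    refine MemLp.of_le_mul (c := m) (Lp.memLp G) ?_ (ae_of_all _ fun p => ?_)
    · exact isBoundedBilinearMap_apply.continuous.comp_aestronglyMeasurable
        ((hcont.comp continuous_fst).aestronglyMeasurable.prodMk (Lp.aestronglyMeasurable G))
    · exact (ContinuousLinearMap.le_opNorm _ _).trans (by gcongr; exact hb _)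
  have hspec := fun G => (hmem G).coeFn_toLp
  let M₀ : FieldL2 n α →ₗ[ℂ] FieldL2 n α :=
    { toFun := fun G => (hmem G).toLp _
      map_add' := fun G H => by
        apply Lp.ext
        filter_upwards [hspec (G + H), hspec G, hspec H, Lp.coeFn_add G H,
          Lp.coeFn_add ((hmem G).toLp _) ((hmem H).toLp _)] with p h1 h2 h3 h4 h5
        rw [h1, h5, Pi.add_apply, h2, h3, h4, Pi.add_apply, map_add]
      map_smul' := fun c G => by
        apply Lp.ext
        filter_upwards [hspec (c • G), hspec G, Lp.coeFn_smul c G,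
          Lp.coeFn_smul c ((hmem G).toLp _)] with p h1 h2 h3 h4
        rw [h1, RingHom.id_apply, h4, Pi.smul_apply, h2, h3, Pi.smul_apply, map_smul] }
  let M : FieldL2 n α →L[ℂ] FieldL2 n α := M₀.mkContinuous m fun G => by
    refine Lp.norm_le_mul_norm_of_ae_le_mul ?_
    filter_upwards [hspec G] with p hp
    exact (congrArg norm hp).trans_le
      ((ContinuousLinearMap.le_opNorm _ _).trans (by gcongr; exact hb _))
  have hM : ∀ G, M G =ᵐ[weightedMeasure n α] fun p => complexOp (gTilde g p.1) (G p) := hspec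
  refine ⟨lam, m, M, hlam, hm, hM, M₀.mkContinuous_norm_le hm _, fun G H => ?_, fun G => ?_,
    fun h G => ?_⟩
  · rw [L2.inner_def, L2.inner_def]
    refine integral_congr_ae ?_
    filter_upwards [hM G, hM H] with p h1 h2
    rw [h1, h2]
    exact inner_complexOp_comm (hg.gTilde_isSymm p.1) _ _
  · have e : ‖G‖ ^ 2 = ∫ p, ‖G p‖ ^ 2 ∂weightedMeasure n α := by
      have := L2.inner_def (𝕜 := ℂ) G G
      rw [inner_self_eq_norm_sq_to_K] at this
      have h2 := congrArg Complex.re this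
      rw [← RCLike.re_eq_complex_re, ← integral_re (L2.integrable_inner G G)] at h2
      simp only [inner_self_eq_norm_sq] at h2
      rw [← h2]
      norm_cast
    have hi : Integrable (fun p => ‖G p‖ ^ 2) (weightedMeasure n α) :=
      (Lp.memLp G).integrable_norm_pow (by norm_num)
    rw [L2.inner_def, ← RCLike.re_eq_complex_re, ← integral_re (L2.integrable_inner G (M G)), e,
      ← integral_const_mul]
    refine integral_mono_ae (hi.const_mul _) (L2.integrable_inner G (M G)).re ?_
    filter_upwards [hM G] with p hp
    rw [hp]
    exact hcoer _ _
  · refine Lp.norm_le_mul_norm_of_ae_le_mul (g := fieldShift α h G) ?_ |>.trans_eq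
      (by rw [LinearIsometry.norm_map])
    have mp := (measurePreserving_tangentialShift h α (n := n)).quasiMeasurePreserving
    filter_upwards [Lp.coeFn_sub (M (fieldShift α h G)) (fieldShift α h (M G)),
      hM (fieldShift α h G), coeFn_fieldShift α h (M G), coeFn_fieldShift α h G,
      mp.ae (hM G)] with p h1 h2 h3 h4 h5
    rw [h1, Pi.sub_apply, h2, h3, Function.comp_apply, h5, h4, Function.comp_apply]
    refine (hL _ _ _).trans_eq ?_
    have : p.1 - (tangentialShift h p).1 = -h := by simp [tangentialShift]
    rw [this, norm_neg]

lemma energyForm_conjField {α : ℝ} {M : FieldL2 n α →L[ℂ] FieldL2 n α}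
    (hM : ∀ G, M G =ᵐ[weightedMeasure n α] fun p => complexOp (gTilde g p.1) (G p))
    {G D : Field n} {G' D' : FieldL2 n α} (hG : G' =ᵐ[weightedMeasure n α] G)
    (hD : D' =ᵐ[weightedMeasure n α] D) :
    energyForm α g G (conjField D) = inner ℂ D' (M G') := by
  rw [energyForm, L2.inner_def]
  refine integral_congr_ae ?_
  filter_upwards [hM G', hG, hD] with p h1 h2 h3
  rw [h1, inner_complexOp, h2, h3]
  rfl

/-- Multiplication by the volume density preserves Sobolev spaces of all orders. -/
lemma IsAdmissibleMetric.memSobolev_smulLeftCLM_sqrtDet (hg : IsAdmissibleMetric g) {s : ℝ}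
    {f : 𝓢'(E n, ℂ)} (hf : MemSobolev s 2 f) :
    MemSobolev s 2 (smulLeftCLM ℂ (fun x => (sqrtDet g x : ℂ)) f) := by
  obtain ⟨R, hR⟩ := hg.exists_eq_one
  have hs : HasCompactSupport fun x => ((sqrtDet g x - 1 : ℝ) : ℂ) :=
    HasCompactSupport.intro (isCompact_closedBall (0 : E n) R) fun x hx => by
      have : g x = 1 := hR x (by simpa using hx)
      simp [sqrtDet, this]
  have hd : ContDiff ℝ ∞ fun x => ((sqrtDet g x - 1 : ℝ) : ℂ) :=
    Complex.ofRealCLM.contDiff.comp (hg.contDiff_sqrtDet.sub contDiff_const)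
  set q : 𝓢(E n, ℂ) := hs.toSchwartzMap hd with hq
  have e : (fun x => (sqrtDet g x : ℂ)) = (fun _ => (1 : ℂ)) + (q : E n → ℂ) := by
    funext x
    simp [hq]
  have h1 : (fun _ : E n => (1 : ℂ)).HasTemperateGrowth := Function.HasTemperateGrowth.const 1
  rw [e, smulLeftCLM_add h1 q.hasTemperateGrowth, add_apply,
    smulLeftCLM_const, one_smul]
  exact hf.add (memSobolev_smulLeftCLM_schwartz q hf)

end Coefficients

/-! ### The shift problem of a weak solution -/

section Assembly

open FourierTransform
open scoped Real

variable {n : ℕ}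

lemma exists_besselPotential_of_le {a b : ℝ} (hab : a ≤ b) {u : 𝓢'(E n, ℂ)} {F : L2 n}
    (h : besselPotential (E n) ℂ b u = (F : 𝓢'(E n, ℂ))) :
    ∃ F' : L2 n, besselPotential (E n) ℂ a u = (F' : 𝓢'(E n, ℂ)) ∧ ‖F'‖ ≤ ‖F‖ := by
  have hle : ∀ ξ, ‖(bracket (a - b) ξ : ℂ) * (𝓕 F : L2 n) ξ‖ ≤ 1 * ‖(𝓕 F : L2 n) ξ‖ := fun ξ => by
    rw [norm_mul, Complex.norm_of_nonneg (bracket_pos _ ξ).le]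
    gcongr
    rw [← bracket_zero ξ]
    exact bracket_le (by linarith) ξ
  have hm : MemLp (fun ξ => (bracket (a - b) ξ : ℂ) * (𝓕 F : L2 n) ξ) 2 volume :=
    (Lp.memLp (𝓕 F : L2 n)).of_le_mul
      ((Complex.continuous_ofReal.comp (continuous_bracket _)).aestronglyMeasurable.mul
        (Lp.aestronglyMeasurable _)) (ae_of_all _ hle)
  obtain ⟨F', hF', -⟩ := exists_besselPotential_eq hm
  refine ⟨F', ?_, ?_⟩
  · rw [← hF', ← h, besselPotential_besselPotential_apply]
    congr 2
    ring
  · rw [← one_mul ‖F‖]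
    apply norm_le_of_fourier_le
    rw [besselPotential_eq_iff] at hF'
    filter_upwards [hF'] with ξ hξ
    rw [hξ]
    exact hle ξ

lemma norm_le_of_besselPotential {s : ℝ} (hs : 0 ≤ s) {w W : L2 n}
    (h : besselPotential (E n) ℂ s (w : 𝓢'(E n, ℂ)) = (W : 𝓢'(E n, ℂ))) : ‖w‖ ≤ ‖W‖ := by
  obtain ⟨F, hF, hle⟩ := exists_besselPotential_of_le hs h
  have : w = F := coe_injective (by simpa using hF)
  rwa [this]

lemma besselPotential_coe_add {s : ℝ} {f F f' F' : L2 n}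
    (hF : besselPotential (E n) ℂ s (f : 𝓢'(E n, ℂ)) = (F : 𝓢'(E n, ℂ)))
    (hF' : besselPotential (E n) ℂ s (f' : 𝓢'(E n, ℂ)) = (F' : 𝓢'(E n, ℂ))) :
    besselPotential (E n) ℂ s ((f + f' : L2 n) : 𝓢'(E n, ℂ)) = ((F + F' : L2 n) : 𝓢'(E n, ℂ)) := by
  have h := fun a b : L2 n =>
    (Lp.toTemperedDistributionCLM ℂ (volume : Measure (E n)) 2).map_add a b
  simp only [Lp.toTemperedDistributionCLM_apply] at h
  rw [h, h, map_add, hF, hF']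

lemma shift_shift (h k : E n) (f : L2 n) : shift h (shift k f) = shift (h + k) f := by
  apply Lp.ext
  filter_upwards [coeFn_shift h (shift k f), coeFn_shift (h + k) f,
    (measurePreserving_add_right (volume : Measure (E n)) h).quasiMeasurePreserving.ae
      (coeFn_shift k f)] with x h1 h2 h3
  rw [h1, h2, h3, add_assoc]

lemma fieldShift_fieldShift {α : ℝ} (h k : E n) (G : FieldL2 n α) :
    fieldShift α h (fieldShift α k G) = fieldShift α (h + k) G := by
  apply Lp.ext
  filter_upwards [coeFn_fieldShift α h (fieldShift α k G), coeFn_fieldShift α (h + k) G,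
    (measurePreserving_tangentialShift h α).quasiMeasurePreserving.ae
      (coeFn_fieldShift α k G)] with p h1 h2 h3
  rw [h1, h2, Function.comp_apply, h3]
  simp [tangentialShift, add_assoc]

lemma add_dyadicStep_mem_posHalfSpace {x : E n} (hx : x ∈ posHalfSpace n) (i : Fin n) (j : ℕ) :
    x + dyadicStep i j ∈ posHalfSpace n := fun k hk => by
  have h1 := hx k hk
  have h2 : 0 ≤ dyadicStep i j k := by
    rw [dyadicStep, PiLp.single_apply]
    split_ifs
    exacts [(scale_pos j).le, le_rfl]
  rw [PiLp.add_apply]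
  linarith

variable {g : E n → Matrix (Fin n) (Fin n) ℝ} {α : ℝ}

/-- The weak formulation in terms of Hilbert space inner products. -/
lemma IsWeakSolution.inner_eq {fD v : L2 n} {fN : 𝓢'(E n, ℂ)} {u : E n × ℝ → ℂ} {G : Field n}
    (hs : IsWeakSolution α g fD fN u G v) {M : FieldL2 n α →L[ℂ] FieldL2 n α}
    (hM : ∀ G, M G =ᵐ[weightedMeasure n α] fun p => complexOp (gTilde g p.1) (G p))
    {G' : FieldL2 n α} (hG : G' =ᵐ[weightedMeasure n α] G) {N : L2 n}
    (hN : besselPotential (E n) ℂ (-α) (smulLeftCLM ℂ (fun x => (sqrtDet g x : ℂ)) fN) =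
      (N : 𝓢'(E n, ℂ)))
    {φ : E n × ℝ → ℂ} {D : Field n} {D' : FieldL2 n α} (hD : D' =ᵐ[weightedMeasure n α] D)
    {w W : L2 n} (hφ : InEnergySpace α φ D w)
    (hW : besselPotential (E n) ℂ α (w : 𝓢'(E n, ℂ)) = (W : 𝓢'(E n, ℂ)))
    (hw : ∀ᵐ x : E n, x ∈ posHalfSpace n → w x = 0) :
    inner ℂ D' (M G') = - inner ℂ W N := by
  rw [← energyForm_conjField hM hG hD, hs.weak (star φ) (conjField D) (star w)
    (hφ.star.congr_trace (Lp.coeFn_star w).symm) ⟨_, besselPotential_star hW⟩, sobolevPairing,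
    besselRep_of_eq hN, besselRep_of_eq (besselPotential_star hW), L2.inner_def]
  · congr 1
    refine integral_congr_ae ?_
    filter_upwards [Lp.coeFn_star W] with x hx
    rw [hx, RCLike.inner_apply]
    rfl
  · filter_upwards [hw, Lp.coeFn_star w] with x h1 h2 hx
    rw [h2, Pi.star_apply, h1 hx, star_zero]

/-- Subtracting an extension of the Dirichlet datum from a weak solution yields an abstract shift
problem in each tangential coordinate direction, with constants independent of the solution. The
shifts go into `ℝⁿ₊`, so that they preserve the space of test functions. -/
theorem exists_isShiftProblem (hn : 2 ≤ n) (h0 : 0 < α) (h1 : α < 1) (hg : IsAdmissibleMetric g)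
    {δ : ℝ} (hδ0 : 0 ≤ δ) (hδ1 : δ ≤ 1) :
    ∃ lam L m c : ℝ, 0 < lam ∧ 0 ≤ L ∧ 0 ≤ m ∧ 0 ≤ c ∧
      ∀ (fD v : L2 n) (fN : 𝓢'(E n, ℂ)) (u : E n × ℝ → ℂ) (G : Field n) (FD V W N : L2 n),
        besselPotential (E n) ℂ (α + δ) (fD : 𝓢'(E n, ℂ)) = (FD : 𝓢'(E n, ℂ)) →
        besselPotential (E n) ℂ (-α + δ) (smulLeftCLM ℂ (fun x => (sqrtDet g x : ℂ)) fN) =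
          (N : 𝓢'(E n, ℂ)) →
        besselPotential (E n) ℂ α (v : 𝓢'(E n, ℂ)) = (V : 𝓢'(E n, ℂ)) →
        besselPotential (E n) ℂ α ((v - fD : L2 n) : 𝓢'(E n, ℂ)) = (W : 𝓢'(E n, ℂ)) →
        IsWeakSolution α g fD fN u G v →
        ∀ i, ∃ M U F N₀, IsShiftProblem lam L m c δ (fun j => fieldShift α (dyadicStep i j))
          (fun j => shift (dyadicStep i j)) M U F W N₀ (‖FD‖ + ‖N‖ + ‖V‖) := by
  obtain ⟨lam, m, M, hlam, hm, hM, hMm, hsymm, hcoer, hcomm⟩ := hg.exists_coefficientOp α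
  obtain ⟨A, hA0, hA⟩ := exists_extension hn h0 h1
  obtain ⟨B, hB0, hB⟩ := exists_norm_shift_sub_le h0
  have hp := one_le_traceExponent hn h0 h1
  set κ := Real.sqrt (2 / α) with hκ
  set c := B * κ + B + 1 + A + 4 * π + A * (4 * π) with hc
  have hκ0 : 0 ≤ κ := Real.sqrt_nonneg _
  have c0 : 0 ≤ c := by positivity
  have hBκ : 0 ≤ B * κ := by positivity
  have hAπ : 0 ≤ A * (4 * π) := by positivity
  have hπ : 0 ≤ 4 * π := by positivity
  refine ⟨lam, m, m, c, hlam, hm, hm, c0, fun fD v fN u G FD V W N hFD hN hV hW hs i => ?_⟩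
  obtain ⟨FD₀, hFD₀, hFD₀le⟩ := exists_besselPotential_of_le (by linarith : α ≤ α + δ) hFD
  obtain ⟨N₀, hN₀, hN₀le⟩ := exists_besselPotential_of_le (by linarith : -α ≤ -α + δ) hN
  obtain ⟨uF, F, hF, hFle, hFshift⟩ := hA fD FD₀ hFD₀
  set w : L2 n := v - fD with hw
  set T := ‖FD‖ + ‖N‖ + ‖V‖ with hT
  have tFD : ‖FD‖ ≤ T := by linarith [norm_nonneg N, norm_nonneg V]
  have tN : ‖N‖ ≤ T := by linarith [norm_nonneg FD, norm_nonneg V]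
  have hT0 : 0 ≤ T := by positivity
  have hWT : ‖W‖ ≤ T := by
    have : W = V - FD₀ :=
      coe_injective (hW.symm.trans (besselPotential_coe_sub hV hFD₀))
    rw [this]
    refine (norm_sub_le _ _).trans ?_
    linarith [norm_nonneg N]
  have hwT : ‖w‖ ≤ T := (norm_le_of_besselPotential h0.le hW).trans hWT
  set G' : FieldL2 n α := hs.mem.memLp_grad.toLp G with hG'
  have hGG : G' =ᵐ[weightedMeasure n α] G := MemLp.coeFn_toLp _
  set U : FieldL2 n α := G' - F with hU
  set D : Field n := G - (F : Field n) with hD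
  have hUD : U =ᵐ[weightedMeasure n α] D := by
    filter_upwards [hGG, Lp.coeFn_sub G' F] with p e1 e2
    rw [e2, Pi.sub_apply, e1, hD, Pi.sub_apply]
  have hφ : InEnergySpace α (u - uF) D w :=
    (hs.mem.sub hp hF).congr_trace (Lp.coeFn_sub v fD).symm
  have hw0 : ∀ᵐ x : E n, x ∈ posHalfSpace n → w x = 0 := by
    filter_upwards [hs.dirichlet, Lp.coeFn_sub v fD] with x e1 e2 hx
    rw [e2, Pi.sub_apply, e1 hx, sub_self]
  have hMG : M G' = M U + M F := by rw [← map_add, hU, sub_add_cancel]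
  have hφs : ∀ h : E n, InEnergySpace α ((u - uF) ∘ tangentialShift h - (u - uF))
      (D ∘ tangentialShift h - D) ((shift h w - w : L2 n) : E n → ℂ) := fun h => by
    refine ((hφ.comp_tangentialShift h).sub hp hφ).congr_trace ?_
    filter_upwards [Lp.coeFn_sub (shift h w) w, coeFn_shift h w] with x e1 e2
    rw [e1, Pi.sub_apply, Pi.sub_apply, e2]
  have hUs : ∀ h : E n, (fieldShift α h U - U : FieldL2 n α) =ᵐ[weightedMeasure n α]
      D ∘ tangentialShift h - D := fun h => by
    filter_upwards [Lp.coeFn_sub (fieldShift α h U) U, coeFn_fieldShift α h U, hUD,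
      (measurePreserving_tangentialShift h α).quasiMeasurePreserving.ae hUD] with p e1 e2 e3 e4
    rw [e1, Pi.sub_apply, e2, Pi.sub_apply, Function.comp_apply, e3, e4]
    rfl
  have hWs : ∀ h : E n, besselPotential (E n) ℂ α ((shift h w - w : L2 n) : 𝓢'(E n, ℂ)) =
      ((shift h W - W : L2 n) : 𝓢'(E n, ℂ)) := fun h =>
    besselPotential_coe_sub (besselPotential_shift hW h) hW
  refine ⟨M, U, F, N₀, ?_⟩
  constructor
  · intro j G
    rw [fieldShift_fieldShift, ← dyadicStep_eq]
  · intro j f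
    rw [shift_shift, ← dyadicStep_eq]
  · exact hsymm
  · exact hcoer
  · exact hMm
  · intro j G
    refine (hcomm (dyadicStep i j) G).trans_eq ?_
    rw [norm_dyadicStep]
  · have := hs.inner_eq hM hGG hN₀ hUD hφ hW hw0
    rw [hMG, inner_add_right] at this
    exact eq_sub_of_add_eq this
  · intro j
    have := hs.inner_eq hM hGG hN₀ (hUs (dyadicStep i j)) (hφs _) (hWs _) (by
      filter_upwards [hw0, Lp.coeFn_sub (shift (dyadicStep i j) w) w,
        coeFn_shift (dyadicStep i j) w,
        (measurePreserving_add_right (volume : Measure (E n))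
          (dyadicStep i j)).quasiMeasurePreserving.ae hw0] with x e1 e2 e3 e4 hx
      rw [e2, Pi.sub_apply, e3, e1 hx, e4 (add_dyadicStep_mem_posHalfSpace hx i j), sub_zero])
    rw [hMG, inner_add_right] at this
    exact eq_sub_of_add_eq this
  · intro j
    set h := dyadicStep i j with hh
    have e1 := hB w W hW h
    have e2 := (hφs h).norm_trace_le hn h0 h1 (hWs h)
    rw [← eLpNorm_congr_ae (hUs h), ← Lp.norm_def] at e2
    have e3 : shift h (W - w) - (W - w) = shift h W - W - (shift h w - w) := by
      rw [map_sub]; abel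
    rw [e3] at e1
    have hn' : ‖h‖ = scale j := norm_dyadicStep i j
    have hsc := (scale_pos j).le
    rw [hn'] at e1
    calc _ ≤ B * (‖shift h W - W - (shift h w - w)‖ + scale j * ‖w‖) := e1
      _ ≤ B * (κ * ‖fieldShift α h U - U‖ + scale j * T) := by gcongr
      _ = B * κ * ‖fieldShift α h U - U‖ + B * (scale j * T) := by ring
      _ ≤ c * ‖fieldShift α h U - U‖ + c * (scale j * T) := by gcongr <;> linarith
      _ = _ := by ring
  · calc ‖W‖ ≤ 1 * T := by linarith
      _ ≤ c * T := by gcongr; linarith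
  · calc ‖N₀‖ ≤ 1 * T := by linarith
      _ ≤ c * T := by gcongr; linarith
  · calc ‖F‖ ≤ A * ‖FD₀‖ := hFle
      _ ≤ c * T := by gcongr <;> linarith
  · intro j
    have e := norm_shift_sub_le hδ0 hδ1 (r := δ) (f := N₀) (F := N)
      (by simpa only [show -α + δ - -α = δ by ring] using besselPotential_sub hN₀ hN)
      (dyadicStep i j)
    rw [norm_dyadicStep] at e
    have hsc := (scale_pos j).le
    calc _ ≤ 4 * π * scale j ^ δ * ‖N‖ := e
      _ = 4 * π * ‖N‖ * scale j ^ δ := by ring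
      _ ≤ _ := by gcongr; linarith
  · intro j
    have e := norm_shift_sub_le hδ0 hδ1 (r := δ) (f := FD₀) (F := FD)
      (by simpa only [show α + δ - α = δ by ring] using besselPotential_sub hFD₀ hFD)
      (dyadicStep i j)
    rw [norm_dyadicStep] at e
    have hsc := (scale_pos j).le
    calc _ ≤ A * ‖shift (dyadicStep i j) FD₀ - FD₀‖ := hFshift _
      _ ≤ A * (4 * π * scale j ^ δ * ‖FD‖) := by gcongr
      _ = A * (4 * π) * ‖FD‖ * scale j ^ δ := by ring
      _ ≤ _ := by gcongr; linarith

end Assembly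

/-! ### The regularity estimate -/

section Conclusion

open FourierTransform
open scoped Real

variable {n : ℕ}

/-- The Bessel potential of `v - f_D` is bounded in `H^{δ-ε}(ℝⁿ)`. -/
theorem exists_besselPotential_dirichlet_sub (hn : 2 ≤ n) {α : ℝ} (h0 : 0 < α) (h1 : α < 1)
    {g : E n → Matrix (Fin n) (Fin n) ℝ} (hg : IsAdmissibleMetric g) {δ ε : ℝ} (hδ : δ < 1 / 2)
    (hε0 : 0 < ε) (hεδ : ε < δ) :
    ∃ C : ℝ, 0 ≤ C ∧
      ∀ (fD v : L2 n) (fN : 𝓢'(E n, ℂ)) (u : E n × ℝ → ℂ) (G : Field n) (FD V N : L2 n),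
        besselPotential (E n) ℂ (α + δ) (fD : 𝓢'(E n, ℂ)) = (FD : 𝓢'(E n, ℂ)) →
        besselPotential (E n) ℂ (-α + δ) (smulLeftCLM ℂ (fun x => (sqrtDet g x : ℂ)) fN) =
          (N : 𝓢'(E n, ℂ)) →
        besselPotential (E n) ℂ α (v : 𝓢'(E n, ℂ)) = (V : 𝓢'(E n, ℂ)) →
        IsWeakSolution α g fD fN u G v →
        ∃ R : L2 n, besselPotential (E n) ℂ (α + δ - ε) ((v - fD : L2 n) : 𝓢'(E n, ℂ)) =
          (R : 𝓢'(E n, ℂ)) ∧ ‖R‖ ≤ C * (‖FD‖ + ‖N‖ + ‖V‖) := by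
  obtain ⟨lam, L, m, c, hlam, hL, hm, hc, hprob⟩ :=
    exists_isShiftProblem hn h0 h1 hg (by linarith : 0 ≤ δ) (by linarith)
  obtain ⟨C₁, hC₁, hreg⟩ := IsShiftProblem.exists_regularity (FieldL2 n α) (L2 n) hlam hL hm hc
    (by linarith : 0 < δ) hδ (s := δ - ε / 2) (by linarith)
  obtain ⟨C₂, hC₂, hbr⟩ := exists_eLpNorm_bracket_le n (r := δ - ε) (s := δ - ε / 2)
    (by linarith) (by linarith)
  refine ⟨C₂ * (C₁ + c), by positivity, fun fD v fN u G FD V N hFD hN hV hs => ?_⟩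
  obtain ⟨FD₀, hFD₀, -⟩ := exists_besselPotential_of_le (by linarith : α ≤ α + δ) hFD
  have hW := besselPotential_coe_sub hV hFD₀
  set W := V - FD₀
  set T := ‖FD‖ + ‖N‖ + ‖V‖ with hT
  have hT0 : 0 ≤ T := by positivity
  have hshift := hprob fD v fN u G FD V W N hFD hN hV hW hs
  have hWT : ‖W‖ ≤ (C₁ + c) * T := by
    obtain ⟨M, U, F, N₀, h⟩ := hshift ⟨0, by omega⟩
    calc ‖W‖ ≤ c * T := h.norm_W
      _ ≤ _ := by gcongr; linarith
  have hb := hbr W ((C₁ + c) * T) (by positivity) hWT fun i j => by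
    obtain ⟨M, U, F, N₀, h⟩ := hshift i
    refine (hreg _ _ _ _ _ _ _ _ hT0 h j).trans ?_
    have := (scale_pos j).le
    gcongr
    linarith
  obtain ⟨R, hR, hRn⟩ := exists_besselPotential_eq (r := δ - ε) (f := W)
    ⟨((Complex.continuous_ofReal.comp (continuous_bracket _)).aestronglyMeasurable.mul
        (Lp.aestronglyMeasurable _)), hb.trans_lt ENNReal.ofReal_lt_top⟩
  refine ⟨R, ?_, ?_⟩
  · rw [← hR, ← hW, besselPotential_besselPotential_apply]
    congr 2
    ring
  · rw [← hRn, ← ofReal_norm, ENNReal.ofReal_le_ofReal_iff (by positivity)] at hb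
    rwa [mul_assoc]

end Conclusion

end MixedExtension

end

theorem propositionC2 (n : ℕ) (hn : 2 ≤ n) (α : ℝ) (hα : α ∈ Set.Ioo (0 : ℝ) 1)
    (g : MixedExtension.E n → Matrix (Fin n) (Fin n) ℝ)
    (hg : MixedExtension.IsAdmissibleMetric g)
    (δ : ℝ) (hδ : δ ∈ Set.Ico (0 : ℝ) (1 / 2)) (ε : ℝ) (hε : ε ∈ Set.Ioo (0 : ℝ) δ) :
    ∃ C : ℝ≥0, 0 < C ∧
      ∀ (fD : Lp ℂ 2 (volume : Measure (MixedExtension.E n))) (fN : 𝓢'(MixedExtension.E n, ℂ))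
        (u : MixedExtension.E n × ℝ → ℂ) (G : MixedExtension.Field n)
        (v : Lp ℂ 2 (volume : Measure (MixedExtension.E n))),
        MemSobolev (α + δ) 2 (fD : 𝓢'(MixedExtension.E n, ℂ)) →
        MemSobolev (-α + δ) 2 fN →
        MemSobolev α 2 (v : 𝓢'(MixedExtension.E n, ℂ)) →
        MixedExtension.IsWeakSolution α g fD fN u G v →
        MemSobolev (α + δ - ε) 2 (v : 𝓢'(MixedExtension.E n, ℂ)) ∧
        MixedExtension.sobolevNorm (α + δ - ε) (v : 𝓢'(MixedExtension.E n, ℂ)) ≤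
          C * (MixedExtension.sobolevNorm (α + δ) (fD : 𝓢'(MixedExtension.E n, ℂ)) +
            MixedExtension.sobolevNorm (-α + δ)
              (smulLeftCLM ℂ (fun x => (MixedExtension.sqrtDet g x : ℂ)) fN) +
            MixedExtension.sobolevNorm α (v : 𝓢'(MixedExtension.E n, ℂ))) := by
  obtain ⟨h0, h1⟩ := hα
  obtain ⟨hε0, hεδ⟩ := hε
  obtain ⟨C, hC, hmain⟩ :=
    MixedExtension.exists_besselPotential_dirichlet_sub hn h0 h1 hg hδ.2 hε0 hεδ
  refine ⟨Real.toNNReal C + 1, by positivity, fun fD fN u G v hfD hfN hv hs => ?_⟩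
  obtain ⟨FD, hFD⟩ := hfD
  obtain ⟨N, hN⟩ := hg.memSobolev_smulLeftCLM_sqrtDet hfN
  obtain ⟨V, hV⟩ := hv
  obtain ⟨R, hR, hRn⟩ := hmain fD v fN u G FD V N hFD hN hV hs
  obtain ⟨F, hF, hFn⟩ :=
    MixedExtension.exists_besselPotential_of_le (by linarith : α + δ - ε ≤ α + δ) hFD
  have hvR := MixedExtension.besselPotential_coe_add hR hF
  rw [sub_add_cancel] at hvR
  refine ⟨⟨_, hvR⟩, ?_⟩
  rw [MixedExtension.sobolevNorm_of_eq hvR, MixedExtension.sobolevNorm_of_eq hFD,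
    MixedExtension.sobolevNorm_of_eq hN, MixedExtension.sobolevNorm_of_eq hV]
  have hle : ‖R + F‖ ≤ (C + 1) * (‖FD‖ + ‖N‖ + ‖V‖) := by
    refine (norm_add_le _ _).trans ?_
    linarith [norm_nonneg N, norm_nonneg V]
  calc ‖R + F‖ₑ = ENNReal.ofReal ‖R + F‖ := (ofReal_norm _).symm
    _ ≤ ENNReal.ofReal ((C + 1) * (‖FD‖ + ‖N‖ + ‖V‖)) := ENNReal.ofReal_le_ofReal hle
    _ = _ := by
      rw [ENNReal.ofReal_mul (by positivity), ENNReal.ofReal_add hC zero_le_one,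
        ENNReal.ofReal_add (by positivity) (norm_nonneg _),
        ENNReal.ofReal_add (norm_nonneg _) (norm_nonneg _), ofReal_norm, ofReal_norm, ofReal_norm,
        ENNReal.ofReal_one]
      push_cast
      rfl
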